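/- **Conventions.** A directed graph has a set $V$ of vertices, a set $E$ of edges and source and target maps $\mathfrak s,\mathfrak t$, extended to $V\sqcup E$ by the identity on $V$; a graph morphism consists of maps $V(G)\to V(G')$ and $E(G)\to V(G')\sqcup E(G')$ compatible with $\mathfrak s,\mathfrak t$ (edges may go to vertices). A *smooth map* $A\to B$ between subsets $A\subset M_A$, $B\subset M_B$ of smooth manifolds is a germ along $A$ of smooth maps $f$ from an open neighborhood of $A$ to $M_B$ with $f(A)\subset B$; it is a submersion (embedding) if some representative is. A *hybrid system* $H$ consists of a directed graph; for each vertex $v$ a manifold $M_v$, a smooth vector field $X_v$ on $M_v$, an active set $I_v\subset M_v$ and a flow set $F_v\subset I_v$; and for each edge $e$ a guard $Z_e\subset I_{\mathfrak s(e)}$ and a reset map $r_e\colon Z_e\to I_{\mathfrak t(e)}$. For a vertex $v$ put $Z_v:=F_v$ and let $r_v$ be the inclusion $F_v\hookrightarrow I_v$. A *hybrid semiconjugacy* $\alpha\colon H\to K$ is a graph morphism $\alpha$ together with smooth maps $\alpha_v\colon I_v\to I_{\alpha(v)}$ such that $\alpha_v(F_v)\subset F_{\alpha(v)}$ and $\alpha_v$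 carries $X_v$ to $X_{\alpha(v)}$ near $F_v$, and such that for every edge $e$, $\alpha_{\mathfrak s(e)}(Z_e)\subset Z_{\alpha(e)}$ and $\alpha_{\mathfrak t(e)}\circ r_e=r_{\alpha(e)}\circ\alpha_{\mathfrak s(e)}$ on $Z_e$. Let $\mathbf H_\emptyset$ be the resulting category and $\mathbf H$ the full subcategory of systems with no empty active set and no empty guard. The state space is $I(H)=\bigsqcup_v I_v$, and $I(\alpha)\colon I(H)\to I(K)$ is the induced map. A *hybrid embedding* is a semiconjugacy whose graph morphism is monic and all of whose components $\alpha_v$ are embeddings. A *hybrid submersion* is a semiconjugacy all of whose components are submersions; it *covers active sets* if $I_u=\bigcup_{\alpha(v)=u}\alpha_v(I_v)$ for every vertex $u$ of the target, and it is a *hybrid surjective submersion* if it covers active sets and its graph morphism is epic. A *hybrid time trajectory* $\tau$ is a nondecreasing sequence $0=\tau_0\le\tau_1\le\cdots$ in $[0,\infty]$ indexed by $0\le j\le N$, $1\le N\le\infty$, with $\tau_j<\infty$ for $j<N$, together with an endpoint type, open or closed, which can be closed only if $N<\infty$ and must be closed if $N<\infty$ and $\tau_N=\tau_{N-1}$.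 It is viewed as the hybrid system on the path with vertices $0\le j<N$, where the mode $j$ has ambient manifold $\mathbb R$, vector field $d/dt$, $F_j=[\tau_j,\tau_{j+1})$, and $I_j=[\tau_j,\tau_{j+1}]\cap\mathbb R$ (but $I_{N-1}=[\tau_{N-1},\tau_N)$ for open type), and where the edge $j\to j+1$ has guard $\{\tau_{j+1}\}$ and reset map induced by $\mathrm{id}_{\mathbb R}$. It is infinite if $\sup_j\tau_j=\infty$. An *execution* of $H$ is a semiconjugacy $\chi\colon\tau\to H$; it starts at the image of the point $0$ of the mode $0$, and $\chi(t)$ is the set of images of all points of $I(\tau)$ with value $t$; $\mathcal E^\infty_H(x)$ is the set of executions from $x$ over infinite $\tau$. A *refinement* is a hybrid surjective submersion $\sigma\to\tau$ of time trajectories. A *hybrid subdivision* is a hybrid submersion $p\colon S\to H$ in $\mathbf H$ such that every execution $\chi\colon\tau\to H$ has a fiber product with $p$ in $\mathbf H$ of the form $\tau\xleftarrow{\ \xi\ }\sigma\to S$ with $\xi$ a refinement. $A\subset I(H)$ is *positively invariant* if $\chi(t)\subset A$ for all $x\in A$, $\chi\in\mathcal E^\infty_H(x)$, $t\ge0$.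 A positively invariant $A$ is *attracting with isolating neighborhood $W$* if $W$ is a neighborhood of $A$ in $I(H)$ and $A=\bigcap_{t\ge0}\{y\in\chi(t)\mid x\in W,\ \chi\in\mathcal E^\infty_H(x)\}$. $W\subset I(H)$ is a *trapping region* if $\mathcal E^\infty_H(w)\ne\emptyset$ for all $w\in W$, $W$ is positively invariant, and there is $T>0$ with $\chi(t)\subset W^\circ$ for all $x\in\overline W$, $\chi\in\mathcal E^\infty_H(x)$, $t\ge T$. **Statement.** Let $K_1,K_2,H\in\mathbf H$, let $i\colon K_2\to H$ be a hybrid embedding and $p\colon K_1\to H$ a hybrid submersion. Then a fiber product $K_1\xleftarrow{\ \tilde i\ }L\xrightarrow{\ \tilde p\ }K_2$ of $p$ and $i$ exists in $\mathbf H$, and every such fiber product has the following properties. 1. $\tilde p$ is a hybrid submersion and $\tilde i$ is a hybrid embedding. 2. If $p$ is a hybrid subdivision, then so is $\tilde p$. 3. If $p$ is a hybrid surjective submersion, then $\tilde p$ covers active sets; and $\tilde p$ is a hybrid surjective submersion if and only if for every edge $e_2$ of $K_2$ there are an edge $e_1$ of $K_1$ with $p(e_1)=i(e_2)$ and points $x_1\in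 Z_{e_1}$, $x_2\in Z_{e_2}$ with $p(x_1)=i(x_2)$. 4. Let $p$ be a hybrid subdivision and $W\subset I(H)$. If $I(i)(I(K_2))$ is attracting in $H$ with isolating neighborhood $W$, then $I(\tilde i)(I(L))$ is attracting in $K_1$ with isolating neighborhood $I(p)^{-1}(W)$. If $W$ is a trapping region for $H$, then $I(p)^{-1}(W)$ is a trapping region for $K_1$. A fiber product $L$ of $p$ and $i$ exists also in $\mathbf H_\emptyset$, and for every such $L$ the map $\tilde p$ is a hybrid submersion, $\tilde i$ is a hybrid embedding, and if $p$ is a hybrid surjective submersion, then so is $\tilde p$. -/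

import Mathlib

open CategoryTheory hiding Quotient
open Set Filter Topology
open scoped Manifold ContDiff

noncomputable section

namespace Hybrid

/-! ### Directed graphs, with morphisms that may send edges to vertices -/

/-- A directed graph. -/
structure DirGraph where
  V : Type
  E : Type
  src : E → V
  tgt : E → V

namespace DirGraph

/-- The source map on `V ⊔ E`, which is the identity on vertices. -/
def gsrc (G : DirGraph) : G.V ⊕ G.E → G.V := Sum.elim id G.src

/-- The target map on `V ⊔ E`, which is the identity on vertices. -/
def gtgt (G : DirGraph) : G.V ⊕ G.E → G.V := Sum.elim id G.tgt

/-- A graph morphism: edges may go to edges or to vertices. -/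
@[ext]
structure Hom (G G' : DirGraph) where
  vmap : G.V → G'.V
  emap : G.E → G'.V ⊕ G'.E
  src_emap : ∀ e, G'.gsrc (emap e) = vmap (G.src e)
  tgt_emap : ∀ e, G'.gtgt (emap e) = vmap (G.tgt e)

/-- The action of a graph morphism on `V ⊔ E`. -/
def Hom.gmap {G G' : DirGraph} (f : Hom G G') : G.V ⊕ G.E → G'.V ⊕ G'.E :=
  Sum.elim (fun v => Sum.inl (f.vmap v)) f.emap

theorem Hom.gsrc_gmap {G G' : DirGraph} (f : Hom G G') (a : G.V ⊕ G.E) :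
    G'.gsrc (f.gmap a) = f.vmap (G.gsrc a) := by
  cases a with
  | inl v => rfl
  | inr e => exact f.src_emap e

theorem Hom.gtgt_gmap {G G' : DirGraph} (f : Hom G G') (a : G.V ⊕ G.E) :
    G'.gtgt (f.gmap a) = f.vmap (G.gtgt a) := by
  cases a with
  | inl v => rfl
  | inr e => exact f.tgt_emap e

/-- The category of directed graphs. -/
instance : Category DirGraph where
  Hom := Hom
  id G := ⟨id, Sum.inr, fun _ => rfl, fun _ => rfl⟩
  comp f g :=
    { vmap := fun v => g.vmap (f.vmap v)
      emap := fun e => g.gmap (f.emap e)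
      src_emap := fun e => by rw [g.gsrc_gmap, f.src_emap]
      tgt_emap := fun e => by rw [g.gtgt_gmap, f.tgt_emap] }
  id_comp f := rfl
  comp_id f := by
    refine Hom.ext rfl (funext fun e => ?_)
    change Hom.gmap _ (f.emap e) = f.emap e
    cases f.emap e <;> rfl
  assoc f g h := by
    refine Hom.ext rfl (funext fun e => ?_)
    change Hom.gmap h (Hom.gmap g (f.emap e)) = Hom.gmap _ (f.emap e)
    cases f.emap e <;> rfl

end DirGraph

/-! ### Smooth sets -/

/-- A smooth set: an arbitrary subset `carrier` of a smooth manifold `M` without boundary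
(finite-dimensional, Hausdorff, second countable). The manifold is asked to be nonempty so that a
smooth map defined near `carrier` can be represented by a total function; up to isomorphism of
smooth sets this only concerns the choice of the ambient manifold of an empty carrier. -/
structure SmoothSet where
  E : Type
  [normedAddCommGroup : NormedAddCommGroup E]
  [normedSpace : NormedSpace ℝ E]
  [finiteDimensional : FiniteDimensional ℝ E]
  M : Type
  [topologicalSpace : TopologicalSpace M]
  [chartedSpace : ChartedSpace E M]
  [isManifold : IsManifold 𝓘(ℝ, E) ∞ M]
  [t2Space : T2Space M]
  [secondCountable : SecondCountableTopology M]
  [nonempty : Nonempty M]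
  carrier : Set M

attribute [instance] SmoothSet.normedAddCommGroup SmoothSet.normedSpace
  SmoothSet.finiteDimensional SmoothSet.topologicalSpace SmoothSet.chartedSpace
  SmoothSet.isManifold SmoothSet.t2Space SmoothSet.secondCountable SmoothSet.nonempty

namespace SmoothSet

/-- `f` represents a smooth map `A → B`: it is smooth on an open neighborhood of `A`, and
`f(A) ⊆ B`. The values of `f` away from a neighborhood of `A` are irrelevant: representatives are
only considered up to equality near `A`. -/
structure IsSmoothRep (A B : SmoothSet) (f : A.M → B.M) : Prop where
  smooth : ∀ᶠ x in 𝓝ˢ A.carrier, ContMDiffAt 𝓘(ℝ, A.E) 𝓘(ℝ, B.E) ∞ f x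
  mapsTo : MapsTo f A.carrier B.carrier

theorem IsSmoothRep.id (A : SmoothSet) : IsSmoothRep A A (fun x => x) :=
  ⟨Eventually.of_forall fun _ => contMDiffAt_id, fun _ hx => hx⟩

theorem IsSmoothRep.tendsto {A B : SmoothSet} {f : A.M → B.M} (h : IsSmoothRep A B f)
    {s : Set A.M} {t : Set B.M} (hs : s ⊆ A.carrier) (hst : MapsTo f s t) :
    Tendsto f (𝓝ˢ s) (𝓝ˢ t) := by
  refine tendsto_def.2 fun u hu => mem_nhdsSet_iff_forall.2 fun x hx => ?_
  have hc : ContinuousAt f x := (h.smooth.self_of_nhdsSet x (hs hx)).continuousAt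
  exact hc (mem_nhdsSet_iff_forall.1 hu _ (hst hx))

theorem IsSmoothRep.comp {A B C : SmoothSet} {f : A.M → B.M} {g : B.M → C.M}
    (hf : IsSmoothRep A B f) (hg : IsSmoothRep B C g) :
    IsSmoothRep A C (fun x => g (f x)) where
  smooth := by
    have ht := hf.tendsto Subset.rfl hf.mapsTo
    filter_upwards [hf.smooth, ht.eventually hg.smooth] with x hx hx'
    exact ContMDiffAt.comp x hx' hx
  mapsTo := fun _ hx => hg.mapsTo (hf.mapsTo hx)

/-- On some open neighborhood of `A`, the map `f` is a submersion. -/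
def IsSubmersionRep (A B : SmoothSet) (f : A.M → B.M) : Prop :=
  ∃ U : Set A.M, IsOpen U ∧ A.carrier ⊆ U ∧ ContMDiffOn 𝓘(ℝ, A.E) 𝓘(ℝ, B.E) ∞ f U ∧
    ∀ x ∈ U, Function.Surjective (mfderiv 𝓘(ℝ, A.E) 𝓘(ℝ, B.E) f x)

/-- On some open neighborhood of `A`, the map `f` is a smooth embedding (an immersion that is a
homeomorphism onto its image). -/
def IsEmbeddingRep (A B : SmoothSet) (f : A.M → B.M) : Prop :=
  ∃ U : Set A.M, IsOpen U ∧ A.carrier ⊆ U ∧ ContMDiffOn 𝓘(ℝ, A.E) 𝓘(ℝ, B.E) ∞ f U ∧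
    (∀ x ∈ U, Function.Injective (mfderiv 𝓘(ℝ, A.E) 𝓘(ℝ, B.E) f x)) ∧
    Topology.IsEmbedding (U.domRestrict f)

end SmoothSet

/-! ### Hybrid systems -/

/-- A continuous mode: an active set in an ambient manifold, a smooth vector field on the ambient
manifold, and a flow set inside the active set. -/
structure Mode extends SmoothSet where
  X : ∀ x : M, TangentSpace 𝓘(ℝ, E) x
  smooth_X : ContMDiff 𝓘(ℝ, E) 𝓘(ℝ, E).tangent ∞
    (fun x => (⟨x, X x⟩ : TangentBundle 𝓘(ℝ, E) M))
  flow : Set M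
  flow_subset : flow ⊆ carrier

/-- `f` is compatible with the continuous dynamics of `A` and `B`: it maps `F_A` into `F_B` and
carries the vector field of `A` to that of `B` on an open neighborhood of `F_A`. -/
structure Mode.IsSemiconjRep (A B : Mode) (f : A.M → B.M) : Prop where
  mapsTo : MapsTo f A.flow B.flow
  semiconj : ∀ᶠ x in 𝓝ˢ A.flow, mfderiv 𝓘(ℝ, A.E) 𝓘(ℝ, B.E) f x (A.X x) = B.X (f x)

theorem Mode.IsSemiconjRep.id (A : Mode) : A.IsSemiconjRep A (fun x => x) where
  mapsTo := fun _ hx => hx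
  semiconj := Eventually.of_forall fun x => by
    have h := mfderiv_id (I := 𝓘(ℝ, A.E)) (x := x)
    exact congrArg (fun L => L (A.X x)) h

theorem Mode.IsSemiconjRep.comp {A B C : Mode} {f : A.M → B.M} {g : B.M → C.M}
    (hf : A.IsSemiconjRep B f) (hg : B.IsSemiconjRep C g)
    (sf : SmoothSet.IsSmoothRep A.toSmoothSet B.toSmoothSet f)
    (sg : SmoothSet.IsSmoothRep B.toSmoothSet C.toSmoothSet g) :
    A.IsSemiconjRep C (fun x => g (f x)) where
  mapsTo := fun _ hx => hg.mapsTo (hf.mapsTo hx)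
  semiconj := by
    have ht := sf.tendsto A.flow_subset hf.mapsTo
    filter_upwards [hf.semiconj, ht.eventually hg.semiconj,
      sf.smooth.filter_mono (nhdsSet_mono A.flow_subset),
      ht.eventually (sg.smooth.filter_mono (nhdsSet_mono B.flow_subset))] with x h1 h2 h3 h4
    have hc := mfderiv_comp x (h4.mdifferentiableAt (by simp)) (h3.mdifferentiableAt (by simp))
    refine (congrArg (fun L => L (A.X x)) hc).trans (Eq.trans ?_ h2)
    exact congrArg (mfderiv 𝓘(ℝ, B.E) 𝓘(ℝ, C.E) g (f x)) h1

/-- A hybrid system (empty active sets and empty guards are allowed). -/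
structure HybridSystem where
  graph : DirGraph
  mode : graph.V → Mode
  guard : ∀ e : graph.E, Set (mode (graph.src e)).M
  guard_subset : ∀ e, guard e ⊆ (mode (graph.src e)).carrier
  reset : ∀ e, guard e → (mode (graph.tgt e)).carrier

namespace HybridSystem

/-- The hybrid state space `I(H)`, the disjoint union of the active sets, with its topology. -/
abbrev State (H : HybridSystem) : Type := Σ v : H.graph.V, ↥(H.mode v).carrier

/-- `H.Step a x y`: the point `x` lies in the guard `Z_a` and `r_a x = y`, where for a vertex `a`
one puts `Z_a = F_a`, with `r_a` the inclusion of the flow set. -/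
inductive Step (H : HybridSystem) : H.graph.V ⊕ H.graph.E → H.State → H.State → Prop
  | flow (v : H.graph.V) (x : (H.mode v).carrier) (hx : x.1 ∈ (H.mode v).flow) :
      Step H (Sum.inl v) ⟨v, x⟩ ⟨v, x⟩
  | jump (e : H.graph.E) (x : H.guard e) :
      Step H (Sum.inr e) ⟨H.graph.src e, ⟨x.1, H.guard_subset e x.2⟩⟩
        ⟨H.graph.tgt e, H.reset e x⟩

/-- No empty active sets and no empty guards: these are the objects of the category `𝐇`, a full
subcategory of the category `𝐇_∅` of all hybrid systems. -/
def IsPruned (H : HybridSystem) : Prop :=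
  (∀ v, (H.mode v).carrier.Nonempty) ∧ ∀ e, (H.guard e).Nonempty

/-- A family of representatives of smooth maps of active sets over a graph morphism. -/
structure PreRep (H K : HybridSystem) where
  gr : H.graph ⟶ K.graph
  map : ∀ v, (H.mode v).M → (K.mode (gr.vmap v)).M
  isSmooth : ∀ v, SmoothSet.IsSmoothRep (H.mode v).toSmoothSet (K.mode (gr.vmap v)).toSmoothSet
    (map v)

/-- The induced map of hybrid state spaces. -/
def PreRep.stateMap {H K : HybridSystem} (f : PreRep H K) (x : H.State) : K.State :=
  ⟨f.gr.vmap x.1, ⟨f.map x.1 x.2.1, (f.isSmooth x.1).mapsTo x.2.2⟩⟩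

/-- A representative of a hybrid semiconjugacy. -/
structure Rep (H K : HybridSystem) extends PreRep H K where
  isSemiconj : ∀ v, (H.mode v).IsSemiconjRep (K.mode (gr.vmap v)) (map v)
  map_step : ∀ (e : H.graph.E) (x : H.guard e),
    K.Step (gr.emap e)
      (toPreRep.stateMap ⟨H.graph.src e, ⟨x.1, H.guard_subset e x.2⟩⟩)
      (toPreRep.stateMap ⟨H.graph.tgt e, H.reset e x⟩)

/-- Germ equivalence: equal graph morphisms, and at each vertex `v` maps that agree on a
neighborhood of the active set of `v`. -/
def Rep.Equiv {H K : HybridSystem} (f g : Rep H K) : Prop :=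
  f.gr = g.gr ∧ ∀ v, ∀ᶠ x in 𝓝ˢ (H.mode v).carrier,
    (⟨f.gr.vmap v, f.map v x⟩ : Σ u, (K.mode u).M) = ⟨g.gr.vmap v, g.map v x⟩

instance repSetoid (H K : HybridSystem) : Setoid (Rep H K) where
  r := Rep.Equiv
  iseqv :=
    { refl := fun _ => ⟨rfl, fun _ => Eventually.of_forall fun _ => rfl⟩
      symm := fun h => ⟨h.1.symm, fun v => (h.2 v).mono fun _ hx => hx.symm⟩
      trans := fun h h' => ⟨h.1.trans h'.1, fun v => by
        filter_upwards [h.2 v, h'.2 v] with x hx hx'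
        exact hx.trans hx'⟩ }

/-- The identity. -/
def Rep.id (H : HybridSystem) : Rep H H where
  gr := 𝟙 H.graph
  map := fun _ x => x
  isSmooth := fun v => SmoothSet.IsSmoothRep.id (H.mode v).toSmoothSet
  isSemiconj := fun v => Mode.IsSemiconjRep.id (H.mode v)
  map_step := fun e x => Step.jump e x

theorem Rep.step_stateMap {H K : HybridSystem} (f : Rep H K) {a : H.graph.V ⊕ H.graph.E}
    {x y : H.State} (h : H.Step a x y) :
    K.Step (f.gr.gmap a) (f.stateMap x) (f.stateMap y) := by
  cases h with
  | flow v x hx => exact Step.flow _ _ ((f.isSemiconj v).mapsTo hx)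
  | jump e x => exact f.map_step e x

/-- Composition of representatives. -/
def Rep.comp {H K L : HybridSystem} (f : Rep H K) (g : Rep K L) : Rep H L where
  gr := f.gr ≫ g.gr
  map := fun v x => g.map (f.gr.vmap v) (f.map v x)
  isSmooth := fun v => (f.isSmooth v).comp (g.isSmooth (f.gr.vmap v))
  isSemiconj := fun v => (f.isSemiconj v).comp (g.isSemiconj (f.gr.vmap v)) (f.isSmooth v)
    (g.isSmooth (f.gr.vmap v))
  map_step := fun e x => g.step_stateMap (f.map_step e x)

theorem Rep.comp_equiv {H K L : HybridSystem} {f f' : Rep H K} {g g' : Rep K L}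
    (hf : f ≈ f') (hg : g ≈ g') : f.comp g ≈ f'.comp g' := by
  refine ⟨show f.gr ≫ g.gr = f'.gr ≫ g'.gr by rw [hf.1, hg.1], fun v => ?_⟩
  have ht := (f.isSmooth v).tendsto Subset.rfl (f.isSmooth v).mapsTo
  filter_upwards [hf.2 v, ht.eventually (hg.2 (f.gr.vmap v))] with x h1 h2
  refine Eq.trans h2 ?_
  exact congrArg (fun q : (Σ u, (K.mode u).M) =>
    (⟨g'.gr.vmap q.1, g'.map q.1 q.2⟩ : Σ u, (L.mode u).M)) h1

/-- The category `𝐇_∅` of hybrid systems. A morphism, called a hybrid semiconjugacy, is a germ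
equivalence class of representatives. -/
instance : Category HybridSystem where
  Hom H K := Quotient (repSetoid H K)
  id H := Quotient.mk _ (Rep.id H)
  comp f g := Quotient.map₂ Rep.comp (fun _ _ hf _ _ hg => Rep.comp_equiv hf hg) f g
  id_comp f := Quotient.inductionOn f fun f => Quotient.sound
    ⟨Category.id_comp f.gr, fun _ => Eventually.of_forall fun _ => rfl⟩
  comp_id f := Quotient.inductionOn f fun f => Quotient.sound
    ⟨Category.comp_id f.gr, fun _ => Eventually.of_forall fun _ => rfl⟩
  assoc f g h := Quotient.inductionOn₃ f g h fun f g h => Quotient.sound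
    ⟨Category.assoc f.gr g.gr h.gr, fun _ => Eventually.of_forall fun _ => rfl⟩

/-- The representative `r` represents the hybrid semiconjugacy `f`. -/
def Represents {H K : HybridSystem} (r : Rep H K) (f : H ⟶ K) : Prop :=
  Quotient.mk (repSetoid H K) r = f

/-- The graph morphism `G(f)` of a hybrid semiconjugacy. -/
def graphMap {H K : HybridSystem} (f : H ⟶ K) : H.graph ⟶ K.graph :=
  Quotient.lift (s := repSetoid H K) (fun r : Rep H K => r.gr) (fun _ _ h => h.1) f

theorem sigma_subtype_eq {ι : Type} {M : ι → Type} {s : ∀ i, Set (M i)} {i j : ι} {x : M i}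
    {y : M j} (hx : x ∈ s i) (hy : y ∈ s j) (h : (⟨i, x⟩ : Σ i, M i) = ⟨j, y⟩) :
    (⟨i, ⟨x, hx⟩⟩ : Σ i, ↥(s i)) = ⟨j, ⟨y, hy⟩⟩ := by
  cases h
  rfl

/-- The map `I(f) : I(H) → I(K)` of hybrid state spaces. -/
def stateMap {H K : HybridSystem} (f : H ⟶ K) : H.State → K.State :=
  Quotient.lift (s := repSetoid H K) (fun r : Rep H K => r.stateMap)
    (fun f g h => funext fun x =>
      sigma_subtype_eq (M := fun v => (K.mode v).M) (s := fun v => (K.mode v).carrier)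
        ((f.isSmooth x.1).mapsTo x.2.2) ((g.isSmooth x.1).mapsTo x.2.2)
        ((h.2 x.1).self_of_nhdsSet x.2.1 x.2.2)) f

/-! ### Embeddings, submersions and fiber products -/

/-- A hybrid embedding. -/
def IsEmbedding {H K : HybridSystem} (f : H ⟶ K) : Prop :=
  Mono (graphMap f) ∧ ∃ r : Rep H K, Represents r f ∧ ∀ v,
    SmoothSet.IsEmbeddingRep (H.mode v).toSmoothSet (K.mode (r.gr.vmap v)).toSmoothSet (r.map v)

/-- A hybrid submersion. -/
def IsSubmersion {H K : HybridSystem} (f : H ⟶ K) : Prop :=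
  ∃ r : Rep H K, Represents r f ∧ ∀ v,
    SmoothSet.IsSubmersionRep (H.mode v).toSmoothSet (K.mode (r.gr.vmap v)).toSmoothSet (r.map v)

/-- For each vertex `u` of the target, `I_u` is the union of the sets `f_v(I_v)` over the
vertices `v` with `f(v) = u`. -/
def CoversActive {H K : HybridSystem} (f : H ⟶ K) : Prop :=
  ∀ (u : K.graph.V) (y : (K.mode u).carrier), ∃ (v : H.graph.V) (x : (H.mode v).carrier),
    stateMap f ⟨v, x⟩ = ⟨u, y⟩

/-- A hybrid surjective submersion. -/
def IsSurjectiveSubmersion {H K : HybridSystem} (f : H ⟶ K) : Prop :=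
  IsSubmersion f ∧ Epi (graphMap f) ∧ CoversActive f

/-- The cone `K₁ ⟵ L ⟶ K₂` is a fiber product of `p : K₁ ⟶ H` and `i : K₂ ⟶ H` in the full
subcategory of hybrid systems satisfying `P`. -/
def IsFiberProduct (P : HybridSystem → Prop) {K₁ K₂ H L : HybridSystem} (p : K₁ ⟶ H) (i : K₂ ⟶ H)
    (π₁ : L ⟶ K₁) (π₂ : L ⟶ K₂) : Prop :=
  P L ∧ π₁ ≫ p = π₂ ≫ i ∧
    ∀ T : HybridSystem, P T → ∀ (a : T ⟶ K₁) (b : T ⟶ K₂), a ≫ p = b ≫ i →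
      ∃! l : T ⟶ L, l ≫ π₁ = a ∧ l ≫ π₂ = b

end HybridSystem

/-! ### Hybrid time trajectories and executions -/

/-- A hybrid time trajectory. Only the values `τ j` with `j ≤ N` (`j < ∞` if `N = ∞`) matter;
`closed` says that the final endpoint type is "closed". -/
structure TimeTrajectory where
  N : ℕ∞
  τ : ℕ → EReal
  closed : Prop
  one_le : 1 ≤ N
  τ_zero : τ 0 = 0
  mono : ∀ j : ℕ, (j : ℕ∞) + 1 ≤ N → τ j ≤ τ (j + 1)
  ne_top : ∀ j : ℕ, (j : ℕ∞) < N → τ j ≠ ⊤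
  finite_of_closed : closed → N < ⊤
  closed_of_eq : ∀ j : ℕ, (j : ℕ∞) + 1 = N → τ (j + 1) = τ j → closed

namespace TimeTrajectory

/-- The stop time: `τ_N` if `N` is finite, and `lim τ_j` if `N = ∞`. Since the sequence is
nondecreasing, this is the supremum of its terms. -/
def stopTime (σ : TimeTrajectory) : EReal := ⨆ (j : ℕ) (_ : (j : ℕ∞) ≤ σ.N), σ.τ j

/-- A time trajectory is infinite if its stop time is `∞`. -/
def IsInfinite (σ : TimeTrajectory) : Prop := σ.stopTime = ⊤

/-- The directed path with vertices `0, …, N - 1` and edges `j ⟶ j + 1`. -/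
def graph (σ : TimeTrajectory) : DirGraph where
  V := {j : ℕ // (j : ℕ∞) < σ.N}
  E := {j : ℕ // ((j + 1 : ℕ) : ℕ∞) < σ.N}
  src := fun e => ⟨e.1, lt_of_le_of_lt (by exact_mod_cast Nat.le_succ e.1) e.2⟩
  tgt := fun e => ⟨e.1 + 1, e.2⟩

/-- The active interval `[τ_j, τ_{j+1}]`, or `[τ_j, τ_{j+1})` if it is the last one and the final
endpoint type is open. -/
def active (σ : TimeTrajectory) (j : ℕ) : Set ℝ :=
  {x | σ.τ j ≤ (x : EReal) ∧ (x : EReal) ≤ σ.τ (j + 1) ∧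
    ((j : ℕ∞) + 1 = σ.N → ¬ σ.closed → (x : EReal) < σ.τ (j + 1))}

/-- The flow interval `[τ_j, τ_{j+1})`. -/
def flow (σ : TimeTrajectory) (j : ℕ) : Set ℝ :=
  {x | σ.τ j ≤ (x : EReal) ∧ (x : EReal) < σ.τ (j + 1)}

theorem mem_active_left (σ : TimeTrajectory) {j : ℕ} (h : (j : ℕ∞) < σ.N) {x : ℝ}
    (hx : (x : EReal) = σ.τ j) : x ∈ σ.active j := by
  have hm : σ.τ j ≤ σ.τ (j + 1) := σ.mono _ (Order.add_one_le_of_lt h)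
  refine ⟨hx.ge, hx ▸ hm, fun hN hc => ?_⟩
  rw [hx]
  exact lt_of_le_of_ne hm fun heq => hc (σ.closed_of_eq _ hN heq.symm)

theorem mem_active_right (σ : TimeTrajectory) {j : ℕ} (h : ((j + 1 : ℕ) : ℕ∞) < σ.N) {x : ℝ}
    (hx : (x : EReal) = σ.τ (j + 1)) : x ∈ σ.active j := by
  refine ⟨?_, hx.le, fun hN => ?_⟩
  · rw [hx]
    exact σ.mono _ (by exact_mod_cast h.le)
  · rw [← hN] at h
    exact absurd h (by push_cast; exact lt_irrefl _)

/-- The mode `(ℝ, d/dt)` at the vertex `j`. -/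
def mode (σ : TimeTrajectory) (j : ℕ) : Mode where
  E := ℝ
  M := ℝ
  carrier := σ.active j
  X := fun _ => (1 : ℝ)
  smooth_X := contMDiff_vectorSpace_iff_contDiff.2 contDiff_const
  flow := σ.flow j
  flow_subset := fun _ hx => ⟨hx.1, hx.2.le, fun _ _ => hx.2⟩

/-- The hybrid system of a time trajectory: the guard of the edge `j ⟶ j + 1` is `{τ_{j+1}}`, and
the reset maps are induced by the identity of `ℝ`. -/
def toSystem (σ : TimeTrajectory) : HybridSystem where
  graph := σ.graph
  mode := fun j => σ.mode j.1
  guard := fun e => {x : ℝ | (x : EReal) = σ.τ (e.1 + 1)}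
  guard_subset := fun e _ hx => σ.mem_active_right e.2 hx
  reset := fun e x => ⟨x.1, σ.mem_active_left e.2 x.2⟩

/-- The set `σ(t)` of time `t` points. -/
def points (σ : TimeTrajectory) (t : ℝ) : Set σ.toSystem.State :=
  {x | (show ℝ from x.2.1) = t}

/-- The starting point, `0` in the first interval. -/
def start (σ : TimeTrajectory) : σ.toSystem.State :=
  ⟨⟨0, lt_of_lt_of_le (by simp) σ.one_le⟩, ⟨(0 : ℝ),
    σ.mem_active_left (lt_of_lt_of_le (by simp) σ.one_le) (by rw [σ.τ_zero]; rfl)⟩⟩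

end TimeTrajectory

namespace HybridSystem

/-- `χ(t)`, the image under the execution `χ` of the time `t` points. -/
def at_time {H : HybridSystem} {σ : TimeTrajectory} (χ : σ.toSystem ⟶ H) (t : ℝ) : Set H.State :=
  stateMap χ '' σ.points t

/-- `χ` is an infinite execution of `H` that starts at `x`. -/
def IsInfiniteFrom {H : HybridSystem} {σ : TimeTrajectory} (χ : σ.toSystem ⟶ H) (x : H.State) :
    Prop :=
  σ.IsInfinite ∧ stateMap χ σ.start = x

/-- A set of states is positively invariant if infinite executions that start in it stay in it. -/
def PositivelyInvariant (H : HybridSystem) (A : Set H.State) : Prop :=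
  ∀ x ∈ A, ∀ (σ : TimeTrajectory) (χ : σ.toSystem ⟶ H), IsInfiniteFrom χ x →
    ∀ t : ℝ, 0 ≤ t → at_time χ t ⊆ A

/-- The intersection over `t ≥ 0` of the sets of points reached at time `t` by infinite executions
starting in `W`. -/
def limitSet (H : HybridSystem) (W : Set H.State) : Set H.State :=
  {y | ∀ t : ℝ, 0 ≤ t → ∃ x ∈ W, ∃ (σ : TimeTrajectory) (χ : σ.toSystem ⟶ H),
    IsInfiniteFrom χ x ∧ y ∈ at_time χ t}

/-- `A` is an attracting set with isolating neighborhood `W`. -/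
def IsAttractingWith (H : HybridSystem) (A W : Set H.State) : Prop :=
  PositivelyInvariant H A ∧ W ∈ 𝓝ˢ A ∧ A = limitSet H W

/-- `W` is a hybrid trapping region. -/
def IsTrappingRegion (H : HybridSystem) (W : Set H.State) : Prop :=
  (∀ w ∈ W, ∃ (σ : TimeTrajectory) (χ : σ.toSystem ⟶ H), IsInfiniteFrom χ w) ∧
    PositivelyInvariant H W ∧
    ∃ T : ℝ, 0 < T ∧ ∀ x ∈ closure W, ∀ (σ : TimeTrajectory) (χ : σ.toSystem ⟶ H),
      IsInfiniteFrom χ x → ∀ t : ℝ, T ≤ t → at_time χ t ⊆ interior W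

/-- A hybrid subdivision: a hybrid submersion in `𝐇` along which every execution `χ` of the target
(over `τ`) has a fiber product in `𝐇` of the form `τ ⟵ σ ⟶ S`, where `σ ⟶ τ` is a refinement,
that is, a hybrid surjective submersion of time trajectories. -/
def IsSubdivision {S H : HybridSystem} (p : S ⟶ H) : Prop :=
  S.IsPruned ∧ H.IsPruned ∧ IsSubmersion p ∧
    ∀ (τ : TimeTrajectory) (χ : τ.toSystem ⟶ H),
      ∃ (σ : TimeTrajectory) (ξ : σ.toSystem ⟶ τ.toSystem) (χ' : σ.toSystem ⟶ S),
        IsSurjectiveSubmersion ξ ∧ IsFiberProduct IsPruned p χ χ' ξ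

end HybridSystem

end Hybrid

end

/-! The fiber product is built vertex by vertex. Over a pair of vertices with the same image `u`
stand a germ of a submersion `f` into the mode of `u` and a germ of an embedding `g`. Since `f` is a
submersion, it is a projection in suitable local coordinates `(f, w)`, so the pairs `(x, y)` with `f
x = g y` form a manifold with local coordinates `(y, w x)`. The second projection is then a
submersion, and the first is an embedding because `g` is one.

The delicate datum is the vector field. The fields on the two factors are known to be related to the
field of the base only near the flow sets, while a mode needs a field on its whole ambient manifold.
The required field has to project to the second field everywhere, and to the first wherever the
images of the two fields in the base agree. These conditions are affine at each point and have local
solutions, so a partition of unity gives a global one (`FiberSetup.exists_vectorField`).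

The edges of the fiber product are pairs of an edge of `K₁` and a vertex or edge of `K₂` with the
same image. No others are needed: `i` is monic, so it sends no edge to a vertex. The guards and
resets are those of pairs of simultaneous steps. The first projection is a hybrid embedding, hence a
monomorphism; this gives uniqueness of lifts, and also shows that a lift respects vector fields.
This settles `𝐇_∅`. A morphism from a pruned system only meets nonempty active sets and guards, so
discarding the empty ones gives the fiber product in `𝐇`. All fiber products are isomorphic, and
isomorphisms are both embeddings and submersions.

The other properties use only the universal property. Maps from a one-point system are states, and
maps from a one-step system are steps; both systems are pruned. Hence the states of any fiber
product are the pairs of states with the same image, which yields covering of active sets and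
identifies the image of `i'` with the preimage of the image of `i`. A single edge with empty active
sets detects pairs of graph elements, but it lives only in `𝐇_∅`. This is why surjectivity passes to
`p'` there, while in `𝐇` it needs compatible points in the guards. Subdivisions are stable by
pasting of fiber products.

For the dynamics, the derivative of a morphism of time trajectories is `1` on flow intervals and
jumps take no time, so the morphism translates time. A refinement covers the start, so its
translation is zero: it keeps times, the start and infinite length. Thus infinite executions of `H`
lift along a subdivision with the same times, and a lift through a prescribed state at time `0` can
be restarted there. It follows that limit sets commute with preimages under `p`. Continuity of the
map of state spaces handles neighborhoods, closures and interiors. -/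

noncomputable section

namespace Hybrid

/-! ### The local normal form of a submersion -/

/-- A surjective linear map is completed to an isomorphism onto a product. -/
theorem exists_continuousLinearEquiv_prod {E G F : Type*} [NormedAddCommGroup E] [NormedSpace ℝ E]
    [FiniteDimensional ℝ E] [NormedAddCommGroup G] [NormedSpace ℝ G] [FiniteDimensional ℝ G]
    [NormedAddCommGroup F] [NormedSpace ℝ F] [FiniteDimensional ℝ F] (D : E →L[ℝ] G)
    (hD : Function.Surjective D)
    (hF : Module.finrank ℝ E = Module.finrank ℝ G + Module.finrank ℝ F) :
    ∃ (L : E →L[ℝ] F) (e : E ≃L[ℝ] G × F), (e : E →L[ℝ] G × F) = D.prod L := by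
  have hr : Module.finrank ℝ (D : E →ₗ[ℝ] G).ker = Module.finrank ℝ F := by
    have h := (D : E →ₗ[ℝ] G).finrank_range_add_finrank_ker
    rw [LinearMap.range_eq_top.2 hD, finrank_top] at h
    omega
  -- `P` is a linear retraction onto the kernel of `D`. Following it by an identification of the
  -- kernel with `F` gives the complementary coordinate `L`, which is injective on the kernel.
  obtain ⟨P, hP⟩ := (D : E →ₗ[ℝ] G).ker.subtype.exists_leftInverse_of_injective
    (Submodule.ker_subtype _)
  let q := LinearEquiv.ofFinrankEq _ F hr
  let L : E →ₗ[ℝ] F := q.toLinearMap ∘ₗ P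
  let T : E →ₗ[ℝ] G × F := (D : E →ₗ[ℝ] G).prod L
  have hT : Function.Injective T := by
    rw [← LinearMap.ker_eq_bot, LinearMap.ker_eq_bot']
    intro z hz
    have h1 : D z = 0 := congrArg Prod.fst hz
    have h2 : q (P z) = 0 := congrArg Prod.snd hz
    have h3 : P z = 0 := by simpa using h2
    have h4 := LinearMap.congr_fun hP ⟨z, h1⟩
    have h5 : (⟨z, h1⟩ : (D : E →ₗ[ℝ] G).ker) = 0 := h4.symm.trans h3
    simpa using congrArg Subtype.val h5
  have hdim : Module.finrank ℝ E = Module.finrank ℝ (G × F) := by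
    rw [Module.finrank_prod, hF]
  have hb : Function.Bijective T :=
    ⟨hT, (LinearMap.injective_iff_surjective_of_finrank_eq_finrank hdim).1 hT⟩
  refine ⟨LinearMap.toContinuousLinearMap L,
    (LinearEquiv.ofBijective T hb).toContinuousLinearEquiv, ?_⟩
  ext z <;> rfl

/-- A submersion between normed spaces is a projection in suitable coordinates. -/
theorem exists_straightening {E G F : Type*} [NormedAddCommGroup E] [NormedSpace ℝ E]
    [FiniteDimensional ℝ E] [NormedAddCommGroup G] [NormedSpace ℝ G] [FiniteDimensional ℝ G]
    [NormedAddCommGroup F] [NormedSpace ℝ F] [FiniteDimensional ℝ F] {f : E → G} {O : Set E}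
    (hO : IsOpen O) (hf : ContDiffOn ℝ ∞ f O) {a : E} (ha : a ∈ O)
    (hs : Function.Surjective (fderiv ℝ f a))
    (hF : Module.finrank ℝ E = Module.finrank ℝ G + Module.finrank ℝ F) :
    ∃ (L : E →L[ℝ] F) (e : OpenPartialHomeomorph E (G × F)), a ∈ e.source ∧ e.source ⊆ O ∧
      (∀ x, e x = (f x, L x)) ∧ ContDiffOn ℝ ∞ e.symm e.target := by
  have : CompleteSpace E := FiniteDimensional.complete ℝ E
  obtain ⟨L, q, hq⟩ := exists_continuousLinearEquiv_prod (F := F) _ hs hF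
  let g : E → G × F := fun x => (f x, L x)
  have hg : ∀ x ∈ O, ContDiffAt ℝ ∞ g x := fun x hx =>
    (hf.contDiffAt (hO.mem_nhds hx)).prodMk L.contDiff.contDiffAt
  have hgd : ∀ x ∈ O, HasFDerivAt g ((fderiv ℝ f x).prod L) x := fun x hx =>
    HasFDerivAt.prodMk ((hf.contDiffAt (hO.mem_nhds hx)).differentiableAt (by simp)).hasFDerivAt
      L.hasFDerivAt
  have hqa : HasFDerivAt g (q : E →L[ℝ] G × F) a := hq ▸ hgd a ha
  let e₀ := (hg a ha).toOpenPartialHomeomorph g hqa (by simp)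
  have hfd : ContinuousOn (fun x => (fderiv ℝ f x).prod L) O := by
    have h1 : ContinuousOn (fderiv ℝ f) O := hf.continuousOn_fderiv_of_isOpen hO (by simp)
    exact ((ContinuousLinearMap.prodₗᵢ ℝ).continuous.comp_continuousOn
      (h1.prodMk (continuousOn_const (c := L))) :)
  -- The invertible maps are open, so the derivative of `(f, L)` stays invertible near `a`.
  -- Restricting to this set makes the inverse smooth on the whole target and not only at the image
  -- of `a`.
  have hV : ∀ᶠ x in 𝓝 a, (fderiv ℝ f x).prod L ∈
      range ((↑) : (E ≃L[ℝ] G × F) → E →L[ℝ] G × F) := by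
    refine (hfd.continuousAt (hO.mem_nhds ha)).eventually ?_
    change range _ ∈ 𝓝 ((fderiv ℝ f a).prod L)
    rw [← hq]
    exact q.nhds
  obtain ⟨V, hV, hVo, haV⟩ := eventually_nhds_iff.1 hV
  refine ⟨L, e₀.restr (V ∩ O), ?_, ?_, fun x => rfl, ?_⟩
  · rw [e₀.restr_source' _ (hVo.inter hO)]
    exact ⟨(hg a ha).mem_toOpenPartialHomeomorph_source hqa (by simp), haV, ha⟩
  · rw [e₀.restr_source' _ (hVo.inter hO)]
    exact fun x hx => hx.2.2
  · intro y hy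
    have hx := (e₀.restr (V ∩ O)).map_target hy
    set x := (e₀.restr (V ∩ O)).symm y with hxdef
    rw [e₀.restr_source' _ (hVo.inter hO)] at hx
    obtain ⟨q', hq'⟩ := hV x hx.2.1
    refine (OpenPartialHomeomorph.contDiffAt_symm _ hy (f₀' := q') ?_ ?_).contDiffWithinAt
    · exact hq' ▸ hgd x hx.2.2
    · exact hg x hx.2.2

section Submersion

variable {EM EQ F : Type} [NormedAddCommGroup EM] [NormedSpace ℝ EM] [FiniteDimensional ℝ EM]
  [NormedAddCommGroup EQ] [NormedSpace ℝ EQ] [FiniteDimensional ℝ EQ]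
  [NormedAddCommGroup F] [NormedSpace ℝ F] [FiniteDimensional ℝ F]
  {M Q : Type} [TopologicalSpace M] [ChartedSpace EM M] [IsManifold 𝓘(ℝ, EM) ∞ M]
  [TopologicalSpace Q] [ChartedSpace EQ Q] [IsManifold 𝓘(ℝ, EQ) ∞ Q]

/-- Local coordinates `(f, w) : M → Q × F` of `M` near a point, adapted to a map `f : M → Q`,
with smooth inverse `r`. -/
structure AdaptedChart (EM EQ : Type) [NormedAddCommGroup EM] [NormedSpace ℝ EM]
    [NormedAddCommGroup EQ] [NormedSpace ℝ EQ] (F : Type) [NormedAddCommGroup F]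
    [NormedSpace ℝ F] {M Q : Type} [TopologicalSpace M] [ChartedSpace EM M] [TopologicalSpace Q]
    [ChartedSpace EQ Q] (f : M → Q) (U : Set M) where
  source : Set M
  w : M → F
  target : Set (Q × F)
  r : Q × F → M
  isOpen_source : IsOpen source
  source_subset : source ⊆ U
  isOpen_target : IsOpen target
  smooth_w : ContMDiffOn 𝓘(ℝ, EM) 𝓘(ℝ, F) ∞ w source
  smooth_r : ContMDiffOn (𝓘(ℝ, EQ).prod 𝓘(ℝ, F)) 𝓘(ℝ, EM) ∞ r target
  map_source : ∀ x ∈ source, (f x, w x) ∈ target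
  r_apply : ∀ x ∈ source, r (f x, w x) = x
  r_mem : ∀ z ∈ target, r z ∈ source
  f_r : ∀ z ∈ target, f (r z) = z.1
  w_r : ∀ z ∈ target, w (r z) = z.2

/-- Read in charts `φ` and `κ`, the map is a submersion of normed spaces and can be straightened.
The domain `O` keeps `f` inside the source of `κ`, so that injectivity of `κ` there gives back `f (r
z) = z.1` from the equation in charts. -/
theorem exists_adaptedChart {f : M → Q} {U : Set M} (hU : IsOpen U)
    (hf : ContMDiffOn 𝓘(ℝ, EM) 𝓘(ℝ, EQ) ∞ f U) {x₀ : M} (hx₀ : x₀ ∈ U)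
    (hs : Function.Surjective (mfderiv 𝓘(ℝ, EM) 𝓘(ℝ, EQ) f x₀))
    (hF : Module.finrank ℝ EM = Module.finrank ℝ EQ + Module.finrank ℝ F) :
    ∃ c : AdaptedChart EM EQ F f U, x₀ ∈ c.source := by
  have : IsManifold 𝓘(ℝ, EM) 1 M := IsManifold.of_le (n := ∞) (by simp)
  have : IsManifold 𝓘(ℝ, EQ) 1 Q := IsManifold.of_le (n := ∞) (by simp)
  let φ := chartAt EM x₀
  let κ := chartAt EQ (f x₀)
  let U' : Set M := U ∩ f ⁻¹' κ.source
  have hU' : IsOpen U' := hf.continuousOn.isOpen_inter_preimage hU κ.open_source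
  let O : Set EM := φ.target ∩ φ.symm ⁻¹' U'
  have hO : IsOpen O := φ.isOpen_inter_preimage_symm hU'
  have hφ0 : x₀ ∈ φ.source := mem_chart_source EM x₀
  have hκ0 : f x₀ ∈ κ.source := mem_chart_source EQ (f x₀)
  have ha : φ x₀ ∈ O := ⟨φ.map_source hφ0, by
    change φ.symm (φ x₀) ∈ U'
    rw [φ.left_inv hφ0]
    exact ⟨hx₀, hκ0⟩⟩
  let g : EM → EQ := fun z => κ (f (φ.symm z))
  have hφ : ContMDiffOn 𝓘(ℝ, EM) 𝓘(ℝ, EM) ∞ φ φ.source := contMDiffOn_chart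
  have hφs : ContMDiffOn 𝓘(ℝ, EM) 𝓘(ℝ, EM) ∞ φ.symm φ.target := contMDiffOn_chart_symm
  have hκ : ContMDiffOn 𝓘(ℝ, EQ) 𝓘(ℝ, EQ) ∞ κ κ.source := contMDiffOn_chart
  have hg : ContDiffOn ℝ ∞ g O := by
    rw [← contMDiffOn_iff_contDiffOn]
    have h1 : ContMDiffOn 𝓘(ℝ, EM) 𝓘(ℝ, EQ) ∞ (fun z => f (φ.symm z)) O :=
      hf.comp (hφs.mono fun _ h => h.1) fun _ h => h.2.1
    exact hκ.comp h1 fun _ h => h.2.2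
  have hgs : Function.Surjective (fderiv ℝ g (φ x₀)) := by
    have hfm : MDifferentiableAt 𝓘(ℝ, EM) 𝓘(ℝ, EQ) f (φ.symm (φ x₀)) := by
      rw [φ.left_inv hφ0]
      exact (hf.contMDiffAt (hU.mem_nhds hx₀)).mdifferentiableAt (by simp)
    have h1 := (mdifferentiable_chart (I := 𝓘(ℝ, EM)) x₀).symm
    have h2 := mdifferentiable_chart (I := 𝓘(ℝ, EQ)) (f x₀)
    have h1' := h1.mdifferentiableAt (x := φ x₀) (φ.map_source hφ0)
    have hc1 := mfderiv_comp (φ x₀) hfm h1'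
    have hκm : MDifferentiableAt 𝓘(ℝ, EQ) 𝓘(ℝ, EQ) κ ((f ∘ φ.symm) (φ x₀)) := by
      refine h2.mdifferentiableAt ?_
      simp [hφ0, φ]
    have hc2 := mfderiv_comp (φ x₀) hκm (hfm.comp _ h1')
    rw [← mfderiv_eq_fderiv]
    change Function.Surjective (mfderiv 𝓘(ℝ, EM) 𝓘(ℝ, EQ) (κ ∘ (f ∘ φ.symm)) (φ x₀))
    rw [hc2, hc1]
    have s1 := h1.mfderiv_surjective (x := φ x₀) (φ.map_source hφ0)
    have s2 : Function.Surjective (mfderiv 𝓘(ℝ, EM) 𝓘(ℝ, EQ) f (φ.symm (φ x₀))) := by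
      rw [φ.left_inv hφ0]
      exact hs
    have s3 : Function.Surjective (mfderiv 𝓘(ℝ, EQ) 𝓘(ℝ, EQ) κ ((f ∘ φ.symm) (φ x₀))) := by
      refine h2.mfderiv_surjective ?_
      simp [hφ0, φ]
    exact s3.comp (s2.comp s1)
  obtain ⟨L, e, he0, heO, he, hes⟩ := exists_straightening (F := F) hO hg ha hgs hF
  have heφ : ∀ x ∈ φ.source, e (φ x) = (κ (f x), L (φ x)) := fun x hx => by
    rw [he]
    change (κ (f (φ.symm (φ x))), L (φ x)) = _
    rw [φ.left_inv hx]
  refine ⟨{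
    source := φ.source ∩ φ ⁻¹' e.source
    w := fun x => L (φ x)
    target := (κ.source ×ˢ univ) ∩ (fun z : Q × F => (κ z.1, z.2)) ⁻¹' e.target
    r := fun z => φ.symm (e.symm (κ z.1, z.2))
    isOpen_source := φ.isOpen_inter_preimage e.open_source
    source_subset := ?_
    isOpen_target := ?_
    smooth_w := ?_
    smooth_r := ?_
    map_source := ?_
    r_apply := ?_
    r_mem := ?_
    f_r := ?_
    w_r := ?_ }, hφ0, he0⟩
  · intro x hx
    have := (heO hx.2).2
    change φ.symm (φ x) ∈ U' at this
    rw [φ.left_inv hx.1] at this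
    exact this.1
  · refine ContinuousOn.isOpen_inter_preimage ?_ (κ.open_source.prod isOpen_univ) e.open_target
    exact (κ.continuousOn.comp continuousOn_fst fun z hz => hz.1).prodMk continuousOn_snd
  · exact L.contMDiff.comp_contMDiffOn (hφ.mono fun _ h => h.1)
  · have h1 : ContMDiffOn (𝓘(ℝ, EQ).prod 𝓘(ℝ, F)) 𝓘(ℝ, EQ × F) ∞
        (fun z : Q × F => (κ z.1, z.2)) ((κ.source ×ˢ univ) ∩
          (fun z : Q × F => (κ z.1, z.2)) ⁻¹' e.target) :=
      (hκ.comp contMDiffOn_fst fun z hz => hz.1.1).prodMk_space contMDiffOn_snd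
    have h2 := (contMDiffOn_iff_contDiffOn.2 hes).comp h1 fun z hz => hz.2
    exact hφs.comp h2 fun z hz => (heO (e.map_target hz.2)).1
  · intro x hx
    have h := (heO hx.2).2
    change φ.symm (φ x) ∈ U' at h
    rw [φ.left_inv hx.1] at h
    refine ⟨⟨h.2, mem_univ _⟩, ?_⟩
    change (κ (f x), L (φ x)) ∈ e.target
    rw [← heφ x hx.1]
    exact e.map_source hx.2
  · intro x hx
    change φ.symm (e.symm (κ (f x), L (φ x))) = x
    rw [← heφ x hx.1, e.left_inv hx.2, φ.left_inv hx.1]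
  · intro z hz
    have h := heO (e.map_target hz.2)
    refine ⟨φ.map_target h.1, ?_⟩
    change φ (φ.symm (e.symm (κ z.1, z.2))) ∈ e.source
    rw [φ.right_inv h.1]
    exact e.map_target hz.2
  · intro z hz
    have h := heO (e.map_target hz.2)
    have h1 := e.right_inv hz.2
    rw [he] at h1
    have h2 : κ (f (φ.symm (e.symm (κ z.1, z.2)))) = κ z.1 := congrArg Prod.fst h1
    exact κ.injOn h.2.2 hz.1.1 h2
  · intro z hz
    have h := heO (e.map_target hz.2)
    have h1 := e.right_inv hz.2
    rw [he] at h1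
    change L (φ (φ.symm (e.symm (κ z.1, z.2)))) = z.2
    rw [φ.right_inv h.1]
    exact congrArg Prod.snd h1

end Submersion


/-! ### The fiber product of a submersion and a smooth map of manifolds -/

/-- A smooth submersion `f : U → M_C` and a smooth map `g : V → M_C`, on open subsets of the
ambient manifolds of `A` and `B`. -/
structure FiberSetup (A B C : SmoothSet) where
  f : A.M → C.M
  g : B.M → C.M
  U : Set A.M
  V : Set B.M
  isOpen_U : IsOpen U
  isOpen_V : IsOpen V
  smooth_f : ContMDiffOn 𝓘(ℝ, A.E) 𝓘(ℝ, C.E) ∞ f U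
  smooth_g : ContMDiffOn 𝓘(ℝ, B.E) 𝓘(ℝ, C.E) ∞ g V
  surj : ∀ x ∈ U, Function.Surjective (mfderiv 𝓘(ℝ, A.E) 𝓘(ℝ, C.E) f x)

namespace FiberSetup

variable {A B C : SmoothSet} (D : FiberSetup A B C)

/-- The model space of the fibers of the submersion. -/
abbrev Fib (_D : FiberSetup A B C) : Type :=
  Fin (Module.finrank ℝ A.E - Module.finrank ℝ C.E) → ℝ

/-- The fiber product. -/
abbrev Space : Type := {z : A.M × B.M // z.1 ∈ D.U ∧ z.2 ∈ D.V ∧ D.f z.1 = D.g z.2}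

theorem exists_adaptedChart_mem {x : A.M} (hx : x ∈ D.U) :
    ∃ c : AdaptedChart A.E C.E D.Fib D.f D.U, x ∈ c.source := by
  refine exists_adaptedChart D.isOpen_U D.smooth_f hx (D.surj x hx) ?_
  let L : A.E →ₗ[ℝ] C.E := (mfderiv 𝓘(ℝ, A.E) 𝓘(ℝ, C.E) D.f x).toLinearMap
  -- Surjectivity bounds the dimension of the base by that of the source, so the truncated
  -- subtraction in `Fib` is the true dimension of the fibers.
  have h := LinearMap.finrank_le_finrank_of_surjective (f := L) (D.surj x hx)
  rw [Module.finrank_fin_fun]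
  omega

/-- Coordinates of the submersion near the first component of a point of the fiber product. -/
def adapted (s : D.Space) : AdaptedChart A.E C.E D.Fib D.f D.U :=
  (D.exists_adaptedChart_mem s.2.1).choose

theorem mem_adapted (s : D.Space) : s.1.1 ∈ (D.adapted s).source :=
  (D.exists_adaptedChart_mem s.2.1).choose_spec

/-- The domain of the local parametrization of the fiber product at `s`. -/
def dom (s : D.Space) : Set (B.M × D.Fib) :=
  (D.V ×ˢ univ) ∩ (fun z : B.M × D.Fib => (D.g z.1, z.2)) ⁻¹' (D.adapted s).target

open Classical in
/-- The local parametrization of the fiber product at `s`. -/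
def param (s : D.Space) (z : B.M × D.Fib) : D.Space :=
  if hz : z ∈ D.dom s then
    ⟨((D.adapted s).r (D.g z.1, z.2), z.1), (D.adapted s).source_subset ((D.adapted s).r_mem _ hz.2),
      hz.1.1, (D.adapted s).f_r _ hz.2⟩
  -- The value off `dom s` is irrelevant; the base point serves as a default.
  else s

theorem param_val {s : D.Space} {z : B.M × D.Fib} (hz : z ∈ D.dom s) :
    (D.param s z).1 = ((D.adapted s).r (D.g z.1, z.2), z.1) := by
  rw [param, dif_pos hz]

theorem mem_dom {s s' : D.Space} (h : s'.1.1 ∈ (D.adapted s).source) :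
    (s'.1.2, (D.adapted s).w s'.1.1) ∈ D.dom s := by
  refine ⟨⟨s'.2.2.1, mem_univ _⟩, ?_⟩
  change (D.g s'.1.2, (D.adapted s).w s'.1.1) ∈ (D.adapted s).target
  rw [← s'.2.2.2]
  exact (D.adapted s).map_source _ h

theorem param_apply {s s' : D.Space} (h : s'.1.1 ∈ (D.adapted s).source) :
    D.param s (s'.1.2, (D.adapted s).w s'.1.1) = s' := by
  apply Subtype.ext
  rw [D.param_val (D.mem_dom h)]
  refine Prod.ext ?_ rfl
  change (D.adapted s).r (D.g s'.1.2, (D.adapted s).w s'.1.1) = s'.1.1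
  rw [← s'.2.2.2]
  exact (D.adapted s).r_apply _ h

theorem param_mem_source {s : D.Space} {z : B.M × D.Fib} (hz : z ∈ D.dom s) :
    (D.param s z).1.1 ∈ (D.adapted s).source := by
  rw [D.param_val hz]
  exact (D.adapted s).r_mem _ hz.2

theorem w_param {s : D.Space} {z : B.M × D.Fib} (hz : z ∈ D.dom s) :
    (D.adapted s).w (D.param s z).1.1 = z.2 := by
  rw [D.param_val hz]
  exact (D.adapted s).w_r _ hz.2

theorem continuousOn_gprod :
    ContinuousOn (fun z : B.M × D.Fib => (D.g z.1, z.2)) (D.V ×ˢ univ) :=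
  (D.smooth_g.continuousOn.comp continuousOn_fst fun _ hz => hz.1).prodMk continuousOn_snd

theorem isOpen_dom (s : D.Space) : IsOpen (D.dom s) :=
  D.continuousOn_gprod.isOpen_inter_preimage (D.isOpen_V.prod isOpen_univ)
    (D.adapted s).isOpen_target

theorem contMDiffOn_param_fst (s : D.Space) :
    ContMDiffOn (𝓘(ℝ, B.E).prod 𝓘(ℝ, D.Fib)) 𝓘(ℝ, A.E) ∞ (fun z => (D.param s z).1.1)
      (D.dom s) := by
  have h1 : ContMDiffOn (𝓘(ℝ, B.E).prod 𝓘(ℝ, D.Fib)) (𝓘(ℝ, C.E).prod 𝓘(ℝ, D.Fib)) ∞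
      (fun z : B.M × D.Fib => (D.g z.1, z.2)) (D.dom s) :=
    (D.smooth_g.comp contMDiffOn_fst fun _ hz => hz.1.1).prodMk contMDiffOn_snd
  refine ((D.adapted s).smooth_r.comp h1 fun _ hz => hz.2).congr fun z hz => ?_
  rw [D.param_val hz]
  rfl

theorem contMDiffOn_param_snd (s : D.Space) :
    ContMDiffOn (𝓘(ℝ, B.E).prod 𝓘(ℝ, D.Fib)) 𝓘(ℝ, B.E) ∞ (fun z => (D.param s z).1.2)
      (D.dom s) :=
  contMDiffOn_fst.congr fun z hz => by rw [D.param_val hz]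

theorem continuousOn_param (s : D.Space) : ContinuousOn (D.param s) (D.dom s) := by
  refine Topology.IsInducing.subtypeVal.continuousOn_iff.2 ?_
  exact (D.contMDiffOn_param_fst s).continuousOn.prodMk (D.contMDiffOn_param_snd s).continuousOn

/-- The chart of the fiber product at `s`. -/
def chart (s : D.Space) : OpenPartialHomeomorph D.Space (B.E × D.Fib) where
  toFun s' := (chartAt B.E s.1.2 s'.1.2, (D.adapted s).w s'.1.1)
  invFun z := D.param s ((chartAt B.E s.1.2).symm z.1, z.2)
  source := {s' | s'.1.1 ∈ (D.adapted s).source ∧ s'.1.2 ∈ (chartAt B.E s.1.2).source}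
  target := ((chartAt B.E s.1.2).target ×ˢ univ) ∩
    (fun z => ((chartAt B.E s.1.2).symm z.1, z.2)) ⁻¹' D.dom s
  map_source' s' h := by
    refine ⟨⟨(chartAt B.E s.1.2).map_source h.2, mem_univ _⟩, ?_⟩
    change ((chartAt B.E s.1.2).symm (chartAt B.E s.1.2 s'.1.2), (D.adapted s).w s'.1.1) ∈ D.dom s
    rw [(chartAt B.E s.1.2).left_inv h.2]
    exact D.mem_dom h.1
  map_target' z hz := by
    refine ⟨D.param_mem_source hz.2, ?_⟩
    rw [D.param_val hz.2]
    exact (chartAt B.E s.1.2).map_target hz.1.1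
  left_inv' s' h := by
    change D.param s ((chartAt B.E s.1.2).symm (chartAt B.E s.1.2 s'.1.2),
      (D.adapted s).w s'.1.1) = s'
    rw [(chartAt B.E s.1.2).left_inv h.2]
    exact D.param_apply h.1
  right_inv' z hz := by
    refine Prod.ext ?_ (D.w_param hz.2)
    rw [D.param_val hz.2]
    exact (chartAt B.E s.1.2).right_inv hz.1.1
  open_source :=
    (((D.adapted s).isOpen_source.preimage continuous_fst).inter
      ((chartAt B.E s.1.2).open_source.preimage continuous_snd)).preimage continuous_subtype_val
  open_target := by
    refine ContinuousOn.isOpen_inter_preimage ?_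
      ((chartAt B.E s.1.2).open_target.prod isOpen_univ) (D.isOpen_dom s)
    exact ((chartAt B.E s.1.2).continuousOn_symm.comp continuousOn_fst
      fun z hz => hz.1).prodMk continuousOn_snd
  continuousOn_toFun := by
    refine ContinuousOn.prodMk ?_ ?_
    · exact (chartAt B.E s.1.2).continuousOn.comp
        (continuous_snd.comp continuous_subtype_val).continuousOn fun _ h => h.2
    · exact (D.adapted s).smooth_w.continuousOn.comp
        (continuous_fst.comp continuous_subtype_val).continuousOn fun _ h => h.1
  continuousOn_invFun := by
    refine (D.continuousOn_param s).comp ?_ fun _ hz => hz.2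
    exact ((chartAt B.E s.1.2).continuousOn_symm.comp continuousOn_fst
      fun z hz => hz.1.1).prodMk continuousOn_snd

instance chartedSpace : ChartedSpace (B.E × D.Fib) D.Space where
  atlas := range D.chart
  chartAt := D.chart
  mem_chart_source s := ⟨D.mem_adapted s, mem_chart_source B.E s.1.2⟩
  chart_mem_atlas s := ⟨s, rfl⟩

theorem contMDiffOn_chart_symm_prod (s : D.Space) :
    ContMDiffOn 𝓘(ℝ, B.E × D.Fib) (𝓘(ℝ, B.E).prod 𝓘(ℝ, D.Fib)) ∞
      (fun z : B.E × D.Fib => ((chartAt B.E s.1.2).symm z.1, z.2)) (D.chart s).target := by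
  have h1 : ContMDiffOn 𝓘(ℝ, B.E) 𝓘(ℝ, B.E) ∞ (chartAt B.E s.1.2).symm
      (chartAt B.E s.1.2).target := contMDiffOn_chart_symm
  exact (h1.comp (t := (chartAt B.E s.1.2).target) contDiff_fst.contMDiff.contMDiffOn
    fun z hz => hz.1.1).prodMk contDiff_snd.contMDiff.contMDiffOn

theorem contMDiffOn_chart_symm_fst (s : D.Space) :
    ContMDiffOn 𝓘(ℝ, B.E × D.Fib) 𝓘(ℝ, A.E) ∞ (fun z => ((D.chart s).symm z).1.1)
      (D.chart s).target :=
  (D.contMDiffOn_param_fst s).comp (D.contMDiffOn_chart_symm_prod s) fun _ hz => hz.2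

theorem contMDiffOn_chart_symm_snd (s : D.Space) :
    ContMDiffOn 𝓘(ℝ, B.E × D.Fib) 𝓘(ℝ, B.E) ∞ (fun z => ((D.chart s).symm z).1.2)
      (D.chart s).target :=
  (D.contMDiffOn_param_snd s).comp (D.contMDiffOn_chart_symm_prod s) fun _ hz => hz.2

/-- Each coordinate of a chart is a smooth function of one component of the pair. Both the
smoothness of the transition maps and that of maps into the fiber product reduce to this. -/
theorem contMDiffWithinAt_chart_comp {E' H' T : Type*} [NormedAddCommGroup E'] [NormedSpace ℝ E']
    [TopologicalSpace H'] {J : ModelWithCorners ℝ E' H'} [TopologicalSpace T] [ChartedSpace H' T]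
    {h : T → D.Space} {t : T} {S : Set T} (s : D.Space) (ht : h t ∈ (D.chart s).source)
    (h1 : ContMDiffWithinAt J 𝓘(ℝ, A.E) ∞ (fun t => (h t).1.1) S t)
    (h2 : ContMDiffWithinAt J 𝓘(ℝ, B.E) ∞ (fun t => (h t).1.2) S t) :
    ContMDiffWithinAt J 𝓘(ℝ, B.E × D.Fib) ∞ (fun t => D.chart s (h t)) S t := by
  have k1 : ContMDiffAt 𝓘(ℝ, B.E) 𝓘(ℝ, B.E) ∞ (chartAt B.E s.1.2) (h t).1.2 :=
    contMDiffOn_chart.contMDiffAt ((chartAt B.E s.1.2).open_source.mem_nhds ht.2)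
  have k2 : ContMDiffAt 𝓘(ℝ, A.E) 𝓘(ℝ, D.Fib) ∞ (D.adapted s).w (h t).1.1 :=
    (D.adapted s).smooth_w.contMDiffAt ((D.adapted s).isOpen_source.mem_nhds ht.1)
  exact (k1.comp_contMDiffWithinAt t h2).prodMk_space (k2.comp_contMDiffWithinAt t h1)

instance isManifold : IsManifold 𝓘(ℝ, B.E × D.Fib) ∞ D.Space := by
  refine isManifold_of_contDiffOn _ _ _ ?_
  rintro _ _ ⟨s, rfl⟩ ⟨s', rfl⟩
  have h : ContMDiffOn 𝓘(ℝ, B.E × D.Fib) 𝓘(ℝ, B.E × D.Fib) ∞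
      (fun z => D.chart s' ((D.chart s).symm z)) ((D.chart s).symm ≫ₕ D.chart s').source := by
    intro z hz
    rw [OpenPartialHomeomorph.trans_source] at hz
    refine D.contMDiffWithinAt_chart_comp s' hz.2 ?_ ?_
    · exact (D.contMDiffOn_chart_symm_fst s z hz.1).mono fun _ hz => hz.1
    · exact (D.contMDiffOn_chart_symm_snd s z hz.1).mono fun _ hz => hz.1
  rw [contMDiffOn_iff_contDiffOn] at h
  exact h.mono fun z hz => hz.1

theorem contMDiff_fst : ContMDiff 𝓘(ℝ, B.E × D.Fib) 𝓘(ℝ, A.E) ∞ (fun s : D.Space => s.1.1) := by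
  intro s
  have h : ContMDiffOn 𝓘(ℝ, B.E × D.Fib) 𝓘(ℝ, B.E × D.Fib) ∞ (D.chart s) (D.chart s).source :=
    contMDiffOn_chart (x := s)
  have hs : s ∈ (D.chart s).source := mem_chart_source (B.E × D.Fib) s
  have h2 := (D.contMDiffOn_chart_symm_fst s).comp h (D.chart s).mapsTo
  refine (h2.contMDiffAt ((D.chart s).open_source.mem_nhds hs)).congr_of_eventuallyEq ?_
  filter_upwards [(D.chart s).open_source.mem_nhds hs] with s' hs'
  exact congrArg (fun q : D.Space => q.1.1) ((D.chart s).left_inv hs').symm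

theorem contMDiff_snd : ContMDiff 𝓘(ℝ, B.E × D.Fib) 𝓘(ℝ, B.E) ∞ (fun s : D.Space => s.1.2) := by
  intro s
  have h : ContMDiffOn 𝓘(ℝ, B.E × D.Fib) 𝓘(ℝ, B.E × D.Fib) ∞ (D.chart s) (D.chart s).source :=
    contMDiffOn_chart (x := s)
  have hs : s ∈ (D.chart s).source := mem_chart_source (B.E × D.Fib) s
  have h2 := (D.contMDiffOn_chart_symm_snd s).comp h (D.chart s).mapsTo
  refine (h2.contMDiffAt ((D.chart s).open_source.mem_nhds hs)).congr_of_eventuallyEq ?_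
  filter_upwards [(D.chart s).open_source.mem_nhds hs] with s' hs'
  exact congrArg (fun q : D.Space => q.1.2) ((D.chart s).left_inv hs').symm

/-- A map to the fiber product is smooth if its two components are. -/
theorem contMDiffAt_lift {E' H' T : Type*} [NormedAddCommGroup E'] [NormedSpace ℝ E']
    [TopologicalSpace H'] {J : ModelWithCorners ℝ E' H'} [TopologicalSpace T] [ChartedSpace H' T]
    {h : T → D.Space} {t : T}
    (h1 : ContMDiffAt J 𝓘(ℝ, A.E) ∞ (fun t => (h t).1.1) t)
    (h2 : ContMDiffAt J 𝓘(ℝ, B.E) ∞ (fun t => (h t).1.2) t) :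
    ContMDiffAt J 𝓘(ℝ, B.E × D.Fib) ∞ h t := by
  rw [contMDiffAt_iff_target]
  refine ⟨Topology.IsInducing.subtypeVal.continuousAt_iff.2
    (h1.continuousAt.prodMk h2.continuousAt), ?_⟩
  exact D.contMDiffWithinAt_chart_comp (h t) (mem_chart_source (B.E × D.Fib) (h t)) h1 h2

theorem contMDiffAt_param {s : D.Space} {z : B.M × D.Fib} (hz : z ∈ D.dom s) :
    ContMDiffAt (𝓘(ℝ, B.E).prod 𝓘(ℝ, D.Fib)) 𝓘(ℝ, B.E × D.Fib) ∞ (D.param s) z :=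
  D.contMDiffAt_lift ((D.contMDiffOn_param_fst s).contMDiffAt ((D.isOpen_dom s).mem_nhds hz))
    ((D.contMDiffOn_param_snd s).contMDiffAt ((D.isOpen_dom s).mem_nhds hz))

end FiberSetup


/-! ### Chain rules for derivatives of maps of manifolds -/

section MFDeriv

variable {E E' E'' H H' H'' M M' M'' : Type*} [NormedAddCommGroup E] [NormedSpace ℝ E]
  [NormedAddCommGroup E'] [NormedSpace ℝ E'] [NormedAddCommGroup E''] [NormedSpace ℝ E'']
  [TopologicalSpace H] {I : ModelWithCorners ℝ E H} [TopologicalSpace H']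
  {I' : ModelWithCorners ℝ E' H'} [TopologicalSpace H''] {I'' : ModelWithCorners ℝ E'' H''}
  [TopologicalSpace M] [ChartedSpace H M] [TopologicalSpace M'] [ChartedSpace H' M']
  [TopologicalSpace M''] [ChartedSpace H'' M'']

/-- The chain rule for a map that is locally a composition. -/
theorem mfderiv_of_eventuallyEq_comp {f : M → M'} {g : M' → M''} {h : M → M''} {x : M} {p : M'}
    (hp : f x = p) (hg : MDifferentiableAt I' I'' g p) (hf : MDifferentiableAt I I' f x)
    (he : ∀ᶠ y in 𝓝 x, g (f y) = h y) (v : E) :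
    (mfderiv I I'' h x : E →L[ℝ] E'') v =
      (mfderiv I' I'' g p : E' →L[ℝ] E'') ((mfderiv I I' f x : E →L[ℝ] E') v) := by
  subst hp
  have h1 : h =ᶠ[𝓝 x] g ∘ f := he.mono fun y hy => hy.symm
  exact congrArg (fun L : E →L[ℝ] E'' => L v) (h1.mfderiv_eq.trans (mfderiv_comp x hg hf))

theorem mfderiv_leftInverse {f : M → M'} {g : M' → M} {x : M} {p : M'}
    (hp : f x = p) (hg : MDifferentiableAt I' I g p) (hf : MDifferentiableAt I I' f x)
    (he : ∀ᶠ y in 𝓝 x, g (f y) = y) (v : E) :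
    (mfderiv I' I g p : E' →L[ℝ] E) ((mfderiv I I' f x : E →L[ℝ] E') v) = v := by
  rw [← mfderiv_of_eventuallyEq_comp hp hg hf (h := fun y => y) he v]
  exact congrArg (fun L : E →L[ℝ] E => L v) (mfderiv_id (I := I) (x := x))

theorem mfderiv_prodMk_apply {f : M → M'} {g : M → M''} {x : M} (hf : MDifferentiableAt I I' f x)
    (hg : MDifferentiableAt I I'' g x) (v : E) :
    (mfderiv I (I'.prod I'') (fun x => (f x, g x)) x : E →L[ℝ] E' × E'') v =
      ((mfderiv I I' f x : E →L[ℝ] E') v, (mfderiv I I'' g x : E →L[ℝ] E'') v) :=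
  congrArg (fun L : E →L[ℝ] E' × E'' => L v) (mfderiv_prodMk hf hg)

end MFDeriv

/-! ### Tangent spaces and vector fields of the fiber product -/

namespace FiberSetup

variable {A B C : SmoothSet} (D : FiberSetup A B C)

/-- The derivative of the first projection of the fiber product. -/
abbrev dfst (s : D.Space) : B.E × D.Fib →L[ℝ] A.E :=
  mfderiv 𝓘(ℝ, B.E × D.Fib) 𝓘(ℝ, A.E) (fun s : D.Space => s.1.1) s

/-- The derivative of the second projection of the fiber product. -/
abbrev dsnd (s : D.Space) : B.E × D.Fib →L[ℝ] B.E :=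
  mfderiv 𝓘(ℝ, B.E × D.Fib) 𝓘(ℝ, B.E) (fun s : D.Space => s.1.2) s

theorem mdifferentiableAt_fst (s : D.Space) :
    MDifferentiableAt 𝓘(ℝ, B.E × D.Fib) 𝓘(ℝ, A.E) (fun s : D.Space => s.1.1) s :=
  (D.contMDiff_fst s).mdifferentiableAt (by simp)

theorem mdifferentiableAt_snd (s : D.Space) :
    MDifferentiableAt 𝓘(ℝ, B.E × D.Fib) 𝓘(ℝ, B.E) (fun s : D.Space => s.1.2) s :=
  (D.contMDiff_snd s).mdifferentiableAt (by simp)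

theorem mdifferentiableAt_w {s s' : D.Space} (h : s'.1.1 ∈ (D.adapted s).source) :
    MDifferentiableAt 𝓘(ℝ, A.E) 𝓘(ℝ, D.Fib) (D.adapted s).w s'.1.1 :=
  ((D.adapted s).smooth_w.contMDiffAt
    ((D.adapted s).isOpen_source.mem_nhds h)).mdifferentiableAt (by simp)

theorem eventually_mem_source {s s' : D.Space} (h : s'.1.1 ∈ (D.adapted s).source) :
    ∀ᶠ q : D.Space in 𝓝 s', q.1.1 ∈ (D.adapted s).source :=
  (continuous_fst.comp continuous_subtype_val).continuousAt.eventually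
    ((D.adapted s).isOpen_source.mem_nhds h)

theorem mdifferentiableAt_param {s : D.Space} {z : B.M × D.Fib} (hz : z ∈ D.dom s) :
    MDifferentiableAt (𝓘(ℝ, B.E).prod 𝓘(ℝ, D.Fib)) 𝓘(ℝ, B.E × D.Fib) (D.param s) z :=
  (D.contMDiffAt_param hz).mdifferentiableAt (by simp)

/-- The derivative of the local parametrization. -/
abbrev dparam (s : D.Space) (z : B.M × D.Fib) : B.E × D.Fib →L[ℝ] B.E × D.Fib :=
  mfderiv (𝓘(ℝ, B.E).prod 𝓘(ℝ, D.Fib)) 𝓘(ℝ, B.E × D.Fib) (D.param s) z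

/-- The derivative of the fiber coordinate. -/
abbrev dw (s : D.Space) (x : A.M) : A.E →L[ℝ] D.Fib :=
  mfderiv 𝓘(ℝ, A.E) 𝓘(ℝ, D.Fib) (D.adapted s).w x

/-- This is the derivative of the identity `param ∘ (snd, w ∘ fst) = id`, valid near `s'`. A tangent
vector is thus recovered from its two projections. -/
theorem dparam_apply {s s' : D.Space} (h : s'.1.1 ∈ (D.adapted s).source) (ζ : B.E × D.Fib) :
    D.dparam s (s'.1.2, (D.adapted s).w s'.1.1)
      (D.dsnd s' ζ, D.dw s s'.1.1 (D.dfst s' ζ)) = ζ := by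
  have hw := D.mdifferentiableAt_w h
  have hc := hw.comp s' (D.mdifferentiableAt_fst s')
  have h1 := mfderiv_leftInverse (f := fun q : D.Space => (q.1.2, (D.adapted s).w q.1.1))
    (g := D.param s) (x := s') rfl (D.mdifferentiableAt_param (D.mem_dom h))
    ((D.mdifferentiableAt_snd s').prodMk hc)
    ((D.eventually_mem_source h).mono fun q hq => D.param_apply hq) ζ
  have h2 := mfderiv_prodMk_apply (D.mdifferentiableAt_snd s') hc ζ
  have h3 := mfderiv_of_eventuallyEq_comp (h := (D.adapted s).w ∘ fun q : D.Space => q.1.1)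
    rfl hw (D.mdifferentiableAt_fst s') (Eventually.of_forall fun _ => rfl) ζ
  exact (congrArg (D.dparam s (s'.1.2, (D.adapted s).w s'.1.1))
    (h2.trans (congrArg (Prod.mk (D.dsnd s' ζ)) h3))).symm.trans h1

theorem ext_tangent (s : D.Space) {ζ ζ' : B.E × D.Fib} (h1 : D.dfst s ζ = D.dfst s ζ')
    (h2 : D.dsnd s ζ = D.dsnd s ζ') : ζ = ζ' := by
  rw [← D.dparam_apply (D.mem_adapted s) ζ, ← D.dparam_apply (D.mem_adapted s) ζ', h1, h2]

theorem dsnd_dparam {s s' : D.Space} (h : s'.1.1 ∈ (D.adapted s).source) (v : B.E × D.Fib) :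
    D.dsnd s' (D.dparam s (s'.1.2, (D.adapted s).w s'.1.1) v) = v.1 := by
  have hz := D.mem_dom h
  have h1 := mfderiv_of_eventuallyEq_comp (f := D.param s) (h := Prod.fst) (D.param_apply h)
    (D.mdifferentiableAt_snd s') (D.mdifferentiableAt_param hz)
    (I'' := 𝓘(ℝ, B.E)) ?_ v
  · refine h1.symm.trans ?_
    rw [mfderiv_fst]
    rfl
  · filter_upwards [(D.isOpen_dom s).mem_nhds hz] with z hz
    rw [D.param_val hz]

theorem dsnd_surjective (s : D.Space) : Function.Surjective (D.dsnd s) := fun v =>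
  ⟨_, D.dsnd_dparam (D.mem_adapted s) (v, 0)⟩

/-- The first component of the parametrization is `r (g y, t)`. When `df u = dg v`, its derivative
at `(v, dw u)` is that of `r` at `(df u, dw u)`, which is `u` because `r ∘ (f, w)` is the identity.
So every pair of tangent vectors with the same image in the base is tangent to the fiber product. -/
theorem dfst_dparam {s s' : D.Space} (h : s'.1.1 ∈ (D.adapted s).source) {u : A.E} {v : B.E}
    (huv : (mfderiv 𝓘(ℝ, A.E) 𝓘(ℝ, C.E) D.f s'.1.1 : A.E →L[ℝ] C.E) u =
      (mfderiv 𝓘(ℝ, B.E) 𝓘(ℝ, C.E) D.g s'.1.2 : B.E →L[ℝ] C.E) v) :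
    D.dfst s' (D.dparam s (s'.1.2, (D.adapted s).w s'.1.1) (v, D.dw s s'.1.1 u)) = u := by
  have hz := D.mem_dom h
  have hw := D.mdifferentiableAt_w h
  have hf : MDifferentiableAt 𝓘(ℝ, A.E) 𝓘(ℝ, C.E) D.f s'.1.1 :=
    (D.smooth_f.contMDiffAt (D.isOpen_U.mem_nhds s'.2.1)).mdifferentiableAt (by simp)
  have hg : MDifferentiableAt 𝓘(ℝ, B.E) 𝓘(ℝ, C.E) D.g s'.1.2 :=
    (D.smooth_g.contMDiffAt (D.isOpen_V.mem_nhds s'.2.2.1)).mdifferentiableAt (by simp)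
  have hfw : (D.f s'.1.1, (D.adapted s).w s'.1.1) ∈ (D.adapted s).target :=
    (D.adapted s).map_source _ h
  have hr : MDifferentiableAt (𝓘(ℝ, C.E).prod 𝓘(ℝ, D.Fib)) 𝓘(ℝ, A.E) (D.adapted s).r
      (D.f s'.1.1, (D.adapted s).w s'.1.1) :=
    ((D.adapted s).smooth_r.contMDiffAt
      ((D.adapted s).isOpen_target.mem_nhds hfw)).mdifferentiableAt (by simp)
  have hg' : MDifferentiableAt (𝓘(ℝ, B.E).prod 𝓘(ℝ, D.Fib)) 𝓘(ℝ, C.E)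
      (fun z : B.M × D.Fib => D.g z.1) (s'.1.2, (D.adapted s).w s'.1.1) :=
    MDifferentiableAt.comp (I' := 𝓘(ℝ, B.E)) (g := D.g) (s'.1.2, (D.adapted s).w s'.1.1) hg
      _root_.mdifferentiableAt_fst
  have h1 := mfderiv_of_eventuallyEq_comp (f := D.param s) (D.param_apply h)
    (D.mdifferentiableAt_fst s') (D.mdifferentiableAt_param hz)
    (Eventually.of_forall fun _ => rfl) (v, D.dw s s'.1.1 u)
  refine h1.symm.trans ?_
  have hp : ((fun z : B.M × D.Fib => (D.g z.1, z.2)) (s'.1.2, (D.adapted s).w s'.1.1)) =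
      (D.f s'.1.1, (D.adapted s).w s'.1.1) := Prod.ext s'.2.2.2.symm rfl
  have h2 := mfderiv_of_eventuallyEq_comp (I' := 𝓘(ℝ, C.E).prod 𝓘(ℝ, D.Fib))
    (f := fun z : B.M × D.Fib => (D.g z.1, z.2))
    (h := fun z => (D.param s z).1.1) (x := (s'.1.2, (D.adapted s).w s'.1.1))
    hp hr (hg'.prodMk _root_.mdifferentiableAt_snd)
    (by
      filter_upwards [(D.isOpen_dom s).mem_nhds hz] with z hz
      rw [D.param_val hz]) (v, D.dw s s'.1.1 u)
  refine h2.trans ((congrArg _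
    (mfderiv_prodMk_apply hg' _root_.mdifferentiableAt_snd _)).trans ?_)
  have h3 := mfderiv_of_eventuallyEq_comp (f := fun z : B.M × D.Fib => z.1) (h := fun z => D.g z.1)
    (x := (s'.1.2, (D.adapted s).w s'.1.1))
    (I := 𝓘(ℝ, B.E).prod 𝓘(ℝ, D.Fib)) rfl hg _root_.mdifferentiableAt_fst
    (Eventually.of_forall fun _ => rfl) (v, D.dw s s'.1.1 u)
  rw [mfderiv_fst] at h3
  rw [mfderiv_snd]
  have h4 := mfderiv_leftInverse (f := fun x => (D.f x, (D.adapted s).w x))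
    (g := (D.adapted s).r) (x := s'.1.1) rfl hr (hf.prodMk hw)
    (by
      filter_upwards [(D.adapted s).isOpen_source.mem_nhds h] with x hx
      exact (D.adapted s).r_apply x hx) u
  have h5 := (congrArg _ (mfderiv_prodMk_apply hf hw u)).symm.trans h4
  have h6 := h3.trans huv.symm
  exact (congrArg (fun c : C.E => (mfderiv (𝓘(ℝ, C.E).prod 𝓘(ℝ, D.Fib)) 𝓘(ℝ, A.E) (D.adapted s).r
    (D.f s'.1.1, (D.adapted s).w s'.1.1) : C.E × D.Fib →L[ℝ] A.E) (c, D.dw s s'.1.1 u)) h6).trans h5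

instance sigmaCompactSpace : SigmaCompactSpace D.Space := by
  have : LocallyCompactSpace D.Space :=
    Manifold.locallyCompact_of_finiteDimensional 𝓘(ℝ, B.E × D.Fib)
  have : SecondCountableTopology D.Space := TopologicalSpace.Subtype.secondCountableTopology _
  exact sigmaCompactSpace_of_locallyCompact_secondCountable

/-- The vector fields on the factors induce a vector field on the fiber product. -/
theorem exists_vectorField (X₁ : ∀ x : A.M, TangentSpace 𝓘(ℝ, A.E) x)
    (h₁ : ContMDiff 𝓘(ℝ, A.E) 𝓘(ℝ, A.E).tangent ∞
      (fun x => (⟨x, X₁ x⟩ : TangentBundle 𝓘(ℝ, A.E) A.M)))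
    (X₂ : ∀ x : B.M, TangentSpace 𝓘(ℝ, B.E) x)
    (h₂ : ContMDiff 𝓘(ℝ, B.E) 𝓘(ℝ, B.E).tangent ∞
      (fun x => (⟨x, X₂ x⟩ : TangentBundle 𝓘(ℝ, B.E) B.M))) :
    ∃ X : ∀ s : D.Space, TangentSpace 𝓘(ℝ, B.E × D.Fib) s,
      ContMDiff 𝓘(ℝ, B.E × D.Fib) 𝓘(ℝ, B.E × D.Fib).tangent ∞
        (fun s => (⟨s, X s⟩ : TangentBundle 𝓘(ℝ, B.E × D.Fib) D.Space)) ∧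
      ∀ s : D.Space, D.dsnd s (X s) = X₂ s.1.2 ∧
        (mfderiv 𝓘(ℝ, A.E) 𝓘(ℝ, C.E) D.f s.1.1 (X₁ s.1.1) =
          (mfderiv 𝓘(ℝ, B.E) 𝓘(ℝ, C.E) D.g s.1.2 (X₂ s.1.2) : C.E) →
          D.dfst s (X s) = X₁ s.1.1) := by
  have : IsManifold 𝓘(ℝ, B.E × D.Fib) 1 D.Space := IsManifold.of_le (n := ∞) (by simp)
  -- The condition on the first projection is imposed only where the two fields have the same image.
  -- At a fixed point that hypothesis does not involve `ζ`, so the admissible vectors satisfy affine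
  -- equations and form a convex set.
  let t : ∀ s : D.Space, Set (TangentSpace 𝓘(ℝ, B.E × D.Fib) s) := fun s =>
    {ζ | D.dsnd s ζ = X₂ s.1.2 ∧
        (mfderiv 𝓘(ℝ, A.E) 𝓘(ℝ, C.E) D.f s.1.1 (X₁ s.1.1) =
          (mfderiv 𝓘(ℝ, B.E) 𝓘(ℝ, C.E) D.g s.1.2 (X₂ s.1.2) : C.E) →
          D.dfst s ζ = X₁ s.1.1)}
  have ht : ∀ s, Convex ℝ (t s) := by
    intro s x hx y hy a b ha hb hab
    have key : ∀ {G : Type} [NormedAddCommGroup G] [NormedSpace ℝ G]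
        (L : B.E × D.Fib →L[ℝ] G) (x y : B.E × D.Fib) (v : G), L x = v → L y = v → L (a • x + b • y) = v := by
      intro G _ _ L x y v h1 h2
      rw [map_add, map_smul, map_smul, h1, h2, ← add_smul, hab, one_smul]
    exact ⟨key _ x y _ hx.1 hy.1, fun h => key _ x y _ (hx.2 h) (hy.2 h)⟩
  suffices h : ∀ s : D.Space, ∃ W ∈ 𝓝 s, ∃ X : ∀ s : D.Space, TangentSpace 𝓘(ℝ, B.E × D.Fib) s,
      ContMDiffOn 𝓘(ℝ, B.E × D.Fib) 𝓘(ℝ, B.E × D.Fib).tangent ∞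
        (fun s => (⟨s, X s⟩ : TangentBundle 𝓘(ℝ, B.E × D.Fib) D.Space)) W ∧
      ∀ s ∈ W, X s ∈ t s by
    obtain ⟨X, hX⟩ := exists_contMDiffSection_forall_mem_convex_of_local 𝓘(ℝ, B.E × D.Fib)
      (n := ⊤) (F_fiber := B.E × D.Fib) (TangentSpace 𝓘(ℝ, B.E × D.Fib) : D.Space → Type) t ht h
    exact ⟨X, X.contMDiff_toFun, hX⟩
  -- The local solution is the parametrization applied to `X₂` and to the fiber coordinate of `X₁`.
  -- It projects to `X₂` always, and to `X₁` whenever the images agree. What remains is its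
  -- smoothness, shown by composing tangent maps.
  intro s
  refine ⟨{s' | s'.1.1 ∈ (D.adapted s).source}, D.eventually_mem_source (D.mem_adapted s),
    fun s' => D.dparam s (s'.1.2, (D.adapted s).w s'.1.1) (X₂ s'.1.2, D.dw s s'.1.1 (X₁ s'.1.1)),
    ?_, fun s' hs' => ⟨D.dsnd_dparam hs' _, fun h => D.dfst_dparam hs' h⟩⟩
  have k1 : ContMDiffOn 𝓘(ℝ, B.E × D.Fib) 𝓘(ℝ, B.E).tangent ∞
      (fun s' : D.Space => (⟨s'.1.2, X₂ s'.1.2⟩ : TangentBundle 𝓘(ℝ, B.E) B.M))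
      {s' | s'.1.1 ∈ (D.adapted s).source} := (h₂.comp D.contMDiff_snd).contMDiffOn
  have k2 : ContMDiffOn 𝓘(ℝ, B.E × D.Fib) 𝓘(ℝ, D.Fib).tangent ∞
      (fun s' : D.Space => (⟨(D.adapted s).w s'.1.1, D.dw s s'.1.1 (X₁ s'.1.1)⟩ :
        TangentBundle 𝓘(ℝ, D.Fib) D.Fib))
      {s' | s'.1.1 ∈ (D.adapted s).source} := by
    have k3 := (D.adapted s).smooth_w.contMDiffOn_tangentMapWithin (m := ∞) (by simp)
      (D.adapted s).isOpen_source.uniqueMDiffOn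
    have k4 := k3.comp ((h₁.comp D.contMDiff_fst).contMDiffOn
      (s := {s' : D.Space | s'.1.1 ∈ (D.adapted s).source})) fun s' hs' => hs'
    refine k4.congr fun s' hs' => ?_
    change _ = (⟨_, mfderivWithin 𝓘(ℝ, A.E) 𝓘(ℝ, D.Fib) (D.adapted s).w (D.adapted s).source
      s'.1.1 (X₁ s'.1.1)⟩ : TangentBundle 𝓘(ℝ, D.Fib) D.Fib)
    rw [mfderivWithin_of_isOpen (D.adapted s).isOpen_source hs']
    rfl
  have k5 := (contMDiff_equivTangentBundleProd_symm (n := ∞) (I := 𝓘(ℝ, B.E)) (M := B.M)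
    (I' := 𝓘(ℝ, D.Fib)) (M' := D.Fib)).comp_contMDiffOn (k1.prodMk k2)
  have k6 := ContMDiffOn.contMDiffOn_tangentMapWithin (m := ∞) (n := ∞) (f := D.param s)
    (s := D.dom s) (fun z hz => (D.contMDiffAt_param hz).contMDiffWithinAt) (by simp)
    (D.isOpen_dom s).uniqueMDiffOn
  refine (k6.comp k5 fun s' hs' => D.mem_dom hs').congr fun s' hs' => ?_
  change _ = (⟨D.param s (s'.1.2, (D.adapted s).w s'.1.1),
    mfderivWithin (𝓘(ℝ, B.E).prod 𝓘(ℝ, D.Fib)) 𝓘(ℝ, B.E × D.Fib) (D.param s) (D.dom s)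
      (s'.1.2, (D.adapted s).w s'.1.1) (X₂ s'.1.2, D.dw s s'.1.1 (X₁ s'.1.1))⟩ :
      TangentBundle 𝓘(ℝ, B.E × D.Fib) D.Space)
  rw [mfderivWithin_of_isOpen (D.isOpen_dom s) (D.mem_dom hs'), D.param_apply hs']
  rfl

end FiberSetup


/-! ### Fiber products of continuous modes -/

namespace FiberSetup

variable {A B C : SmoothSet} (D : FiberSetup A B C)

/-- The first projection is a topological embedding if the second map is one. -/
theorem isEmbedding_fst (hg : Topology.IsEmbedding (D.V.domRestrict D.g)) :
    Topology.IsEmbedding (fun s : D.Space => s.1.1) := by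
  have hfst : Continuous (fun s : D.Space => s.1.1) := continuous_fst.comp continuous_subtype_val
  have hsnd : Continuous (fun s : D.Space => s.1.2) := continuous_snd.comp continuous_subtype_val
  let j : D.Space → A.M × D.V := fun s => (s.1.1, ⟨s.1.2, s.2.2.1⟩)
  let q : D.Space → D.U := fun s => ⟨s.1.1, s.2.1⟩
  let G : D.U → A.M × C.M := fun x => (x.1, D.f x.1)
  have hj : Topology.IsInducing j := by
    refine Topology.IsInducing.of_comp (g := Prod.map id Subtype.val)
      (hfst.prodMk (hsnd.subtype_mk _)) (continuous_id.prodMap continuous_subtype_val) ?_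
    exact Topology.IsInducing.subtypeVal
  have hq : Continuous q := hfst.subtype_mk _
  have hG : Continuous G :=
    continuous_subtype_val.prodMk D.smooth_f.continuousOn.domRestrict
  -- On the fiber product `(x, g y) = (x, f x)`. The left side induces the topology because `g` is
  -- an embedding, and the right side depends continuously on `x` alone.
  have hGq : Topology.IsInducing (G ∘ q) := by
    have h := (Topology.IsInducing.id.prodMap hg.isInducing).comp hj
    have he : Prod.map id (D.V.domRestrict D.g) ∘ j = G ∘ q :=
      funext fun s => Prod.ext rfl s.2.2.2.symm
    rwa [he] at h
  refine ⟨Topology.IsInducing.subtypeVal.comp (Topology.IsInducing.of_comp hq hG hGq), ?_⟩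
  intro s s' h
  have h1 : s.1.1 = s'.1.1 := h
  refine Subtype.ext (Prod.ext h1 ?_)
  have h2 : D.g s.1.2 = D.g s'.1.2 := by rw [← s.2.2.2, ← s'.2.2.2, h1]
  exact congrArg Subtype.val (@hg.injective ⟨s.1.2, s.2.2.1⟩ ⟨s'.1.2, s'.2.2.1⟩ h2)

end FiberSetup

/-- A fiber product, for germs along the active sets, of two maps between ambient manifolds of
modes. -/
structure ModeFiber {ι : Type} (C : ι → Mode) (A B : Mode) {u u' : ι} (f : A.M → (C u).M)
    (g : B.M → (C u').M) where
  L : Mode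
  fst : L.M → A.M
  snd : L.M → B.M
  fst_smooth : SmoothSet.IsSmoothRep L.toSmoothSet A.toSmoothSet fst
  snd_smooth : SmoothSet.IsSmoothRep L.toSmoothSet B.toSmoothSet snd
  fst_semiconj : L.IsSemiconjRep A fst
  snd_semiconj : L.IsSemiconjRep B snd
  fst_embedding : SmoothSet.IsEmbeddingRep L.toSmoothSet A.toSmoothSet fst
  snd_submersion : SmoothSet.IsSubmersionRep L.toSmoothSet B.toSmoothSet snd
  -- The values are compared in a sigma type because the fiber product graph provides only a
  -- propositional equality between `u` and `u'`.
  comm : ∀ᶠ l in 𝓝ˢ L.carrier, (⟨u, f (fst l)⟩ : Σ i, (C i).M) = ⟨u', g (snd l)⟩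
  mem_flow : ∀ l ∈ L.carrier, fst l ∈ A.flow → snd l ∈ B.flow → l ∈ L.flow
  exists_mem : ∀ x ∈ A.carrier, ∀ y ∈ B.carrier,
    (⟨u, f x⟩ : Σ i, (C i).M) = ⟨u', g y⟩ → ∃ l ∈ L.carrier, fst l = x ∧ snd l = y
  exists_lift : ∀ (T : SmoothSet) (a : T.M → A.M) (b : T.M → B.M),
    SmoothSet.IsSmoothRep T A.toSmoothSet a → SmoothSet.IsSmoothRep T B.toSmoothSet b →
    (∀ᶠ t in 𝓝ˢ T.carrier, (⟨u, f (a t)⟩ : Σ i, (C i).M) = ⟨u', g (b t)⟩) →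
    ∃ l : T.M → L.M, SmoothSet.IsSmoothRep T L.toSmoothSet l ∧
      ∀ᶠ t in 𝓝ˢ T.carrier, fst (l t) = a t ∧ snd (l t) = b t

/-- The real line, with no active points. -/
def emptyMode : Mode where
  E := ℝ
  M := ℝ
  carrier := ∅
  X := fun _ => (0 : ℝ)
  smooth_X := contMDiff_vectorSpace_iff_contDiff.2 contDiff_const
  flow := ∅
  flow_subset := Subset.rfl

theorem sigma_mk_inj {ι : Type} {M : ι → Type} {u : ι} {x y : M u} :
    (⟨u, x⟩ : Σ i, M i) = ⟨u, y⟩ ↔ x = y :=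
  ⟨fun h => eq_of_heq (Sigma.mk.inj h).2, fun h => by rw [h]⟩

theorem nonempty_modeFiber {ι : Type} (C : ι → Mode) (A B : Mode) {u u' : ι} (f : A.M → (C u).M)
    (g : B.M → (C u').M) (hu : u = u')
    (fs : A.IsSemiconjRep (C u) f)
    (fe : SmoothSet.IsSubmersionRep A.toSmoothSet (C u).toSmoothSet f)
    (gs : B.IsSemiconjRep (C u') g)
    (ge : SmoothSet.IsEmbeddingRep B.toSmoothSet (C u').toSmoothSet g) :
    Nonempty (ModeFiber C A B f g) := by
  subst hu
  obtain ⟨U, hU, hAU, hfU, hfs⟩ := fe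
  obtain ⟨V, hV, hBV, hgV, hgi, hge⟩ := ge
  let D : FiberSetup A.toSmoothSet B.toSmoothSet (C u).toSmoothSet :=
    ⟨f, g, U, V, hU, hV, hfU, hgV, hfs⟩
  -- The ambient manifold of a mode has to be nonempty. If no pair exists, the real line with empty
  -- active set takes its place; a lift then has nothing to satisfy, since its hypotheses near any
  -- active point would produce a pair.
  rcases isEmpty_or_nonempty D.Space with hD | hD
  · refine ⟨{
      L := emptyMode
      fst := fun _ => Classical.arbitrary A.M
      snd := fun _ => Classical.arbitrary B.M
      fst_smooth := ⟨Eventually.of_forall fun _ => contMDiffAt_const, fun _ h => h.elim⟩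
      snd_smooth := ⟨Eventually.of_forall fun _ => contMDiffAt_const, fun _ h => h.elim⟩
      fst_semiconj := ⟨fun _ h => h.elim, mem_nhdsSet_iff_forall.2 fun _ h => h.elim⟩
      snd_semiconj := ⟨fun _ h => h.elim, mem_nhdsSet_iff_forall.2 fun _ h => h.elim⟩
      fst_embedding := ⟨∅, isOpen_empty, fun _ h => h.elim, fun _ h => h.elim, fun _ h => h.elim,
        Topology.IsEmbedding.of_subsingleton _⟩
      snd_submersion := ⟨∅, isOpen_empty, fun _ h => h.elim, fun _ h => h.elim, fun _ h => h.elim⟩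
      comm := mem_nhdsSet_iff_forall.2 fun _ h => h.elim
      mem_flow := fun _ h => h.elim
      exists_mem := fun x hx y hy h => (hD.false ⟨(x, y), hAU hx, hBV hy, sigma_mk_inj.1 h⟩).elim
      exists_lift := fun T a b ha hb h => ?_ }⟩
    refine ⟨fun _ => (0 : ℝ), ⟨Eventually.of_forall fun _ => contMDiffAt_const, fun t ht => ?_⟩, ?_⟩
    · exact (hD.false ⟨(a t, b t), hAU (ha.mapsTo ht), hBV (hb.mapsTo ht),
        sigma_mk_inj.1 (h.self_of_nhdsSet t ht)⟩).elim
    · filter_upwards [h, (ha.tendsto Subset.rfl ha.mapsTo).eventually (hU.mem_nhdsSet.2 hAU),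
        (hb.tendsto Subset.rfl hb.mapsTo).eventually (hV.mem_nhdsSet.2 hBV)] with t h1 h2 h3
      exact (hD.false ⟨(a t, b t), h2, h3, sigma_mk_inj.1 h1⟩).elim
  obtain ⟨X, hX, hX'⟩ := D.exists_vectorField A.X A.smooth_X B.X B.smooth_X
  have hfst : Continuous (fun s : D.Space => s.1.1) := continuous_fst.comp continuous_subtype_val
  have hsnd : Continuous (fun s : D.Space => s.1.2) := continuous_snd.comp continuous_subtype_val
  have : T2Space D.Space := inferInstance
  have : SecondCountableTopology D.Space := TopologicalSpace.Subtype.secondCountableTopology _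
  let L : Mode :=
    { E := B.E × D.Fib
      M := D.Space
      carrier := {s | s.1.1 ∈ A.carrier ∧ s.1.2 ∈ B.carrier}
      X := X
      smooth_X := hX
      flow := {s | s.1.1 ∈ A.flow ∧ s.1.2 ∈ B.flow}
      flow_subset := fun s hs => ⟨A.flow_subset hs.1, B.flow_subset hs.2⟩ }
  refine ⟨{
    L := L
    fst := fun s => s.1.1
    snd := fun s => s.1.2
    fst_smooth := ⟨Eventually.of_forall fun s => D.contMDiff_fst s, fun s hs => hs.1⟩
    snd_smooth := ⟨Eventually.of_forall fun s => D.contMDiff_snd s, fun s hs => hs.2⟩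
    fst_semiconj := ⟨fun s hs => hs.1, ?_⟩
    snd_semiconj := ⟨fun s hs => hs.2, Eventually.of_forall fun s => (hX' s).1⟩
    fst_embedding := ⟨univ, isOpen_univ, subset_univ _, D.contMDiff_fst.contMDiffOn, ?_,
      (D.isEmbedding_fst hge).comp (Homeomorph.Set.univ _).isEmbedding⟩
    snd_submersion := ⟨univ, isOpen_univ, subset_univ _, D.contMDiff_snd.contMDiffOn,
      fun s _ => D.dsnd_surjective s⟩
    comm := Eventually.of_forall fun s => sigma_mk_inj.2 s.2.2.2
    mem_flow := fun s _ h1 h2 => ⟨h1, h2⟩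
    exists_mem := fun x hx y hy h =>
      ⟨⟨(x, y), hAU hx, hBV hy, sigma_mk_inj.1 h⟩, ⟨hx, hy⟩, rfl, rfl⟩
    exists_lift := fun T a b ha hb h => ?_ }⟩
  · refine mem_nhdsSet_iff_forall.2 fun s hs => ?_
    have h1 := hfst.continuousAt.eventually (mem_nhdsSet_iff_forall.1 fs.semiconj s.1.1 hs.1)
    have h2 := hsnd.continuousAt.eventually (mem_nhdsSet_iff_forall.1 gs.semiconj s.1.2 hs.2)
    filter_upwards [h1, h2] with q hq1 hq2
    refine (hX' q).2 (hq1.trans (Eq.trans ?_ hq2.symm))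
    exact congrArg (fun c => ((C u).X c : (C u).E)) q.2.2.2
  · intro s _ ζ ζ' h
    refine D.ext_tangent s h ?_
    have hf : MDifferentiableAt 𝓘(ℝ, A.E) 𝓘(ℝ, (C u).E) D.f s.1.1 :=
      (D.smooth_f.contMDiffAt (D.isOpen_U.mem_nhds s.2.1)).mdifferentiableAt (by simp)
    have hg : MDifferentiableAt 𝓘(ℝ, B.E) 𝓘(ℝ, (C u).E) D.g s.1.2 :=
      (D.smooth_g.contMDiffAt (D.isOpen_V.mem_nhds s.2.2.1)).mdifferentiableAt (by simp)
    have key : ∀ ζ : B.E × D.Fib, (mfderiv 𝓘(ℝ, B.E) 𝓘(ℝ, (C u).E) D.g s.1.2 : B.E →L[ℝ] (C u).E)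
        (D.dsnd s ζ) = (mfderiv 𝓘(ℝ, A.E) 𝓘(ℝ, (C u).E) D.f s.1.1 : A.E →L[ℝ] (C u).E)
        (D.dfst s ζ) := fun ζ =>
      (mfderiv_of_eventuallyEq_comp (h := fun q : D.Space => D.f q.1.1) rfl hg
        (D.mdifferentiableAt_snd s) (Eventually.of_forall fun q => q.2.2.2.symm) ζ).symm.trans
        (mfderiv_of_eventuallyEq_comp (h := fun q : D.Space => D.f q.1.1) rfl hf
        (D.mdifferentiableAt_fst s) (Eventually.of_forall fun q => rfl) ζ)
    exact hgi s.1.2 s.2.2.1 ((key ζ).trans ((congrArg _ h).trans (key ζ').symm))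
  · have hgood : ∀ᶠ t in 𝓝ˢ T.carrier, a t ∈ U ∧ b t ∈ V ∧ f (a t) = g (b t) := by
      filter_upwards [h, (ha.tendsto Subset.rfl ha.mapsTo).eventually (hU.mem_nhdsSet.2 hAU),
        (hb.tendsto Subset.rfl hb.mapsTo).eventually (hV.mem_nhdsSet.2 hBV)] with t h1 h2 h3
      exact ⟨h2, h3, sigma_mk_inj.1 h1⟩
    classical
    let l : T.M → D.Space := fun t =>
      if ht : a t ∈ U ∧ b t ∈ V ∧ f (a t) = g (b t) then ⟨(a t, b t), ht⟩
      else Classical.arbitrary D.Space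
    have hl : ∀ t, a t ∈ U ∧ b t ∈ V ∧ f (a t) = g (b t) → (l t).1 = (a t, b t) := fun t ht => by
      simp only [l, dif_pos ht]
    refine ⟨l, ⟨?_, fun t ht => ?_⟩, hgood.mono fun t ht => ?_⟩
    · filter_upwards [ha.smooth, hb.smooth, hgood.eventually_nhdsSet] with t h1 h2 h3
      refine D.contMDiffAt_lift (h1.congr_of_eventuallyEq ?_) (h2.congr_of_eventuallyEq ?_)
      · exact h3.mono fun t ht => congrArg Prod.fst (hl t ht)
      · exact h3.mono fun t ht => congrArg Prod.snd (hl t ht)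
    · have h1 := hl t (hgood.self_of_nhdsSet t ht)
      change (l t).1.1 ∈ A.carrier ∧ (l t).1.2 ∈ B.carrier
      rw [h1]
      exact ⟨ha.mapsTo ht, hb.mapsTo ht⟩
    · exact ⟨congrArg Prod.fst (hl t ht), congrArg Prod.snd (hl t ht)⟩


/-! ### Monomorphisms and epimorphisms of directed graphs -/

namespace DirGraph

/-- The graph with a single edge, from `false` to `true`. -/
def arrow : DirGraph := ⟨Bool, Unit, fun _ => false, fun _ => true⟩

/-- The morphism from `arrow` that picks the vertex or edge `a`. -/
def Hom.ofElem {G : DirGraph} (a : G.V ⊕ G.E) : arrow ⟶ G where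
  vmap c := match c with
    | false => G.gsrc a
    | true => G.gtgt a
  emap _ := a
  src_emap _ := rfl
  tgt_emap _ := rfl

theorem Hom.gmap_comp {G G' G'' : DirGraph} (f : G ⟶ G') (g : G' ⟶ G'') (a : G.V ⊕ G.E) :
    Hom.gmap (f ≫ g) a = Hom.gmap g (Hom.gmap f a) := by
  cases a <;> rfl

/-- Edges may go to vertices, so morphisms from `arrow` correspond to arbitrary elements of `V ⊔ E`,
and two elements with the same image give two morphisms equalized by `f`. -/
theorem gmap_injective_of_mono {G G' : DirGraph} (f : G ⟶ G') [Mono f] :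
    Function.Injective (Hom.gmap f) := by
  intro a a' h
  have h1 : Hom.ofElem a ≫ f = Hom.ofElem a' ≫ f := by
    refine Hom.ext (funext fun c => ?_) (funext fun _ => h)
    cases c
    · change f.vmap (G.gsrc a) = f.vmap (G.gsrc a')
      rw [← f.gsrc_gmap, ← f.gsrc_gmap, h]
    · change f.vmap (G.gtgt a) = f.vmap (G.gtgt a')
      rw [← f.gtgt_gmap, ← f.gtgt_gmap, h]
  have h2 := (cancel_mono f).1 h1
  exact congrArg (fun g : arrow ⟶ G => g.emap ()) h2

theorem mono_of_gmap_injective {G G' : DirGraph} (f : G ⟶ G')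
    (hf : Function.Injective (Hom.gmap f)) : Mono f := by
  refine ⟨fun g g' h => Hom.ext (funext fun v => ?_) (funext fun e => hf ?_)⟩
  · exact Sum.inl_injective (hf (congrArg Sum.inl (congrFun (congrArg Hom.vmap h) v)))
  · exact congrFun (congrArg Hom.emap h) e

theorem Hom.vmap_eq_of_gmap_eq_inl {G G' : DirGraph} (f : Hom G G') {a : G.V ⊕ G.E} {v : G'.V}
    (h : f.gmap a = Sum.inl v) : f.vmap (G.gsrc a) = v := by
  rw [← f.gsrc_gmap, h]
  rfl

/-- A morphism that is injective on vertices and edges does not collapse edges. -/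
theorem Hom.eq_inl_of_injective {G G' : DirGraph} {f : Hom G G'} (hf : Function.Injective f.gmap)
    {a : G.V ⊕ G.E} {v : G'.V} (h : f.gmap a = Sum.inl v) : a = Sum.inl (G.gsrc a) := by
  refine hf (h.trans ?_)
  rw [← f.vmap_eq_of_gmap_eq_inl h]
  rfl

/-- A graph that classifies predicates on vertices and edges. -/
def classifier : DirGraph := ⟨Prop, Prop × Prop × Prop, fun e => e.1, fun e => e.2.1⟩

/-- The morphism to `classifier` given by a predicate. -/
def Hom.ofPred {G : DirGraph} (P : G.V ⊕ G.E → Prop) : G ⟶ classifier where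
  vmap v := P (Sum.inl v)
  emap e := Sum.inr (P (Sum.inl (G.src e)), P (Sum.inl (G.tgt e)), P (Sum.inr e))
  src_emap _ := rfl
  tgt_emap _ := rfl

/-- An epimorphism cannot distinguish the predicate of lying in its range from the constant
predicate `True`; both are morphisms to `classifier`. -/
theorem epi_iff_gmap_surjective {G G' : DirGraph} (f : G ⟶ G') :
    Epi f ↔ Function.Surjective (Hom.gmap f) := by
  constructor
  · intro hf
    have h : f ≫ Hom.ofPred (fun _ => True) = f ≫ Hom.ofPred (fun a => a ∈ range (Hom.gmap f)) := by
      refine Hom.ext (funext fun v => ?_) (funext fun e => ?_)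
      · exact (eq_true (⟨Sum.inl v, rfl⟩ : Sum.inl (f.vmap v) ∈ range (Hom.gmap f))).symm
      · change Hom.gmap _ (f.emap e) = Hom.gmap _ (f.emap e)
        have hs : Sum.inl (G'.gsrc (f.emap e)) ∈ range (Hom.gmap f) :=
          ⟨Sum.inl (G.src e), congrArg Sum.inl (f.src_emap e).symm⟩
        have ht : Sum.inl (G'.gtgt (f.emap e)) ∈ range (Hom.gmap f) :=
          ⟨Sum.inl (G.tgt e), congrArg Sum.inl (f.tgt_emap e).symm⟩
        have he : f.emap e ∈ range (Hom.gmap f) := ⟨Sum.inr e, rfl⟩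
        revert hs ht he
        generalize f.emap e = a
        intro hs ht he
        cases a with
        | inl v => exact congrArg Sum.inl (eq_true he).symm
        | inr e =>
          exact congrArg Sum.inr (Prod.ext (eq_true hs).symm
            (Prod.ext (eq_true ht).symm (eq_true he).symm))
    have h2 := (cancel_epi f).1 h
    intro a
    cases a with
    | inl v => exact of_eq_true (congrFun (congrArg Hom.vmap h2) v).symm
    | inr e =>
      have h3 := Sum.inr_injective (congrFun (congrArg Hom.emap h2) e)
      exact of_eq_true (congrArg (fun q => q.2.2) h3).symm
  · intro hf
    refine ⟨fun g g' h => ?_⟩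
    have hg : ∀ a, Hom.gmap g a = Hom.gmap g' a := by
      intro a
      obtain ⟨b, rfl⟩ := hf a
      rw [← Hom.gmap_comp, ← Hom.gmap_comp, h]
    exact Hom.ext (funext fun v => Sum.inl_injective (hg (Sum.inl v)))
      (funext fun e => hg (Sum.inr e))

end DirGraph

/-! ### Representatives of smooth maps -/

namespace SmoothSet


theorem isSubmersionRep_iff {A B : SmoothSet} {f : A.M → B.M} :
    IsSubmersionRep A B f ↔ ∀ᶠ x in 𝓝ˢ A.carrier, ContMDiffAt 𝓘(ℝ, A.E) 𝓘(ℝ, B.E) ∞ f x ∧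
      Function.Surjective (mfderiv 𝓘(ℝ, A.E) 𝓘(ℝ, B.E) f x) := by
  constructor
  · rintro ⟨U, hU, hAU, hf, hs⟩
    filter_upwards [hU.mem_nhdsSet.2 hAU] with x hx
    exact ⟨hf.contMDiffAt (hU.mem_nhds hx), hs x hx⟩
  · intro h
    obtain ⟨U, hU, hAU, h⟩ := eventually_nhdsSet_iff_exists.1 h
    exact ⟨U, hU, hAU, fun x hx => (h x hx).1.contMDiffWithinAt, fun x hx => (h x hx).2⟩

theorem IsSubmersionRep.comp {A B C : SmoothSet} {f : A.M → B.M} {g : B.M → C.M}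
    (sf : IsSmoothRep A B f) (hf : IsSubmersionRep A B f) (hg : IsSubmersionRep B C g) :
    IsSubmersionRep A C (fun x => g (f x)) := by
  rw [isSubmersionRep_iff] at *
  filter_upwards [hf, (sf.tendsto Subset.rfl sf.mapsTo).eventually hg] with x h1 h2
  refine ⟨h2.1.comp x h1.1, ?_⟩
  have h := mfderiv_comp x (h2.1.mdifferentiableAt (by simp)) (h1.1.mdifferentiableAt (by simp))
  change Function.Surjective (mfderiv 𝓘(ℝ, A.E) 𝓘(ℝ, C.E) (g ∘ f) x)
  rw [h]
  exact h2.2.comp h1.2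

theorem IsEmbeddingRep.comp {A B C : SmoothSet} {f : A.M → B.M} {g : B.M → C.M}
    (sf : IsSmoothRep A B f) (hf : IsEmbeddingRep A B f) (hg : IsEmbeddingRep B C g) :
    IsEmbeddingRep A C (fun x => g (f x)) := by
  obtain ⟨U, hU, hAU, hfU, hfi, hfe⟩ := hf
  obtain ⟨V, hV, hBV, hgV, hgi, hge⟩ := hg
  refine ⟨U ∩ f ⁻¹' V, hfU.continuousOn.isOpen_inter_preimage hU hV,
    fun x hx => ⟨hAU hx, hBV (sf.mapsTo hx)⟩, hgV.comp (hfU.mono fun x hx => hx.1) fun x hx => hx.2,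
    fun x hx => ?_, ?_⟩
  · have h1 := hfU.contMDiffAt (hU.mem_nhds hx.1)
    have h2 := hgV.contMDiffAt (hV.mem_nhds hx.2)
    have h := mfderiv_comp x (h2.mdifferentiableAt (by simp)) (h1.mdifferentiableAt (by simp))
    change Function.Injective (mfderiv 𝓘(ℝ, A.E) 𝓘(ℝ, C.E) (g ∘ f) x)
    rw [h]
    exact (hgi (f x) hx.2).comp (hfi x hx.1)
  · have h1 : Topology.IsEmbedding (fun x : ↥(U ∩ f ⁻¹' V) => f x.1) :=
      hfe.comp (Topology.IsEmbedding.inclusion inter_subset_left)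
    have h2 : Topology.IsEmbedding (fun x : ↥(U ∩ f ⁻¹' V) => (⟨f x.1, x.2.2⟩ : V)) :=
      h1.codRestrict V fun x => x.2.2
    exact hge.comp h2

theorem IsEmbeddingRep.id (A : SmoothSet) : IsEmbeddingRep A A (fun x => x) := by
  refine ⟨univ, isOpen_univ, subset_univ _, contMDiff_id.contMDiffOn, fun x _ => ?_,
    (Homeomorph.Set.univ _).isEmbedding⟩
  have h := mfderiv_id (I := 𝓘(ℝ, A.E)) (x := x)
  change Function.Injective (mfderiv 𝓘(ℝ, A.E) 𝓘(ℝ, A.E) _root_.id x)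
  rw [h]
  exact Function.injective_id

theorem IsSubmersionRep.id (A : SmoothSet) : IsSubmersionRep A A (fun x => x) := by
  refine ⟨univ, isOpen_univ, subset_univ _, contMDiff_id.contMDiffOn, fun x _ => ?_⟩
  have h := mfderiv_id (I := 𝓘(ℝ, A.E)) (x := x)
  change Function.Surjective (mfderiv 𝓘(ℝ, A.E) 𝓘(ℝ, A.E) _root_.id x)
  rw [h]
  exact Function.surjective_id

theorem isSubmersionRep_of_inverse {A B : SmoothSet} {f : A.M → B.M} {g : B.M → A.M} (hf : IsSmoothRep A B f)
    (hg : IsSmoothRep B A g) (hgf : ∀ᶠ x in 𝓝ˢ A.carrier, g (f x) = x)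
    (hfg : ∀ᶠ y in 𝓝ˢ B.carrier, f (g y) = y) : IsSubmersionRep A B f := by
  rw [isSubmersionRep_iff]
  have ht := hf.tendsto Subset.rfl hf.mapsTo
  filter_upwards [hf.smooth, hgf, ht.eventually hg.smooth, ht.eventually hfg.eventually_nhdsSet]
    with x h1 h2 h3 h4
  exact ⟨h1, fun v => ⟨_, mfderiv_leftInverse h2 (h1.mdifferentiableAt (by simp))
    (h3.mdifferentiableAt (by simp)) h4 v⟩⟩

/-- A left inverse germ suffices: its derivative inverts that of `f` on the left, and its continuity
on the image makes `f` a homeomorphism onto the image. -/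
theorem isEmbeddingRep_of_inverse {A B : SmoothSet} {f : A.M → B.M} {g : B.M → A.M} (hf : IsSmoothRep A B f)
    (hg : IsSmoothRep B A g) (hgf : ∀ᶠ x in 𝓝ˢ A.carrier, g (f x) = x) : IsEmbeddingRep A B f := by
  have ht := hf.tendsto Subset.rfl hf.mapsTo
  have h := (hf.smooth.and (hgf.and (ht.eventually hg.smooth)))
  obtain ⟨U, hU, hAU, h⟩ := eventually_nhdsSet_iff_exists.1 h
  have hfU : ContinuousOn f U := fun x hx => (h x hx).1.continuousAt.continuousWithinAt
  refine ⟨U, hU, hAU, fun x hx => (h x hx).1.contMDiffWithinAt, fun x hx v v' hv => ?_, ?_⟩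
  · have he : ∀ᶠ y in 𝓝 x, g (f y) = y := by
      filter_upwards [hU.mem_nhds hx] with y hy
      exact (h y hy).2.1
    have key := mfderiv_leftInverse rfl ((h x hx).2.2.mdifferentiableAt (by simp))
      ((h x hx).1.mdifferentiableAt (by simp)) he
    exact (key v).symm.trans ((congrArg _ hv).trans (key v'))
  · let W : Set B.M := f '' U
    have hgW : ContinuousOn g W := by
      rintro _ ⟨x, hx, rfl⟩
      exact (h x hx).2.2.continuousAt.continuousWithinAt
    let q : U → W := fun x => ⟨f x.1, mem_image_of_mem f x.2⟩
    have hq : Continuous q := hfU.domRestrict.subtype_mk _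
    have hgq : (W.domRestrict g) ∘ q = Subtype.val := funext fun x => (h x.1 x.2).2.1
    have h1 : Topology.IsEmbedding q := by
      refine Topology.IsEmbedding.of_comp hq hgW.domRestrict ?_
      rw [hgq]
      exact Topology.IsEmbedding.subtypeVal
    exact Topology.IsEmbedding.subtypeVal.comp h1

end SmoothSet

/-- A map whose composition with an embedding carries vector fields to each other does so. -/
theorem Mode.IsSemiconjRep.of_comp {T L A : Mode} {l : T.M → L.M} {g : L.M → A.M} {a : T.M → A.M}
    (sl : SmoothSet.IsSmoothRep T.toSmoothSet L.toSmoothSet l)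
    (hg : L.IsSemiconjRep A g) (eg : SmoothSet.IsEmbeddingRep L.toSmoothSet A.toSmoothSet g)
    (ha : T.IsSemiconjRep A a) (h : ∀ᶠ t in 𝓝ˢ T.carrier, g (l t) = a t)
    (hl : MapsTo l T.flow L.flow) : T.IsSemiconjRep L l where
  mapsTo := hl
  semiconj := by
    obtain ⟨U, hU, hLU, hgU, hgi, -⟩ := eg
    have ht := sl.tendsto T.flow_subset hl
    have hm := nhdsSet_mono T.flow_subset
    filter_upwards [ha.semiconj, ht.eventually hg.semiconj, sl.smooth.filter_mono hm,
      ht.eventually (hU.mem_nhdsSet.2 (L.flow_subset.trans hLU)),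
      h.eventually_nhdsSet.filter_mono hm] with t h1 h2 h3 h4 h5
    refine hgi (l t) h4 ?_
    have h6 := mfderiv_of_eventuallyEq_comp rfl
      ((hgU.contMDiffAt (hU.mem_nhds h4)).mdifferentiableAt (by simp))
      (h3.mdifferentiableAt (by simp)) h5 (T.X t)
    have h7 : (A.X (a t) : A.E) = A.X (g (l t)) := congrArg (fun x => (A.X x : A.E))
      (h5.self_of_nhds).symm
    exact h6.symm.trans (h1.trans (h7.trans h2.symm))


namespace HybridSystem

/-! ### Steps -/

theorem Step.inl_inv {K : HybridSystem} {v : K.graph.V} {x y : K.State}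
    (h : K.Step (Sum.inl v) x y) :
    y = x ∧ ∃ l : (K.mode v).carrier, l.1 ∈ (K.mode v).flow ∧ x = ⟨v, l⟩ := by
  cases h with
  | flow v x hx => exact ⟨rfl, x, hx, rfl⟩

theorem Step.inr_inv {K : HybridSystem} {e : K.graph.E} {x y : K.State}
    (h : K.Step (Sum.inr e) x y) :
    ∃ z : K.guard e, x = ⟨K.graph.src e, ⟨z.1, K.guard_subset e z.2⟩⟩ ∧
      y = ⟨K.graph.tgt e, K.reset e z⟩ := by
  cases h with
  | jump e x => exact ⟨x, rfl, rfl⟩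

theorem Step.fst_src {K : HybridSystem} {a : K.graph.V ⊕ K.graph.E} {x y : K.State}
    (h : K.Step a x y) : x.1 = K.graph.gsrc a := by
  cases h <;> rfl

theorem Step.fst_tgt {K : HybridSystem} {a : K.graph.V ⊕ K.graph.E} {x y : K.State}
    (h : K.Step a x y) : y.1 = K.graph.gtgt a := by
  cases h <;> rfl

theorem state_mk_inj {K : HybridSystem} {v : K.graph.V} {x y : (K.mode v).carrier} :
    (⟨v, x⟩ : K.State) = ⟨v, y⟩ ↔ x = y :=
  ⟨fun h => eq_of_heq (Sigma.mk.inj h).2, fun h => by rw [h]⟩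

/-- Resets are maps. This determinism is what makes the ends of two compatible steps match in the
fiber product. -/
theorem Step.unique {K : HybridSystem} {a : K.graph.V ⊕ K.graph.E} {x y y' : K.State}
    (h : K.Step a x y) (h' : K.Step a x y') : y = y' := by
  cases a with
  | inl v => rw [h.inl_inv.1, h'.inl_inv.1]
  | inr e =>
    obtain ⟨z, h1, rfl⟩ := h.inr_inv
    obtain ⟨z', h2, rfl⟩ := h'.inr_inv
    have h3 := state_mk_inj.1 (h1.symm.trans h2)
    have h4 : z = z' := Subtype.ext (congrArg (fun q : (K.mode _).carrier => q.1) h3)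
    rw [h4]

theorem state_ext {K : HybridSystem} {x y : K.State}
    (h : (⟨x.1, x.2.1⟩ : Σ v, (K.mode v).M) = ⟨y.1, y.2.1⟩) : x = y :=
  sigma_subtype_eq (M := fun v => (K.mode v).M) (s := fun v => (K.mode v).carrier) x.2.2 y.2.2 h

theorem stateMap_comp {H K L : HybridSystem} (f : H ⟶ K) (g : K ⟶ L) (x : H.State) :
    stateMap (f ≫ g) x = stateMap g (stateMap f x) :=
  Quotient.inductionOn₂ f g fun _ _ => rfl

theorem graphMap_comp {H K L : HybridSystem} (f : H ⟶ K) (g : K ⟶ L) :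
    graphMap (f ≫ g) = graphMap f ≫ graphMap g :=
  Quotient.inductionOn₂ f g fun _ _ => rfl

theorem step_stateMap {H K : HybridSystem} (f : H ⟶ K) {a : H.graph.V ⊕ H.graph.E}
    {x y : H.State} (h : H.Step a x y) :
    K.Step ((graphMap f).gmap a) (stateMap f x) (stateMap f y) := by
  induction f using Quotient.inductionOn with
  | h r => exact r.step_stateMap h

/-! ### Embeddings, submersions and isomorphisms of hybrid systems -/

/-- All components are embeddings. -/
def Rep.EmbeddingRep {H K : HybridSystem} (r : Rep H K) : Prop :=
  ∀ v, SmoothSet.IsEmbeddingRep (H.mode v).toSmoothSet (K.mode (r.gr.vmap v)).toSmoothSet (r.map v)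

/-- All components are submersions. -/
def Rep.SubmersionRep {H K : HybridSystem} (r : Rep H K) : Prop :=
  ∀ v, SmoothSet.IsSubmersionRep (H.mode v).toSmoothSet (K.mode (r.gr.vmap v)).toSmoothSet
    (r.map v)

theorem IsSubmersion.comp {H K L : HybridSystem} {f : H ⟶ K} {g : K ⟶ L} (hf : IsSubmersion f)
    (hg : IsSubmersion g) : IsSubmersion (f ≫ g) := by
  obtain ⟨r, rfl, hr⟩ := hf
  obtain ⟨q, rfl, hq⟩ := hg
  exact ⟨r.comp q, rfl, fun v =>
    SmoothSet.IsSubmersionRep.comp (f := r.map v) (g := q.map _) (r.isSmooth v) (hr v) (hq _)⟩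

theorem IsEmbedding.comp {H K L : HybridSystem} {f : H ⟶ K} {g : K ⟶ L} (hf : IsEmbedding f)
    (hg : IsEmbedding g) : IsEmbedding (f ≫ g) := by
  obtain ⟨hf, r, rfl, hr⟩ := hf
  obtain ⟨hg, q, rfl, hq⟩ := hg
  refine ⟨?_, r.comp q, rfl,
    fun v => SmoothSet.IsEmbeddingRep.comp (f := r.map v) (g := q.map _)
      (r.isSmooth v) (hr v) (hq _)⟩
  rw [graphMap_comp]
  exact mono_comp _ _

/-- A hybrid embedding is a monomorphism. -/
theorem Rep.equiv_of_comp_embedding {T L K : HybridSystem} {f : Rep L K}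
    (hf : Function.Injective f.gr.gmap) (ef : f.EmbeddingRep) {l l' : Rep T L}
    (h : l.comp f ≈ l'.comp f) : l ≈ l' := by
  have := DirGraph.mono_of_gmap_injective f.gr hf
  have hgr : l.gr = l'.gr := (cancel_mono f.gr).1 h.1
  choose U hU hLU hfU hfi hfe using ef
  have key : ∀ (v v' : L.graph.V) (x : (L.mode v).M) (x' : (L.mode v').M), x ∈ U v → x' ∈ U v' →
      v = v' → (⟨f.gr.vmap v, f.map v x⟩ : Σ u, (K.mode u).M) = ⟨f.gr.vmap v', f.map v' x'⟩ →
      (⟨v, x⟩ : Σ u, (L.mode u).M) = ⟨v', x'⟩ := by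
    rintro v _ x x' hx hx' rfl h
    have h1 : f.map v x = f.map v x' := sigma_mk_inj.1 h
    have h2 := @(hfe v).injective ⟨x, hx⟩ ⟨x', hx'⟩ h1
    exact sigma_mk_inj.2 (congrArg (fun q : U v => q.1) h2)
  refine ⟨hgr, fun t => ?_⟩
  filter_upwards [h.2 t,
    ((l.isSmooth t).tendsto Subset.rfl (l.isSmooth t).mapsTo).eventually
      ((hU _).mem_nhdsSet.2 (hLU _)),
    ((l'.isSmooth t).tendsto Subset.rfl (l'.isSmooth t).mapsTo).eventually
      ((hU _).mem_nhdsSet.2 (hLU _))] with x h1 h2 h3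
  exact key _ _ _ _ h2 h3 (by rw [hgr]) h1

theorem Rep.stateMap_injective_of_embedding {L K : HybridSystem} {f : Rep L K}
    (hf : Function.Injective f.gr.gmap) (ef : f.EmbeddingRep) :
    Function.Injective f.stateMap := by
  rintro ⟨v, x⟩ ⟨v', x'⟩ h
  have h1 : v = v' := Sum.inl_injective (hf (congrArg (fun s : K.State => Sum.inl s.1) h))
  subst h1
  obtain ⟨U, hU, hLU, hfU, hfi, hfe⟩ := ef v
  have h1 : (⟨f.gr.vmap v, f.map v x.1⟩ : Σ u, (K.mode u).M) = ⟨f.gr.vmap v, f.map v x'.1⟩ :=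
    congrArg (fun s : K.State => (⟨s.1, s.2.1⟩ : Σ u, (K.mode u).M)) h
  have h2 : f.map v x.1 = f.map v x'.1 := sigma_mk_inj.1 h1
  have h3 := @hfe.injective ⟨x.1, hLU x.2⟩ ⟨x'.1, hLU x'.2⟩ h2
  rw [state_mk_inj]
  exact Subtype.ext (congrArg (fun q : U => q.1) h3)

/-- The component of an isomorphism at a vertex `ρ w`. The target vertex `u` equals `w` only
propositionally; keeping it a variable allows the substitution that turns the equations in sigma
types into equations of maps. -/
theorem inverse_component {V W : Type} {X : V → Mode} {Y : W → Mode} {ρ : W → V}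
    {g : ∀ w, (Y w).M → (X (ρ w)).M} {w u : W} (hu : u = w) {F : (X (ρ w)).M → (Y u).M}
    (sg : SmoothSet.IsSmoothRep (Y w).toSmoothSet (X (ρ w)).toSmoothSet (g w))
    (sF : SmoothSet.IsSmoothRep (X (ρ w)).toSmoothSet (Y u).toSmoothSet F)
    (h1 : ∀ᶠ x in 𝓝ˢ (X (ρ w)).carrier, (⟨ρ u, g u (F x)⟩ : Σ v, (X v).M) = ⟨ρ w, x⟩)
    (h2 : ∀ᶠ y in 𝓝ˢ (Y w).carrier, (⟨u, F (g w y)⟩ : Σ w, (Y w).M) = ⟨w, y⟩) :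
    SmoothSet.IsSubmersionRep (X (ρ w)).toSmoothSet (Y u).toSmoothSet F ∧
      SmoothSet.IsEmbeddingRep (X (ρ w)).toSmoothSet (Y u).toSmoothSet F := by
  subst hu
  have h1' : ∀ᶠ x in 𝓝ˢ (X (ρ u)).carrier, g u (F x) = x := h1.mono fun x hx => sigma_mk_inj.1 hx
  have h2' : ∀ᶠ y in 𝓝ˢ (Y u).carrier, F (g u y) = y := h2.mono fun x hx => sigma_mk_inj.1 hx
  exact ⟨SmoothSet.isSubmersionRep_of_inverse sF sg h1' h2',
    SmoothSet.isEmbeddingRep_of_inverse sF sg h1'⟩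

theorem isSubmersion_and_isEmbedding_of_iso {L L' : HybridSystem} (φ : L ≅ L') :
    IsSubmersion φ.hom ∧ IsEmbedding φ.hom := by
  obtain ⟨f, g, hfg, hgf⟩ := φ
  obtain ⟨f, rfl⟩ := Quotient.exists_rep f
  obtain ⟨g, rfl⟩ := Quotient.exists_rep g
  have h1 : f.comp g ≈ Rep.id L := Quotient.exact hfg
  have h2 : g.comp f ≈ Rep.id L' := Quotient.exact hgf
  have hv1 : ∀ v, g.gr.vmap (f.gr.vmap v) = v := fun v => congrFun (congrArg DirGraph.Hom.vmap h1.1) v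
  have hv2 : ∀ w, f.gr.vmap (g.gr.vmap w) = w := fun w => congrFun (congrArg DirGraph.Hom.vmap h2.1) w
  have key : ∀ v, SmoothSet.IsSubmersionRep (L.mode v).toSmoothSet
        (L'.mode (f.gr.vmap v)).toSmoothSet (f.map v) ∧
      SmoothSet.IsEmbeddingRep (L.mode v).toSmoothSet
        (L'.mode (f.gr.vmap v)).toSmoothSet (f.map v) := by
    intro v
    obtain ⟨w, rfl⟩ : ∃ w, g.gr.vmap w = v := ⟨_, hv1 v⟩
    exact inverse_component (X := L.mode) (Y := L'.mode) (g := g.map) (hv2 w) (g.isSmooth w)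
      (f.isSmooth _) (h1.2 _) (h2.2 w)
  have hm : f.gr ≫ g.gr = 𝟙 L.graph := h1.1
  have hmono : Mono f.gr := ⟨fun a b hab => by
    have h3 : a ≫ f.gr ≫ g.gr = b ≫ f.gr ≫ g.gr := by
      rw [← Category.assoc, ← Category.assoc, hab]
    rwa [hm, Category.comp_id, Category.comp_id] at h3⟩
  exact ⟨⟨f, rfl, fun v => (key v).1⟩, hmono, f, rfl, fun v => (key v).2⟩

/-! ### Fiber products -/

section FiberProduct

variable {K₁ K₂ H : HybridSystem} {p : Rep K₁ H} {i : Rep K₂ H}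

/-- The vertices of the fiber product. -/
abbrev FiberVert (p : Rep K₁ H) (i : Rep K₂ H) : Type :=
  {v : K₁.graph.V × K₂.graph.V // p.gr.vmap v.1 = i.gr.vmap v.2}

/-- The edges of the fiber product. -/
abbrev FiberEdge (p : Rep K₁ H) (i : Rep K₂ H) : Type :=
  {e : K₁.graph.E × (K₂.graph.V ⊕ K₂.graph.E) // p.gr.emap e.1 = i.gr.gmap e.2}

/-- The graph of the fiber product. -/
def fiberGraph (p : Rep K₁ H) (i : Rep K₂ H) : DirGraph where
  V := FiberVert p i
  E := FiberEdge p i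
  src e := ⟨(K₁.graph.src e.1.1, K₂.graph.gsrc e.1.2), by
    have h1 := p.gr.src_emap e.1.1
    rw [e.2, i.gr.gsrc_gmap] at h1
    exact h1.symm⟩
  tgt e := ⟨(K₁.graph.tgt e.1.1, K₂.graph.gtgt e.1.2), by
    have h1 := p.gr.tgt_emap e.1.1
    rw [e.2, i.gr.gtgt_gmap] at h1
    exact h1.symm⟩

variable (F : ∀ v : FiberVert p i, ModeFiber H.mode (K₁.mode v.1.1) (K₂.mode v.1.2)
  (p.map v.1.1) (i.map v.1.2))

/-- The first component of a state of the fiber product. -/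
def fiberState₁ (v : FiberVert p i) (l : (F v).L.carrier) : K₁.State :=
  ⟨v.1.1, ⟨(F v).fst l.1, (F v).fst_smooth.mapsTo l.2⟩⟩

/-- The second component of a state of the fiber product. -/
def fiberState₂ (v : FiberVert p i) (l : (F v).L.carrier) : K₂.State :=
  ⟨v.1.2, ⟨(F v).snd l.1, (F v).snd_smooth.mapsTo l.2⟩⟩

theorem stateMap_fiberState (v : FiberVert p i) (l : (F v).L.carrier) :
    p.stateMap (fiberState₁ F v l) = i.stateMap (fiberState₂ F v l) :=
  state_ext ((F v).comm.self_of_nhdsSet l.1 l.2)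

theorem exists_fiberState (v : FiberVert p i) {s₁ : K₁.State} {s₂ : K₂.State} (h₁ : s₁.1 = v.1.1)
    (h₂ : s₂.1 = v.1.2) (h : p.stateMap s₁ = i.stateMap s₂) :
    ∃ l : (F v).L.carrier, fiberState₁ F v l = s₁ ∧ fiberState₂ F v l = s₂ := by
  obtain ⟨⟨v₁, v₂⟩, hv⟩ := v
  obtain ⟨w₁, x₁⟩ := s₁
  obtain ⟨w₂, x₂⟩ := s₂
  obtain rfl : w₁ = v₁ := h₁
  obtain rfl : w₂ = v₂ := h₂
  obtain ⟨l, hl, h1, h2⟩ := (F ⟨(w₁, w₂), hv⟩).exists_mem x₁.1 x₁.2 x₂.1 x₂.2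
    (congrArg (fun s : H.State => (⟨s.1, s.2.1⟩ : Σ u, (H.mode u).M)) h)
  exact ⟨⟨l, hl⟩, state_mk_inj.2 (Subtype.ext h1), state_mk_inj.2 (Subtype.ext h2)⟩

/-- The two steps lie over steps of `H` along the same graph element and from the same state. By
`Step.unique` these end at the same state, so the two end states form a state of the fiber product.
-/
theorem exists_fiber_reset (e : FiberEdge p i) (l : (F ((fiberGraph p i).src e)).L.carrier)
    {s₁ : K₁.State} {s₂ : K₂.State}
    (h₁ : K₁.Step (Sum.inr e.1.1) (fiberState₁ F ((fiberGraph p i).src e) l) s₁)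
    (h₂ : K₂.Step e.1.2 (fiberState₂ F ((fiberGraph p i).src e) l) s₂) :
    ∃ l' : (F ((fiberGraph p i).tgt e)).L.carrier,
      K₁.Step (Sum.inr e.1.1) (fiberState₁ F ((fiberGraph p i).src e) l)
        (fiberState₁ F ((fiberGraph p i).tgt e) l') ∧
      K₂.Step e.1.2 (fiberState₂ F ((fiberGraph p i).src e) l)
        (fiberState₂ F ((fiberGraph p i).tgt e) l') := by
  have h3 := p.step_stateMap h₁
  have h4 := i.step_stateMap h₂
  have h5 := stateMap_fiberState F ((fiberGraph p i).src e) l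
  rw [← e.2, ← h5] at h4
  obtain ⟨l', hl1, hl2⟩ := exists_fiberState F ((fiberGraph p i).tgt e) h₁.fst_tgt h₂.fst_tgt
    (h3.unique h4)
  exact ⟨l', hl1 ▸ h₁, hl2 ▸ h₂⟩

/-- The guard of an edge of the fiber product. -/
def fiberGuard (e : FiberEdge p i) : Set (F ((fiberGraph p i).src e)).L.M :=
  {x | ∃ hx : x ∈ (F ((fiberGraph p i).src e)).L.carrier,
    ∃ s₁ s₂, K₁.Step (Sum.inr e.1.1) (fiberState₁ F ((fiberGraph p i).src e) ⟨x, hx⟩) s₁ ∧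
      K₂.Step e.1.2 (fiberState₂ F ((fiberGraph p i).src e) ⟨x, hx⟩) s₂}

theorem exists_reset_of_mem_fiberGuard (e : FiberEdge p i) (x : fiberGuard F e) :
    ∃ l' : (F ((fiberGraph p i).tgt e)).L.carrier,
      K₁.Step (Sum.inr e.1.1) (fiberState₁ F ((fiberGraph p i).src e) ⟨x.1, x.2.choose⟩)
        (fiberState₁ F ((fiberGraph p i).tgt e) l') ∧
      K₂.Step e.1.2 (fiberState₂ F ((fiberGraph p i).src e) ⟨x.1, x.2.choose⟩)
        (fiberState₂ F ((fiberGraph p i).tgt e) l') := by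
  obtain ⟨s₁, s₂, h₁, h₂⟩ := x.2.choose_spec
  exact exists_fiber_reset F e _ h₁ h₂

/-- The fiber product of `p` and `i`. -/
def fiberSystem : HybridSystem where
  graph := fiberGraph p i
  mode v := (F v).L
  guard := fiberGuard F
  guard_subset _ _ hx := hx.choose
  reset e x := (exists_reset_of_mem_fiberGuard F e x).choose

theorem fiber_reset_spec (e : FiberEdge p i) (x : fiberGuard F e) :
    K₁.Step (Sum.inr e.1.1) (fiberState₁ F ((fiberGraph p i).src e) ⟨x.1, x.2.choose⟩)
        (fiberState₁ F ((fiberGraph p i).tgt e) ((fiberSystem F).reset e x)) ∧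
      K₂.Step e.1.2 (fiberState₂ F ((fiberGraph p i).src e) ⟨x.1, x.2.choose⟩)
        (fiberState₂ F ((fiberGraph p i).tgt e) ((fiberSystem F).reset e x)) :=
  (exists_reset_of_mem_fiberGuard F e x).choose_spec

/-- The first projection of the fiber product. -/
def fiberFst : Rep (fiberSystem F) K₁ where
  gr :=
    { vmap := fun v : FiberVert p i => v.1.1
      emap := fun e : FiberEdge p i => Sum.inr e.1.1
      src_emap := fun _ => rfl
      tgt_emap := fun _ => rfl }
  map v := (F v).fst
  isSmooth v := (F v).fst_smooth
  isSemiconj v := (F v).fst_semiconj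
  map_step e x := (fiber_reset_spec F e x).1

/-- The second projection of the fiber product. -/
def fiberSnd : Rep (fiberSystem F) K₂ where
  gr :=
    { vmap := fun v : FiberVert p i => v.1.2
      emap := fun e : FiberEdge p i => e.1.2
      src_emap := fun _ => rfl
      tgt_emap := fun _ => rfl }
  map v := (F v).snd
  isSmooth v := (F v).snd_smooth
  isSemiconj v := (F v).snd_semiconj
  map_step e x := (fiber_reset_spec F e x).2

theorem fiber_comm : (fiberFst F).comp p ≈ (fiberSnd F).comp i :=
  ⟨DirGraph.Hom.ext (funext fun v : FiberVert p i => v.2)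
    (funext fun e : FiberEdge p i => e.2), fun v => (F v).comm⟩

theorem fiberFst_gmap_injective (hi : Function.Injective i.gr.gmap) :
    Function.Injective (fiberFst F).gr.gmap := by
  rintro (⟨⟨v₁, v₂⟩, hv⟩ | ⟨⟨e, a⟩, he⟩) (⟨⟨w₁, w₂⟩, hw⟩ | ⟨⟨e', a'⟩, he'⟩) h
  · obtain rfl : v₁ = w₁ := Sum.inl_injective h
    obtain rfl : v₂ = w₂ := Sum.inl_injective (hi (congrArg Sum.inl (hv.symm.trans hw)))
    rfl
  · exact (Sum.inl_ne_inr h).elim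
  · exact (Sum.inr_ne_inl h).elim
  · obtain rfl : e = e' := Sum.inr_injective h
    obtain rfl : a = a' := hi (he.symm.trans he')
    rfl

theorem fiberFst_embeddingRep : (fiberFst F).EmbeddingRep := fun v => (F v).fst_embedding

theorem fiberSnd_submersionRep : (fiberSnd F).SubmersionRep := fun v => (F v).snd_submersion

/-- If `a₁` is a vertex, then `a₂` is one too, since an injective `i` collapses no edge. This
justifies taking only pairs whose first entry is an edge as edges of the fiber product. -/
theorem exists_fiberElem (hi : Function.Injective i.gr.gmap) {a₁ : K₁.graph.V ⊕ K₁.graph.E}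
    {a₂ : K₂.graph.V ⊕ K₂.graph.E} (h : p.gr.gmap a₁ = i.gr.gmap a₂) :
    ∃ c, (fiberFst F).gr.gmap c = a₁ ∧ (fiberSnd F).gr.gmap c = a₂ := by
  cases a₁ with
  | inl v =>
    have h1 := DirGraph.Hom.eq_inl_of_injective hi h.symm
    rw [h1] at h ⊢
    exact ⟨Sum.inl ⟨(v, _), Sum.inl_injective h⟩, rfl, rfl⟩
  | inr e => exact ⟨Sum.inr ⟨(e, a₂), h⟩, rfl, rfl⟩

/-- Steps of the fiber product are pairs of steps of the factors over the same step. -/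
theorem fiber_step (hi : Function.Injective i.gr.gmap)
    {c : (fiberSystem F).graph.V ⊕ (fiberSystem F).graph.E} {s s' : (fiberSystem F).State}
    (h₁ : K₁.Step ((fiberFst F).gr.gmap c) ((fiberFst F).stateMap s) ((fiberFst F).stateMap s'))
    (h₂ : K₂.Step ((fiberSnd F).gr.gmap c) ((fiberSnd F).stateMap s) ((fiberSnd F).stateMap s')) :
    (fiberSystem F).Step c s s' := by
  have hinj := Rep.stateMap_injective_of_embedding (fiberFst_gmap_injective F hi)
    (fiberFst_embeddingRep F)
  obtain ⟨w, l⟩ := s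
  cases c with
  | inl v =>
    obtain ⟨h3, l₁, hl₁, h4⟩ := h₁.inl_inv
    obtain ⟨-, l₂, hl₂, h5⟩ := h₂.inl_inv
    obtain rfl : s' = ⟨w, l⟩ := hinj h3
    have hw : w = v := Subtype.ext (Prod.ext (congrArg Sigma.fst h4) (congrArg Sigma.fst h5))
    subst hw
    have h6 := congrArg Subtype.val (state_mk_inj.1 h4)
    have h7 := congrArg Subtype.val (state_mk_inj.1 h5)
    refine Step.flow w l ((F w).mem_flow l.1 l.2 ?_ ?_)
    · rw [← h6] at hl₁
      exact hl₁
    · rw [← h7] at hl₂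
      exact hl₂
  | inr e =>
    have hw : w = (fiberGraph p i).src e := Subtype.ext (Prod.ext h₁.fst_src h₂.fst_src)
    subst hw
    have hg : l.1 ∈ (fiberSystem F).guard e := ⟨l.2, _, _, h₁, h₂⟩
    have h3 : (fiberSystem F).Step (Sum.inr e) ⟨_, l⟩ ⟨_, (fiberSystem F).reset e ⟨l.1, hg⟩⟩ :=
      Step.jump e ⟨l.1, hg⟩
    have h4 := (fiberFst F).step_stateMap h3
    rw [← hinj (h4.unique h₁)]
    exact h3

/-- Lifts are chosen separately at each vertex and graph element. Injectivity of the first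
projection on states and of its derivatives makes these choices compatible with steps and vector
fields. -/
theorem exists_fiberLift (hi : Function.Injective i.gr.gmap) {T : HybridSystem} (a : Rep T K₁)
    (b : Rep T K₂) (hab : a.comp p ≈ b.comp i) :
    ∃ l : Rep T (fiberSystem F), l.comp (fiberFst F) ≈ a ∧ l.comp (fiberSnd F) ≈ b := by
  have hV : ∀ t, p.gr.vmap (a.gr.vmap t) = i.gr.vmap (b.gr.vmap t) := fun t =>
    congrFun (congrArg DirGraph.Hom.vmap hab.1) t
  have hE : ∀ e, p.gr.gmap (a.gr.emap e) = i.gr.gmap (b.gr.emap e) := fun e =>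
    congrFun (congrArg DirGraph.Hom.emap hab.1) e
  let V : T.graph.V → FiberVert p i := fun t => ⟨(a.gr.vmap t, b.gr.vmap t), hV t⟩
  choose l hl hla using fun t => (F (V t)).exists_lift _ _ _ (a.isSmooth t) (b.isSmooth t) (hab.2 t)
  choose c hc₁ hc₂ using fun e => exists_fiberElem F hi (hE e)
  let pre : PreRep T (fiberSystem F) :=
    { gr :=
        { vmap := V
          emap := c
          src_emap := fun e => by
            refine Subtype.ext (Prod.ext ?_ ?_)
            · have h := (fiberFst F).gr.gsrc_gmap (c e)
              rw [hc₁, a.gr.src_emap] at h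
              exact h.symm
            · have h := (fiberSnd F).gr.gsrc_gmap (c e)
              rw [hc₂, b.gr.src_emap] at h
              exact h.symm
          tgt_emap := fun e => by
            refine Subtype.ext (Prod.ext ?_ ?_)
            · have h := (fiberFst F).gr.gtgt_gmap (c e)
              rw [hc₁, a.gr.tgt_emap] at h
              exact h.symm
            · have h := (fiberSnd F).gr.gtgt_gmap (c e)
              rw [hc₂, b.gr.tgt_emap] at h
              exact h.symm }
      map := l
      isSmooth := hl }
  have hs₁ : ∀ s, (fiberFst F).stateMap (pre.stateMap s) = a.stateMap s := fun s =>
    state_mk_inj.2 (Subtype.ext ((hla s.1).self_of_nhdsSet s.2.1 s.2.2).1)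
  have hs₂ : ∀ s, (fiberSnd F).stateMap (pre.stateMap s) = b.stateMap s := fun s =>
    state_mk_inj.2 (Subtype.ext ((hla s.1).self_of_nhdsSet s.2.1 s.2.2).2)
  let r : Rep T (fiberSystem F) :=
    { toPreRep := pre
      isSemiconj := fun t => by
        refine Mode.IsSemiconjRep.of_comp (hl t) (F (V t)).fst_semiconj (F (V t)).fst_embedding
          (a.isSemiconj t) ((hla t).mono fun x hx => hx.1) fun x hx => ?_
        have hx' := (T.mode t).flow_subset hx
        have h := (hla t).self_of_nhdsSet x hx'
        refine (F (V t)).mem_flow _ ((hl t).mapsTo hx') ?_ ?_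
        · rw [h.1]
          exact (a.isSemiconj t).mapsTo hx
        · rw [h.2]
          exact (b.isSemiconj t).mapsTo hx
      map_step := fun e x => by
        refine fiber_step F hi ?_ ?_
        · rw [hs₁, hs₁]
          exact (hc₁ e).symm ▸ a.map_step e x
        · rw [hs₂, hs₂]
          exact (hc₂ e).symm ▸ b.map_step e x }
  refine ⟨r, ⟨DirGraph.Hom.ext rfl (funext hc₁), fun t => (hla t).mono fun x hx => ?_⟩,
    ⟨DirGraph.Hom.ext rfl (funext hc₂), fun t => (hla t).mono fun x hx => ?_⟩⟩
  · exact sigma_mk_inj.2 hx.1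
  · exact sigma_mk_inj.2 hx.2

end FiberProduct

end HybridSystem


/-! ### Monomorphisms, pruned subsystems and the universal property -/

namespace HybridSystem

theorem gmap_comp {H K L : HybridSystem} (f : H ⟶ K) (g : K ⟶ L)
    (a : H.graph.V ⊕ H.graph.E) :
    (graphMap (f ≫ g)).gmap a = (graphMap g).gmap ((graphMap f).gmap a) := by
  rw [graphMap_comp, DirGraph.Hom.gmap_comp]

theorem IsEmbedding.gmap_injective {H K : HybridSystem} {f : H ⟶ K} (hf : IsEmbedding f) :
    Function.Injective (graphMap f).gmap :=
  have := hf.1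
  DirGraph.gmap_injective_of_mono _

theorem IsEmbedding.mono {H K : HybridSystem} {f : H ⟶ K} (hf : IsEmbedding f) : Mono f := by
  have hinj := hf.gmap_injective
  obtain ⟨-, r, rfl, hr⟩ := hf
  refine ⟨fun {T} l l' h => ?_⟩
  obtain ⟨l, rfl⟩ := Quotient.exists_rep l
  obtain ⟨l', rfl⟩ := Quotient.exists_rep l'
  exact Quotient.sound (Rep.equiv_of_comp_embedding hinj hr (Quotient.exact h))

/-! ### Pruning -/

/-- The graph of nonempty active sets and nonempty guards. -/
def pruneGraph (L : HybridSystem) : DirGraph where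
  V := {v // (L.mode v).carrier.Nonempty}
  E := {e // (L.guard e).Nonempty}
  src e := ⟨L.graph.src e.1, e.2.mono (L.guard_subset e.1)⟩
  tgt e := ⟨L.graph.tgt e.1, e.2.elim fun x hx => ⟨_, (L.reset e.1 ⟨x, hx⟩).2⟩⟩

/-- The largest pruned subsystem. -/
def prune (L : HybridSystem) : HybridSystem where
  graph := pruneGraph L
  mode v := L.mode v.1
  guard e := L.guard e.1
  guard_subset e := L.guard_subset e.1
  reset e := L.reset e.1

theorem isPruned_prune (L : HybridSystem) : L.prune.IsPruned := ⟨fun v => v.2, fun e => e.2⟩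

/-- The inclusion of the largest pruned subsystem. -/
def pruneIncl (L : HybridSystem) : Rep L.prune L where
  gr :=
    { vmap := fun v => v.1
      emap := fun e => Sum.inr e.1
      src_emap := fun _ => rfl
      tgt_emap := fun _ => rfl }
  map _ x := x
  isSmooth v := SmoothSet.IsSmoothRep.id (L.mode v.1).toSmoothSet
  isSemiconj v := Mode.IsSemiconjRep.id (L.mode v.1)
  map_step e x := Step.jump e.1 x

theorem pruneIncl_gmap_injective (L : HybridSystem) :
    Function.Injective (pruneIncl L).gr.gmap := by
  rintro (⟨v, hv⟩ | ⟨e, he⟩) (⟨w, hw⟩ | ⟨e', he'⟩) h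
  · obtain rfl : v = w := Sum.inl_injective h
    rfl
  · exact (Sum.inl_ne_inr h).elim
  · exact (Sum.inr_ne_inl h).elim
  · obtain rfl : e = e' := Sum.inr_injective h
    rfl

theorem pruneIncl_embeddingRep (L : HybridSystem) : (pruneIncl L).EmbeddingRep := fun v =>
  SmoothSet.IsEmbeddingRep.id (L.mode v.1).toSmoothSet

theorem pruneIncl_submersionRep (L : HybridSystem) : (pruneIncl L).SubmersionRep := fun v =>
  SmoothSet.IsSubmersionRep.id (L.mode v.1).toSmoothSet

theorem prune_step {L : HybridSystem} {c : L.prune.graph.V ⊕ L.prune.graph.E}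
    {s s' : L.prune.State}
    (h : L.Step ((pruneIncl L).gr.gmap c) ((pruneIncl L).stateMap s) ((pruneIncl L).stateMap s')) :
    L.prune.Step c s s' := by
  have hinj := Rep.stateMap_injective_of_embedding (pruneIncl_gmap_injective L)
    (pruneIncl_embeddingRep L)
  obtain ⟨w, l⟩ := s
  cases c with
  | inl v =>
    obtain ⟨h1, l', hl', h2⟩ := h.inl_inv
    obtain rfl : s' = ⟨w, l⟩ := hinj h1
    have hw : w = v := Subtype.ext (congrArg Sigma.fst h2)
    subst hw
    have h3 := congrArg (fun q : (L.mode w.1).carrier => q.1) (state_mk_inj.1 h2)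
    refine Step.flow w l ?_
    rw [← h3] at hl'
    exact hl'
  | inr e =>
    have hw : w = (pruneGraph L).src e := Subtype.ext h.fst_src
    subst hw
    obtain ⟨z, hz, -⟩ := h.inr_inv
    have hz' := congrArg (fun q : (L.mode _).carrier => q.1) (state_mk_inj.1 hz)
    have hg : l.1 ∈ L.guard e.1 := by
      have h1 := z.2
      rw [← hz'] at h1
      exact h1
    have h3 : L.prune.Step (Sum.inr e) ⟨_, l⟩ ⟨_, L.prune.reset e ⟨l.1, hg⟩⟩ :=
      Step.jump e ⟨l.1, hg⟩
    have h4 := (pruneIncl L).step_stateMap h3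
    rw [← hinj (h4.unique h)]
    exact h3

/-- A point of an active set has an image in the target active set, and a point of a guard gives a
step along the image of the edge. Each graph element in the image therefore survives pruning,
whether an edge stays an edge or collapses. -/
theorem exists_pruneLift {T L : HybridSystem} (hT : T.IsPruned) (f : T ⟶ L) :
    ∃ g : T ⟶ L.prune, g ≫ Quotient.mk _ (pruneIncl L) = f := by
  obtain ⟨f, rfl⟩ := Quotient.exists_rep f
  have hc : ∀ e, ∃ c : L.prune.graph.V ⊕ L.prune.graph.E,
      (pruneIncl L).gr.gmap c = f.gr.emap e := by
    intro e
    obtain ⟨x, hx⟩ := hT.2 e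
    have h := f.map_step e ⟨x, hx⟩
    revert h
    generalize f.gr.emap e = a
    intro h
    cases a with
    | inl v =>
      obtain ⟨-, l, -, -⟩ := h.inl_inv
      exact ⟨Sum.inl ⟨v, ⟨l.1, l.2⟩⟩, rfl⟩
    | inr e' =>
      obtain ⟨z, -, -⟩ := h.inr_inv
      exact ⟨Sum.inr ⟨e', ⟨z.1, z.2⟩⟩, rfl⟩
  choose c hc using hc
  let pre : PreRep T L.prune :=
    { gr :=
        { vmap := fun t => ⟨f.gr.vmap t, (hT.1 t).elim fun x hx => ⟨_, (f.isSmooth t).mapsTo hx⟩⟩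
          emap := c
          src_emap := fun e => by
            have h := (pruneIncl L).gr.gsrc_gmap (c e)
            rw [hc, f.gr.src_emap] at h
            exact Subtype.ext h.symm
          tgt_emap := fun e => by
            have h := (pruneIncl L).gr.gtgt_gmap (c e)
            rw [hc, f.gr.tgt_emap] at h
            exact Subtype.ext h.symm }
      map := f.map
      isSmooth := f.isSmooth }
  let r : Rep T L.prune :=
    { toPreRep := pre
      isSemiconj := f.isSemiconj
      map_step := fun e x => prune_step ((hc e).symm ▸ f.map_step e x) }
  exact ⟨Quotient.mk _ r, Quotient.sound
    ⟨DirGraph.Hom.ext rfl (funext hc), fun t => Eventually.of_forall fun x => rfl⟩⟩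

/-! ### Existence of fiber products -/

theorem exists_isFiberProduct {K₁ K₂ H : HybridSystem} {p : K₁ ⟶ H} (hp : IsSubmersion p)
    {i : K₂ ⟶ H} (hi : IsEmbedding i) :
    ∃ (L : HybridSystem) (i' : L ⟶ K₁) (p' : L ⟶ K₂),
      IsFiberProduct (fun _ => True) p i i' p' ∧ IsSubmersion p' ∧ IsEmbedding i' := by
  have hinj := hi.gmap_injective
  obtain ⟨p, rfl, hp⟩ := hp
  obtain ⟨-, i, rfl, hi⟩ := hi
  have F : ∀ v : FiberVert p i, ModeFiber H.mode (K₁.mode v.1.1) (K₂.mode v.1.2)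
      (p.map v.1.1) (i.map v.1.2) := fun v =>
    (nonempty_modeFiber H.mode _ _ _ _ v.2 (p.isSemiconj _) (hp _) (i.isSemiconj _) (hi _)).some
  have hinj₁ := fiberFst_gmap_injective F hinj
  let π : fiberSystem F ⟶ K₁ := Quotient.mk _ (fiberFst F)
  have he : IsEmbedding π :=
    ⟨DirGraph.mono_of_gmap_injective _ hinj₁, fiberFst F, rfl, fiberFst_embeddingRep F⟩
  refine ⟨fiberSystem F, π, Quotient.mk _ (fiberSnd F),
    ⟨trivial, Quotient.sound (fiber_comm F), fun T _ a b hab => ?_⟩,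
    ⟨fiberSnd F, rfl, fiberSnd_submersionRep F⟩, he⟩
  obtain ⟨a, rfl⟩ := Quotient.exists_rep a
  obtain ⟨b, rfl⟩ := Quotient.exists_rep b
  obtain ⟨l, hl₁, hl₂⟩ := exists_fiberLift F hinj a b (Quotient.exact hab)
  have := he.mono
  refine ⟨Quotient.mk _ l, ⟨Quotient.sound hl₁, Quotient.sound hl₂⟩, fun l' hl' => ?_⟩
  rw [← cancel_mono π, hl'.1]
  exact (Quotient.sound hl₁).symm

theorem exists_isFiberProduct_isPruned {K₁ K₂ H : HybridSystem} {p : K₁ ⟶ H} (hp : IsSubmersion p)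
    {i : K₂ ⟶ H} (hi : IsEmbedding i) :
    ∃ (L : HybridSystem) (i' : L ⟶ K₁) (p' : L ⟶ K₂),
      IsFiberProduct IsPruned p i i' p' ∧ IsSubmersion p' ∧ IsEmbedding i' := by
  obtain ⟨L, i', p', ⟨-, hc, hL⟩, hp', hi'⟩ := exists_isFiberProduct hp hi
  let j : L.prune ⟶ L := Quotient.mk _ (pruneIncl L)
  have hj : IsEmbedding j := ⟨DirGraph.mono_of_gmap_injective _ (pruneIncl_gmap_injective L),
    pruneIncl L, rfl, pruneIncl_embeddingRep L⟩
  have hj' : IsSubmersion j := ⟨pruneIncl L, rfl, pruneIncl_submersionRep L⟩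
  have := hj.mono
  refine ⟨L.prune, j ≫ i', j ≫ p', ⟨isPruned_prune L, ?_, fun T hT a b hab => ?_⟩,
    hj'.comp hp', hj.comp hi'⟩
  · rw [Category.assoc, hc, Category.assoc]
  obtain ⟨l, hl, hlu⟩ := hL T trivial a b hab
  obtain ⟨g, rfl⟩ := exists_pruneLift hT l
  simp only [Category.assoc] at hl
  refine ⟨g, hl, fun g' hg' => ?_⟩
  rw [← cancel_mono j]
  refine hlu _ ?_
  simpa only [Category.assoc] using hg'

section General

variable {P : HybridSystem → Prop} {K₁ K₂ H L : HybridSystem} {p : K₁ ⟶ H} {i : K₂ ⟶ H}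
  {i' : L ⟶ K₁} {p' : L ⟶ K₂}

theorem IsFiberProduct.exists_iso (h : IsFiberProduct P p i i' p') {L' : HybridSystem}
    {i'' : L' ⟶ K₁} {p'' : L' ⟶ K₂} (h' : IsFiberProduct P p i i'' p'') :
    ∃ φ : L ≅ L', φ.hom ≫ i'' = i' ∧ φ.hom ≫ p'' = p' := by
  obtain ⟨hL, hc, hu⟩ := h
  obtain ⟨hL', hc', hu'⟩ := h'
  obtain ⟨f, hf, -⟩ := hu' L hL i' p' hc
  obtain ⟨g, hg, -⟩ := hu L' hL' i'' p'' hc'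
  refine ⟨⟨f, g, ?_, ?_⟩, hf⟩
  · refine (hu L hL i' p' hc).unique ⟨?_, ?_⟩ ⟨Category.id_comp _, Category.id_comp _⟩
    · rw [Category.assoc, hg.1, hf.1]
    · rw [Category.assoc, hg.2, hf.2]
  · refine (hu' L' hL' i'' p'' hc').unique ⟨?_, ?_⟩ ⟨Category.id_comp _, Category.id_comp _⟩
    · rw [Category.assoc, hf.1, hg.1]
    · rw [Category.assoc, hf.2, hg.2]

theorem IsFiberProduct.isSubmersion_isEmbedding (h : IsFiberProduct P p i i' p')
    (hex : ∃ (L : HybridSystem) (i' : L ⟶ K₁) (p' : L ⟶ K₂),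
      IsFiberProduct P p i i' p' ∧ IsSubmersion p' ∧ IsEmbedding i') :
    IsSubmersion p' ∧ IsEmbedding i' := by
  obtain ⟨L', i'', p'', h', hp, hi⟩ := hex
  obtain ⟨φ, rfl, rfl⟩ := h.exists_iso h'
  have hφ := isSubmersion_and_isEmbedding_of_iso φ
  exact ⟨hφ.1.comp hp, hφ.2.comp hi⟩

end General

/-! ### Test systems -/

/-- The real line, with active set `{0}` and empty flow set. -/
def pointMode : Mode where
  E := ℝ
  M := ℝ
  carrier := {0}
  X := fun _ => (0 : ℝ)
  smooth_X := contMDiff_vectorSpace_iff_contDiff.2 contDiff_const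
  flow := ∅
  flow_subset := empty_subset _

/-- The system with a single state and no flow. -/
def pointSystem : HybridSystem where
  graph := ⟨Unit, Empty, Empty.elim, Empty.elim⟩
  mode _ := pointMode
  guard e := e.elim
  guard_subset e := e.elim
  reset e := e.elim

theorem isPruned_pointSystem : pointSystem.IsPruned := ⟨fun _ => ⟨(0 : ℝ), rfl⟩, fun e => e.elim⟩

theorem isSmoothRep_const (A B : SmoothSet) {y : B.M} (hy : y ∈ B.carrier) :
    SmoothSet.IsSmoothRep A B (fun _ => y) :=
  ⟨Eventually.of_forall fun _ => contMDiffAt_const, fun _ _ => hy⟩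

theorem isSemiconjRep_of_flow_eq_empty {A B : Mode} (hA : A.flow = ∅) (f : A.M → B.M) :
    A.IsSemiconjRep B f where
  mapsTo _ hx := (hA.le hx).elim
  semiconj := mem_nhdsSet_iff_forall.2 fun _ h => (hA.le h).elim

/-- The morphism from `pointSystem` that picks the state `x`. -/
def pointRep {K : HybridSystem} (x : K.State) : Rep pointSystem K where
  gr :=
    { vmap := fun _ => x.1
      emap := fun e => Empty.elim e
      src_emap := fun e => Empty.elim e
      tgt_emap := fun e => Empty.elim e }
  map _ _ := x.2.1
  isSmooth _ := isSmoothRep_const _ _ x.2.2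
  isSemiconj _ := isSemiconjRep_of_flow_eq_empty rfl _
  map_step e := Empty.elim e

/-- The morphism from `pointSystem` that picks the state `x`. -/
def pointHom {K : HybridSystem} (x : K.State) : pointSystem ⟶ K := Quotient.mk _ (pointRep x)

theorem pointHom_comp {K H : HybridSystem} (x : K.State) (f : K ⟶ H) :
    pointHom x ≫ f = pointHom (stateMap f x) := by
  obtain ⟨f, rfl⟩ := Quotient.exists_rep f
  exact Quotient.sound ⟨DirGraph.Hom.ext rfl (funext fun e => Empty.elim e),
    fun _ => Eventually.of_forall fun _ => rfl⟩

/-- The system with a single step, between states `false` and `true`. -/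
def stepSystem : HybridSystem where
  graph := DirGraph.arrow
  mode _ := pointMode
  guard _ := ({0} : Set ℝ)
  guard_subset _ := Subset.rfl
  reset _ x := x

theorem isPruned_stepSystem : stepSystem.IsPruned :=
  ⟨fun _ => ⟨(0 : ℝ), rfl⟩, fun _ => ⟨(0 : ℝ), rfl⟩⟩

/-- The morphism from `stepSystem` given by a step. -/
def stepRep {K : HybridSystem} {a : K.graph.V ⊕ K.graph.E} {x y : K.State} (h : K.Step a x y) :
    Rep stepSystem K where
  gr :=
    { vmap := fun c : Bool => (bif c then y else x).1
      emap := fun _ => a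
      src_emap := fun _ => h.fst_src.symm
      tgt_emap := fun _ => h.fst_tgt.symm }
  map c _ := (bif c then y else x).2.1
  isSmooth _ := isSmoothRep_const _ _ (Subtype.property _)
  isSemiconj _ := isSemiconjRep_of_flow_eq_empty rfl _
  map_step _ _ := h

/-- The morphism from `stepSystem` given by a step. -/
def stepHom {K : HybridSystem} {a : K.graph.V ⊕ K.graph.E} {x y : K.State} (h : K.Step a x y) :
    stepSystem ⟶ K := Quotient.mk _ (stepRep h)

theorem stepHom_comp {K H : HybridSystem} {a : K.graph.V ⊕ K.graph.E} {x y : K.State}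
    (h : K.Step a x y) (f : K ⟶ H) : stepHom h ≫ f = stepHom (step_stateMap f h) := by
  obtain ⟨f, rfl⟩ := Quotient.exists_rep f
  refine Quotient.sound ⟨DirGraph.Hom.ext (funext fun c : Bool => ?_) rfl,
    fun c : Bool => Eventually.of_forall fun _ => ?_⟩ <;> cases c <;> rfl

theorem stepHom_congr {K : HybridSystem} {a a' : K.graph.V ⊕ K.graph.E} {x y x' y' : K.State}
    (h : K.Step a x y) (h' : K.Step a' x' y') (ha : a = a') (hx : x = x') :
    stepHom h = stepHom h' := by
  subst ha hx
  obtain rfl := h.unique h'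
  rfl

/-- The graph with a single edge, with empty active sets. -/
def edgeSystem : HybridSystem where
  graph := DirGraph.arrow
  mode _ := emptyMode
  guard _ := (∅ : Set ℝ)
  guard_subset _ := Subset.rfl
  reset _ x := x

/-- The morphism from `edgeSystem` that picks a vertex or an edge. -/
def edgeRep {K : HybridSystem} (a : K.graph.V ⊕ K.graph.E) : Rep edgeSystem K where
  gr := DirGraph.Hom.ofElem a
  map _ _ := Classical.arbitrary _
  isSmooth _ := ⟨Eventually.of_forall fun _ => contMDiffAt_const, fun _ h => h.elim⟩
  isSemiconj _ := isSemiconjRep_of_flow_eq_empty rfl _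
  map_step _ x := x.2.elim

/-- The morphism from `edgeSystem` that picks a vertex or an edge. -/
def edgeHom {K : HybridSystem} (a : K.graph.V ⊕ K.graph.E) : edgeSystem ⟶ K :=
  Quotient.mk _ (edgeRep a)

theorem edgeHom_comp {K H : HybridSystem} (a : K.graph.V ⊕ K.graph.E) (f : K ⟶ H) :
    edgeHom a ≫ f = edgeHom ((graphMap f).gmap a) := by
  obtain ⟨f, rfl⟩ := Quotient.exists_rep f
  refine Quotient.sound ⟨DirGraph.Hom.ext (funext fun c : Bool => ?_) rfl,
    fun c : Bool => mem_nhdsSet_iff_forall.2 fun _ h => h.elim⟩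
  cases c
  · exact (f.gr.gsrc_gmap a).symm
  · exact (f.gr.gtgt_gmap a).symm

/-! ### Properties of fiber products -/

section Properties

variable {P : HybridSystem → Prop} {K₁ K₂ H L : HybridSystem} {p : K₁ ⟶ H} {i : K₂ ⟶ H}
  {i' : L ⟶ K₁} {p' : L ⟶ K₂}

theorem IsFiberProduct.stateMap_comm (h : IsFiberProduct P p i i' p') (l : L.State) :
    stateMap p (stateMap i' l) = stateMap i (stateMap p' l) := by
  rw [← stateMap_comp, ← stateMap_comp, h.2.1]

theorem IsFiberProduct.gmap_comm (h : IsFiberProduct P p i i' p')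
    (a : L.graph.V ⊕ L.graph.E) :
    (graphMap p).gmap ((graphMap i').gmap a) = (graphMap i).gmap ((graphMap p').gmap a) := by
  rw [← gmap_comp, ← gmap_comp, h.2.1]

/-- The states of a fiber product are the pairs of states with the same image. -/
theorem IsFiberProduct.exists_state (h : IsFiberProduct P p i i' p') (hP : ∀ T, IsPruned T → P T)
    {x : K₁.State} {y : K₂.State} (hxy : stateMap p x = stateMap i y) :
    ∃ l, stateMap i' l = x ∧ stateMap p' l = y := by
  obtain ⟨l, ⟨h1, h2⟩, -⟩ := h.2.2 pointSystem (hP _ isPruned_pointSystem) (pointHom x)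
    (pointHom y) (by rw [pointHom_comp, pointHom_comp, hxy])
  let o : pointSystem.State := ⟨(), ⟨(0 : ℝ), rfl⟩⟩
  refine ⟨stateMap l o, ?_, ?_⟩
  · rw [← stateMap_comp, h1]
    rfl
  · rw [← stateMap_comp, h2]
    rfl

/-- The lift is tested on `stepSystem`. Only equality of the starting states is assumed, as equality
of the end states follows by `Step.unique`. -/
theorem IsFiberProduct.exists_step (h : IsFiberProduct P p i i' p') (hP : ∀ T, IsPruned T → P T)
    {a₁ : K₁.graph.V ⊕ K₁.graph.E} {a₂ : K₂.graph.V ⊕ K₂.graph.E} {x₁ y₁ : K₁.State}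
    {x₂ y₂ : K₂.State} (h₁ : K₁.Step a₁ x₁ y₁) (h₂ : K₂.Step a₂ x₂ y₂)
    (ha : (graphMap p).gmap a₁ = (graphMap i).gmap a₂) (hx : stateMap p x₁ = stateMap i x₂) :
    ∃ c, (graphMap i').gmap c = a₁ ∧ (graphMap p').gmap c = a₂ := by
  obtain ⟨l, ⟨h3, h4⟩, -⟩ := h.2.2 stepSystem (hP _ isPruned_stepSystem) (stepHom h₁)
    (stepHom h₂) (by
      rw [stepHom_comp, stepHom_comp]
      exact stepHom_congr _ _ ha hx)
  refine ⟨(graphMap l).gmap (Sum.inr ()), ?_, ?_⟩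
  · rw [← gmap_comp, h3]
    rfl
  · rw [← gmap_comp, h4]
    rfl

/-- The test system `edgeSystem` has empty active sets, so this argument is confined to `𝐇_∅`; no
points in the guards are needed. -/
theorem IsFiberProduct.exists_elem (h : IsFiberProduct (fun _ => True) p i i' p')
    {a₁ : K₁.graph.V ⊕ K₁.graph.E} {a₂ : K₂.graph.V ⊕ K₂.graph.E}
    (ha : (graphMap p).gmap a₁ = (graphMap i).gmap a₂) :
    ∃ c, (graphMap i').gmap c = a₁ ∧ (graphMap p').gmap c = a₂ := by
  obtain ⟨l, ⟨h3, h4⟩, -⟩ := h.2.2 edgeSystem trivial (edgeHom a₁) (edgeHom a₂) (by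
      rw [edgeHom_comp, edgeHom_comp, ha])
  refine ⟨(graphMap l).gmap (Sum.inr ()), ?_, ?_⟩
  · rw [← gmap_comp, h3]
    rfl
  · rw [← gmap_comp, h4]
    rfl

theorem IsFiberProduct.coversActive (h : IsFiberProduct P p i i' p') (hP : ∀ T, IsPruned T → P T)
    (hp : CoversActive p) : CoversActive p' := by
  intro u y
  obtain ⟨v, x, hx⟩ := hp (stateMap i ⟨u, y⟩).1 (stateMap i ⟨u, y⟩).2
  obtain ⟨l, -, hl⟩ := h.exists_state hP hx
  exact ⟨l.1, l.2, hl⟩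

theorem IsFiberProduct.range_stateMap (h : IsFiberProduct P p i i' p')
    (hP : ∀ T, IsPruned T → P T) :
    range (stateMap i') = stateMap p ⁻¹' range (stateMap i) := by
  ext x
  constructor
  · rintro ⟨l, rfl⟩
    exact ⟨stateMap p' l, (h.stateMap_comm l).symm⟩
  · rintro ⟨y, hy⟩
    obtain ⟨l, hl, -⟩ := h.exists_state hP hy.symm
    exact ⟨l, hl⟩

theorem IsFiberProduct.epi_of_epi (h : IsFiberProduct (fun _ => True) p i i' p')
    (hp : Epi (graphMap p)) : Epi (graphMap p') := by
  rw [DirGraph.epi_iff_gmap_surjective] at hp ⊢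
  intro a₂
  obtain ⟨a₁, ha⟩ := hp ((graphMap i).gmap a₂)
  obtain ⟨c, -, hc⟩ := h.exists_elem ha
  exact ⟨c, hc⟩

theorem vmap_surjective_of_coversActive {K L : HybridSystem} {f : L ⟶ K} (hK : K.IsPruned)
    (hf : CoversActive f) (v : K.graph.V) : ∃ w, (graphMap f).vmap w = v := by
  obtain ⟨f, rfl⟩ := Quotient.exists_rep f
  obtain ⟨y, hy⟩ := hK.1 v
  obtain ⟨w, x, hx⟩ := hf v ⟨y, hy⟩
  exact ⟨w, congrArg Sigma.fst hx⟩

theorem IsFiberProduct.epi_iff (h : IsFiberProduct IsPruned p i i' p') (hi : IsEmbedding i)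
    (hK₂ : K₂.IsPruned) (hc : CoversActive p') :
    Epi (graphMap p') ↔ ∀ e₂ : K₂.graph.E, ∃ e₁ : K₁.graph.E,
      (graphMap p).emap e₁ = (graphMap i).emap e₂ ∧ ∃ (x₁ : K₁.guard e₁) (x₂ : K₂.guard e₂),
        stateMap p ⟨_, ⟨x₁.1, K₁.guard_subset e₁ x₁.2⟩⟩ =
          stateMap i ⟨_, ⟨x₂.1, K₂.guard_subset e₂ x₂.2⟩⟩ := by
  rw [DirGraph.epi_iff_gmap_surjective]
  constructor
  · intro hs e₂
    obtain ⟨c, hc⟩ := hs (Sum.inr e₂)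
    have hcomm := h.gmap_comm c
    rw [hc] at hcomm
    -- Since `i` is monic, `i e₂` is not a vertex; hence the element of `K₁` over it is not a vertex
    -- either.
    have hne : ∀ u, (graphMap i).gmap (Sum.inr e₂) ≠ Sum.inl u := fun u hu =>
      Sum.inr_ne_inl (DirGraph.Hom.eq_inl_of_injective hi.gmap_injective hu)
    cases c with
    | inl w => exact (Sum.inl_ne_inr hc).elim
    | inr e =>
      -- As `L` is pruned, the edge has a guard point. Its two projections are the required
      -- compatible points.
      obtain ⟨x, hx⟩ := h.1.2 e
      have hstep := Step.jump e ⟨x, hx⟩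
      have h₁ := step_stateMap i' hstep
      have h₂ := step_stateMap p' hstep
      have hs' := h.stateMap_comm ⟨_, ⟨x, L.guard_subset e hx⟩⟩
      rw [hc] at h₂
      obtain ⟨x₂, hx₂, -⟩ := h₂.inr_inv
      revert h₁ hcomm
      generalize (graphMap i').gmap (Sum.inr e) = a₁
      intro hcomm h₁
      cases a₁ with
      | inl v₁ => exact (hne _ hcomm.symm).elim
      | inr e₁ =>
        obtain ⟨x₁, hx₁, -⟩ := h₁.inr_inv
        refine ⟨e₁, hcomm, x₁, x₂, ?_⟩
        rw [← hx₁, ← hx₂]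
        exact hs'
  · intro hE a₂
    cases a₂ with
    | inl v =>
      obtain ⟨w, hw⟩ := vmap_surjective_of_coversActive hK₂ hc v
      exact ⟨Sum.inl w, congrArg Sum.inl hw⟩
    | inr e₂ =>
      obtain ⟨e₁, he, x₁, x₂, hx⟩ := hE e₂
      obtain ⟨c, -, hc⟩ := h.exists_step (fun _ h => h) (Step.jump e₁ x₁) (Step.jump e₂ x₂) he hx
      exact ⟨c, hc⟩

/-- Pasting of fiber products. -/
theorem IsFiberProduct.paste (h : IsFiberProduct P p i i' p') {T S : HybridSystem} {χ : T ⟶ K₂}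
    {χ' : S ⟶ K₁} {ξ : S ⟶ T} (h' : IsFiberProduct P p (χ ≫ i) χ' ξ) :
    ∃ χ'' : S ⟶ L, IsFiberProduct P p' χ χ'' ξ := by
  obtain ⟨hS, hc', hu'⟩ := h'
  obtain ⟨hL, hc, hu⟩ := h
  obtain ⟨χ'', ⟨h1, h2⟩, h3⟩ := hu S hS χ' (ξ ≫ χ) (by rw [hc', Category.assoc])
  refine ⟨χ'', hS, h2, fun R hR a b hab => ?_⟩
  have hcomm : (a ≫ i') ≫ p = b ≫ χ ≫ i := by
    rw [Category.assoc, hc, ← Category.assoc, hab, Category.assoc]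
  obtain ⟨l, ⟨h4, h5⟩, h6⟩ := hu' R hR (a ≫ i') b hcomm
  refine ⟨l, ⟨?_, h5⟩, ?_⟩
  · refine (hu R hR (a ≫ i') (b ≫ χ) (by rw [hcomm, Category.assoc])).unique ⟨?_, ?_⟩ ⟨rfl, hab⟩
    · rw [Category.assoc, h1, h4]
    · rw [Category.assoc, h2, ← Category.assoc, h5]
  · rintro l' ⟨h7, h8⟩
    refine h6 l' ⟨?_, h8⟩
    rw [← h7, Category.assoc, h1]

/-- The subdivision `p` supplies a fiber product over the composite execution `χ ≫ i`. By pasting,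
the same refinement is a fiber product of `p'` with `χ`. -/
theorem IsFiberProduct.isSubdivision (h : IsFiberProduct IsPruned p i i' p')
    (hK₂ : K₂.IsPruned) (hp' : IsSubmersion p') (hp : IsSubdivision p) : IsSubdivision p' := by
  refine ⟨h.1, hK₂, hp', fun τ χ => ?_⟩
  obtain ⟨σ, ξ, χ', hξ, hf⟩ := hp.2.2.2 τ (χ ≫ i)
  obtain ⟨χ'', h''⟩ := h.paste hf
  exact ⟨σ, ξ, χ'', hξ, h''⟩

end Properties

end HybridSystem


namespace TimeTrajectory

open HybridSystem

/-! ### Points of time trajectories -/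

/-- The time of a state of a time trajectory. -/
def time {σ : TimeTrajectory} (s : σ.toSystem.State) : ℝ := s.2.1

theorem time_mem {σ : TimeTrajectory} (s : σ.toSystem.State) : time s ∈ σ.active s.1.1 := s.2.2

/-- The state of time `t` in mode `j`. -/
def point (σ : TimeTrajectory) (j : ℕ) (hj : (j : ℕ∞) < σ.N) (t : ℝ) (ht : t ∈ σ.active j) :
    σ.toSystem.State := ⟨⟨j, hj⟩, ⟨t, ht⟩⟩

theorem state_ext {σ : TimeTrajectory} {s s' : σ.toSystem.State} (h : s.1.1 = s'.1.1)
    (ht : time s = time s') : s = s' := by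
  obtain ⟨⟨j, hj⟩, ⟨x, hx⟩⟩ := s
  obtain ⟨⟨j', hj'⟩, ⟨x', hx'⟩⟩ := s'
  obtain rfl : j = j' := h
  obtain rfl : x = x' := ht
  rfl

theorem τ_le_τ {σ : TimeTrajectory} {j k : ℕ} (hjk : j ≤ k) (hk : (k : ℕ∞) ≤ σ.N) :
    σ.τ j ≤ σ.τ k := by
  induction k, hjk using Nat.le_induction with
  | base => exact le_rfl
  | succ k hjk ih =>
    exact (ih (le_trans (by exact_mod_cast Nat.le_succ k) hk)).trans
      (σ.mono k (by exact_mod_cast hk))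

theorem τ_nonneg {σ : TimeTrajectory} {j : ℕ} (hj : (j : ℕ∞) ≤ σ.N) : 0 ≤ σ.τ j := by
  have h := τ_le_τ (σ := σ) (Nat.zero_le j) hj
  rwa [σ.τ_zero] at h

theorem exists_coe_τ {σ : TimeTrajectory} {j : ℕ} (hj : (j : ℕ∞) < σ.N) :
    ∃ t : ℝ, (t : EReal) = σ.τ j :=
  ⟨(σ.τ j).toReal, EReal.coe_toReal (σ.ne_top j hj)
    (ne_bot_of_le_ne_bot EReal.zero_ne_bot (τ_nonneg hj.le))⟩

theorem time_nonneg {σ : TimeTrajectory} (s : σ.toSystem.State) : 0 ≤ time s := by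
  have h : (0 : EReal) ≤ (time s : EReal) := (τ_nonneg s.1.2.le).trans (time_mem s).1
  exact_mod_cast h

theorem time_eq_of_step {σ : TimeTrajectory} {a : σ.toSystem.graph.V ⊕ σ.toSystem.graph.E}
    {s s' : σ.toSystem.State} (h : σ.toSystem.Step a s s') : time s' = time s := by
  cases h <;> rfl

/-- A time trajectory is infinite if and only if it has points of arbitrarily large time. -/
theorem isInfinite_iff {σ : TimeTrajectory} :
    σ.IsInfinite ↔ ∀ C : ℝ, ∃ s : σ.toSystem.State, C ≤ time s := by
  constructor
  · intro h C
    have hC : (C : EReal) < σ.stopTime := by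
      rw [h]
      exact EReal.coe_lt_top C
    obtain ⟨j, hj, hCj⟩ : ∃ j : ℕ, ∃ _ : (j : ℕ∞) ≤ σ.N, (C : EReal) < σ.τ j := by
      simpa only [stopTime, lt_iSup_iff] using hC
    have key : ∀ k : ℕ, (k : ℕ∞) < σ.N → (C : EReal) < σ.τ k →
        ∃ s : σ.toSystem.State, C ≤ time s := by
      intro k hk hCk
      obtain ⟨t, ht⟩ := exists_coe_τ hk
      refine ⟨σ.point k hk t (σ.mem_active_left hk ht), ?_⟩
      rw [← ht] at hCk
      exact le_of_lt (by exact_mod_cast hCk)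
    rcases hj.lt_or_eq with hj' | hj'
    · exact key j hj' hCj
    cases j with
    | zero =>
      have h1 := σ.one_le
      rw [← hj'] at h1
      exact absurd h1 (by simp)
    | succ k =>
      have hk : (k : ℕ∞) < σ.N := lt_of_lt_of_le (by exact_mod_cast Nat.lt_succ_self k) hj
      -- The final value `τ_N` may be infinite or not attained, so if `τ_{N-1} ≤ C` the time `C`
      -- itself, a point of the last flow interval, is used.
      by_cases hCk : (C : EReal) < σ.τ k
      · exact key k hk hCk
      · exact ⟨σ.point k hk C ((σ.mode k).flow_subset ⟨not_lt.1 hCk, hCj⟩), le_rfl⟩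
  · intro h
    refine EReal.eq_top_iff_forall_lt _ |>.2 fun C => ?_
    obtain ⟨s, hs⟩ := h (C + 1)
    have h1 : ((s.1.1 + 1 : ℕ) : ℕ∞) ≤ σ.N := by
      push_cast
      exact Order.add_one_le_of_lt s.1.2
    have h2 : σ.τ (s.1.1 + 1) ≤ σ.stopTime := le_iSup₂ (f := fun (j : ℕ) (_ : (j : ℕ∞) ≤ σ.N) => σ.τ j)
      (s.1.1 + 1) h1
    have h3 : (C : EReal) < (time s : EReal) := by
      exact_mod_cast lt_of_lt_of_le (lt_add_one C) hs
    exact h3.trans_le ((time_mem s).2.1.trans h2)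

/-! ### Refinements preserve time -/

section Refinement

variable {σ τ : TimeTrajectory}

/-- On a flow interval `h` has derivative `1`, so `h z - z` has right derivative zero. The right end
`y` need not be a flow point; continuity there is enough. -/
theorem translation_of_rep (r : Rep σ.toSystem τ.toSystem) {j : ℕ} (hj : (j : ℕ∞) < σ.N)
    {x y : ℝ} (hx : x ∈ σ.active j) (hy : y ∈ σ.active j) (hxy : x ≤ y) :
    time (r.stateMap (σ.point j hj y hy)) - y = time (r.stateMap (σ.point j hj x hx)) - x := by
  let h : ℝ → ℝ := r.map ⟨j, hj⟩
  have hI : ∀ z ∈ Icc x y, z ∈ σ.active j := fun z hz =>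
    ⟨hx.1.trans (EReal.coe_le_coe_iff.2 hz.1), (EReal.coe_le_coe_iff.2 hz.2).trans hy.2.1,
      fun h1 h2 => (EReal.coe_le_coe_iff.2 hz.2).trans_lt (hy.2.2 h1 h2)⟩
  have hF : ∀ z ∈ Ico x y, z ∈ σ.flow j := fun z hz =>
    ⟨hx.1.trans (EReal.coe_le_coe_iff.2 hz.1), (EReal.coe_lt_coe_iff.2 hz.2).trans_le hy.2.1⟩
  have hs : ∀ z ∈ σ.active j, ContMDiffAt 𝓘(ℝ, ℝ) 𝓘(ℝ, ℝ) ∞ h z := fun z hz =>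
    (r.isSmooth ⟨j, hj⟩).smooth.self_of_nhdsSet z hz
  have hd : ∀ z ∈ σ.flow j, (mfderiv 𝓘(ℝ, ℝ) 𝓘(ℝ, ℝ) h z : ℝ →L[ℝ] ℝ) 1 = 1 := fun z hz =>
    (r.isSemiconj ⟨j, hj⟩).semiconj.self_of_nhdsSet z hz
  have hc : ContinuousOn (fun z => h z - z) (Icc x y) := fun z hz =>
    ((hs z (hI z hz)).continuousAt.sub continuousAt_id).continuousWithinAt
  have hderiv : ∀ z ∈ Ico x y, HasDerivWithinAt (fun z => h z - z) 0 (Ici z) z := by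
    intro z hz
    have h1 : DifferentiableAt ℝ h z :=
      ((hs z (hI z ⟨hz.1, hz.2.le⟩)).contDiffAt).differentiableAt (by simp)
    have h2 := hd z (hF z hz)
    rw [mfderiv_eq_fderiv] at h2
    have h5 : deriv h z = 1 := fderiv_apply_one_eq_deriv.symm.trans h2
    have h3 : HasDerivAt h 1 z := h5 ▸ h1.hasDerivAt
    have h4 := h3.sub (hasDerivAt_id z)
    rw [sub_self] at h4
    exact h4.hasDerivWithinAt
  exact constant_of_has_deriv_right_zero hc hderiv y ⟨hxy, le_rfl⟩

theorem translation (ξ : σ.toSystem ⟶ τ.toSystem) {j : ℕ} (hj : (j : ℕ∞) < σ.N)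
    {x y : ℝ} (hx : x ∈ σ.active j) (hy : y ∈ σ.active j) :
    time (stateMap ξ (σ.point j hj y hy)) - y = time (stateMap ξ (σ.point j hj x hx)) - x := by
  obtain ⟨r, rfl⟩ := Quotient.exists_rep ξ
  rcases le_total x y with h | h
  · exact translation_of_rep r hj hx hy h
  · exact (translation_of_rep r hj hy hx h).symm

/-- Semiconjugacies of time trajectories are translations of time. -/
theorem time_stateMap (ξ : σ.toSystem ⟶ τ.toSystem) (s : σ.toSystem.State) :
    time (stateMap ξ s) = time s + time (stateMap ξ σ.start) := by
  have key : ∀ (j : ℕ) (hj : (j : ℕ∞) < σ.N) (x : ℝ) (hx : x ∈ σ.active j),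
      time (stateMap ξ (σ.point j hj x hx)) - x = time (stateMap ξ σ.start) := by
    intro j
    induction j with
    | zero =>
      intro hj x hx
      have h0 : (0 : ℝ) ∈ σ.active 0 := σ.mem_active_left hj (by rw [σ.τ_zero]; rfl)
      rw [translation ξ hj h0 hx, sub_zero]
      rfl
    | succ j ih =>
      intro hj x hx
      have hj' : (j : ℕ∞) < σ.N := lt_trans (by exact_mod_cast Nat.lt_succ_self j) hj
      obtain ⟨t, ht⟩ := exists_coe_τ hj
      have h1 : σ.toSystem.Step (Sum.inr ⟨j, hj⟩)
          (σ.point j hj' t (σ.mem_active_right hj ht))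
          (σ.point (j + 1) hj t (σ.mem_active_left hj ht)) :=
        Step.jump (H := σ.toSystem) ⟨j, hj⟩ ⟨t, ht⟩
      rw [translation ξ hj (σ.mem_active_left hj ht) hx, time_eq_of_step (step_stateMap ξ h1)]
      exact ih hj' t _
  have h := key s.1.1 s.1.2 (time s) (time_mem s)
  exact (sub_eq_iff_eq_add'.1 h)

variable {ξ : σ.toSystem ⟶ τ.toSystem}

/-- Some state is sent to the start of `τ`, so its time plus the translation is zero. Both are
nonnegative, hence the translation vanishes. -/
theorem time_stateMap_eq (hξ : CoversActive ξ) (s : σ.toSystem.State) :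
    time (stateMap ξ s) = time s := by
  obtain ⟨v, x, h⟩ := hξ τ.start.1 τ.start.2
  have h1 := time_stateMap ξ ⟨v, x⟩
  have h2 : time (stateMap ξ ⟨v, x⟩) = 0 := congrArg time h
  have h3 := time_nonneg (σ := σ) ⟨v, x⟩
  have h4 := time_nonneg (stateMap ξ σ.start)
  have h5 := time_stateMap ξ s
  linarith

theorem vmap_zero_le (f : σ.graph ⟶ τ.graph) (h0 : ((0 : ℕ) : ℕ∞) < σ.N) (j : ℕ)
    (hj : (j : ℕ∞) < σ.N) : (f.vmap ⟨0, h0⟩).1 ≤ (f.vmap ⟨j, hj⟩).1 := by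
  induction j with
  | zero => exact le_rfl
  | succ j ih =>
    have hj' : (j : ℕ∞) < σ.N := lt_trans (by exact_mod_cast Nat.lt_succ_self j) hj
    refine (ih hj').trans ?_
    let e : σ.graph.E := ⟨j, hj⟩
    have h1 : τ.graph.gsrc (f.emap e) = f.vmap ⟨j, hj'⟩ := f.src_emap e
    have h2 : τ.graph.gtgt (f.emap e) = f.vmap ⟨j + 1, hj⟩ := f.tgt_emap e
    rw [← h1, ← h2]
    rcases f.emap e with v | e'
    · exact le_rfl
    · exact Nat.le_succ e'.1

/-- Time `0` may belong to several modes, so the mode has to be checked as well. Some vertex is sent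
to `0`, and along the path the image of the vertex `0` is the least one. -/
theorem stateMap_start (hξ : CoversActive ξ) : stateMap ξ σ.start = τ.start := by
  refine state_ext ?_ (time_stateMap_eq hξ σ.start)
  obtain ⟨v, x, h⟩ := hξ τ.start.1 τ.start.2
  obtain ⟨r, rfl⟩ := Quotient.exists_rep ξ
  have h1 : (r.gr.vmap v).1 = 0 := congrArg (fun s : τ.toSystem.State => s.1.1) h
  have h2 := vmap_zero_le r.gr σ.start.1.2 v.1 v.2
  have h3 : (r.gr.vmap ⟨v.1, v.2⟩).1 = 0 := h1
  rw [h3] at h2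
  exact Nat.le_zero.1 h2

theorem isInfinite_of_coversActive (hξ : CoversActive ξ) (hτ : τ.IsInfinite) : σ.IsInfinite := by
  rw [isInfinite_iff] at hτ ⊢
  intro C
  obtain ⟨s, hs⟩ := hτ C
  obtain ⟨v, x, h⟩ := hξ s.1 s.2
  refine ⟨⟨v, x⟩, ?_⟩
  rw [← time_stateMap_eq hξ, h]
  exact hs

end Refinement

/-! ### Restarting a time trajectory -/

section Tail

theorem natCast_add_lt {N : ℕ∞} {j k : ℕ} : (j : ℕ∞) < N - k ↔ ((j + k : ℕ) : ℕ∞) < N := by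
  cases N with
  | top => simp
  | coe n =>
    norm_cast
    omega

theorem natCast_add_le {N : ℕ∞} {j k : ℕ} (hk : (k : ℕ∞) ≤ N) :
    (j : ℕ∞) ≤ N - k ↔ ((j + k : ℕ) : ℕ∞) ≤ N := by
  cases N with
  | top => simp
  | coe n =>
    norm_cast at *
    omega

theorem natCast_add_eq {N : ℕ∞} {j k : ℕ} (hk : (k : ℕ∞) ≤ N) :
    (j : ℕ∞) = N - k ↔ ((j + k : ℕ) : ℕ∞) = N := by
  cases N with
  | top => simp
  | coe n =>
    norm_cast at *
    omega

variable (σ : TimeTrajectory) {k : ℕ} (hk : (k : ℕ∞) < σ.N) (h0 : σ.τ k = 0)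

/-- The part of a time trajectory from its `k`-th mode on, if this mode starts at time `0`. -/
def tail : TimeTrajectory where
  N := σ.N - k
  τ j := σ.τ (j + k)
  closed := σ.closed
  one_le := by
    have h : ((1 : ℕ) : ℕ∞) ≤ σ.N - k := by
      rw [natCast_add_le hk.le, add_comm]
      push_cast
      exact Order.add_one_le_of_lt hk
    exact_mod_cast h
  τ_zero := by rw [zero_add, h0]
  mono j hj := by
    have h : ((j + 1 : ℕ) : ℕ∞) ≤ σ.N - k := by exact_mod_cast hj
    rw [natCast_add_le hk.le, add_right_comm] at h
    rw [add_right_comm]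
    exact σ.mono (j + k) (by exact_mod_cast h)
  ne_top j hj := σ.ne_top _ (natCast_add_lt.1 hj)
  finite_of_closed h := lt_of_le_of_lt tsub_le_self (σ.finite_of_closed h)
  closed_of_eq j hj he := by
    have h : ((j + 1 : ℕ) : ℕ∞) = σ.N - k := by exact_mod_cast hj
    rw [natCast_add_eq hk.le, add_right_comm] at h
    rw [add_right_comm] at he
    exact σ.closed_of_eq (j + k) (by exact_mod_cast h) he

theorem tail_active (j : ℕ) : (σ.tail hk h0).active j = σ.active (j + k) := by
  have h1 : (j : ℕ∞) + 1 = σ.N - k ↔ ((j + k : ℕ) : ℕ∞) + 1 = σ.N := by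
    have := natCast_add_eq (N := σ.N) (j := j + 1) hk.le
    rw [add_right_comm] at this
    exact_mod_cast this
  ext x
  simp only [active, tail, mem_ofPred_eq, h1, add_right_comm j 1 k]

theorem tail_flow (j : ℕ) : (σ.tail hk h0).flow j = σ.flow (j + k) := by
  ext x
  simp only [flow, tail, mem_ofPred_eq, add_right_comm j 1 k]

/-- The inclusion of a tail. -/
def tailPreRep : PreRep (σ.tail hk h0).toSystem σ.toSystem where
  gr :=
    { vmap := fun j => ⟨j.1 + k, natCast_add_lt.1 j.2⟩
      emap := fun e => Sum.inr ⟨e.1 + k, by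
        have h := natCast_add_lt.1 e.2
        rwa [add_right_comm] at h⟩
      src_emap := fun _ => rfl
      tgt_emap := fun e => Subtype.ext (add_right_comm e.1 k 1) }
  map _ x := x
  isSmooth j := ⟨Eventually.of_forall fun _ => contMDiffAt_id, fun x hx => by
    have h : x ∈ (σ.tail hk h0).active j.1 := hx
    rw [tail_active] at h
    exact h⟩

/-- The inclusion of a tail. -/
def tailRep : Rep (σ.tail hk h0).toSystem σ.toSystem where
  toPreRep := σ.tailPreRep hk h0
  isSemiconj j := by
    refine ⟨fun x hx => ?_, (Mode.IsSemiconjRep.id ((σ.tail hk h0).mode j.1)).semiconj⟩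
    have h : x ∈ (σ.tail hk h0).flow j.1 := hx
    rw [tail_flow] at h
    exact h
  map_step e x := by
    have he : ((e.1 + k + 1 : ℕ) : ℕ∞) < σ.N := by
      have h := natCast_add_lt.1 e.2
      rwa [add_right_comm] at h
    have hx : (show ℝ from x.1) ∈ σ.toSystem.guard ⟨e.1 + k, he⟩ := by
      have h : ((show ℝ from x.1 : ℝ) : EReal) = σ.τ (e.1 + 1 + k) := x.2
      rw [add_right_comm] at h
      exact h
    have h := Step.jump (H := σ.toSystem) ⟨e.1 + k, he⟩ ⟨x.1, hx⟩
    -- The modes `e + 1 + k` and `e + k + 1` agree only propositionally, so the end state of the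
    -- jump has to be transported.
    refine Eq.mp (congrArg (σ.toSystem.Step _ _) ?_) h
    exact state_ext (add_right_comm e.1 k 1) rfl

/-- Every point of time `0` is the start of an infinite time trajectory. -/
theorem exists_restart {σ : TimeTrajectory} (hσ : σ.IsInfinite) (q : σ.toSystem.State)
    (hq : time q = 0) :
    ∃ (ρ : TimeTrajectory) (η : ρ.toSystem ⟶ σ.toSystem), ρ.IsInfinite ∧
      stateMap η ρ.start = q := by
  have h0 : σ.τ q.1.1 = 0 := by
    refine le_antisymm ?_ (τ_nonneg q.1.2.le)
    have h := (time_mem q).1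
    rw [hq] at h
    exact h
  refine ⟨σ.tail q.1.2 h0, Quotient.mk _ (σ.tailRep q.1.2 h0), ?_, ?_⟩
  · rw [isInfinite_iff] at hσ ⊢
    intro C
    -- A time of at least `1` forces the mode of `s` to be no earlier than that of `q`: every
    -- earlier mode ends by `τ_k = 0`.
    obtain ⟨s, hs⟩ := hσ (max C 1)
    have hle : q.1.1 ≤ s.1.1 := by
      by_contra hlt
      have h1 : s.1.1 + 1 ≤ q.1.1 := by omega
      have h2 := (time_mem s).2.1.trans (τ_le_τ h1 q.1.2.le)
      rw [h0] at h2
      have h3 : time s ≤ 0 := by exact_mod_cast h2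
      have h4 := (le_max_right C 1).trans hs
      linarith
    have hj : s.1.1 - q.1.1 + q.1.1 = s.1.1 := Nat.sub_add_cancel hle
    refine ⟨(σ.tail q.1.2 h0).point (s.1.1 - q.1.1) ?_ (time s) ?_, (le_max_left C 1).trans hs⟩
    · refine natCast_add_lt.2 ?_
      rw [hj]
      exact s.1.2
    · rw [tail_active, hj]
      exact time_mem s
  · exact state_ext (zero_add _) hq.symm

end Tail

end TimeTrajectory


/-! ### Limit sets, attractors and trapping regions under subdivisions -/

namespace HybridSystem

theorem continuous_stateMap {H K : HybridSystem} (f : H ⟶ K) : Continuous (stateMap f) := by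
  obtain ⟨f, rfl⟩ := Quotient.exists_rep f
  refine continuous_sigma fun v => ?_
  have h : Continuous fun x : (H.mode v).carrier => f.map v x.1 :=
    continuous_iff_continuousAt.2 fun x => ContinuousAt.comp (f := Subtype.val)
      ((f.isSmooth v).smooth.self_of_nhdsSet x.1 x.2).continuousAt continuousAt_subtype_val
  have h' := h.subtype_mk (p := (· ∈ (K.mode (f.gr.vmap v)).carrier))
    fun x => (f.isSmooth v).mapsTo x.2
  exact (continuous_sigmaMk (σ := fun u => ↥(K.mode u).carrier) (i := f.gr.vmap v)).comp h'

section Dynamics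

variable {S H : HybridSystem} {σ : TimeTrajectory}

theorem at_time_comp (χ : σ.toSystem ⟶ S) (p : S ⟶ H) (t : ℝ) :
    at_time (χ ≫ p) t = stateMap p '' at_time χ t := by
  rw [at_time, at_time, image_image]
  exact image_congr fun x _ => stateMap_comp χ p x

theorem IsInfiniteFrom.comp {χ : σ.toSystem ⟶ S} {x : S.State} (h : IsInfiniteFrom χ x)
    (p : S ⟶ H) : IsInfiniteFrom (χ ≫ p) (stateMap p x) :=
  ⟨h.1, by rw [stateMap_comp, h.2]⟩

theorem PositivelyInvariant.preimage {A : Set H.State} (hA : PositivelyInvariant H A)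
    (p : S ⟶ H) : PositivelyInvariant S (stateMap p ⁻¹' A) := by
  intro x hx σ χ hχ t ht
  have h := hA _ hx σ (χ ≫ p) (hχ.comp p) t ht
  rw [at_time_comp] at h
  exact image_subset_iff.1 h

/-- Executions of `S` project to `H`. Conversely, if `p y` is reached at time `t` by an execution of
`H`, the pair of `y` and the point reaching it is a state of the fiber product, so the lifted
execution passes through `y` at the same time. Its start lies over the original start, hence over
`W`. -/
theorem IsSubdivision.limitSet_preimage {p : S ⟶ H} (hp : IsSubdivision p) (W : Set H.State) :
    limitSet S (stateMap p ⁻¹' W) = stateMap p ⁻¹' limitSet H W := by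
  ext y
  constructor
  · intro hy t ht
    obtain ⟨x, hx, σ, χ, hχ, hy⟩ := hy t ht
    refine ⟨_, hx, σ, χ ≫ p, hχ.comp p, ?_⟩
    rw [at_time_comp]
    exact mem_image_of_mem _ hy
  · intro hy t ht
    obtain ⟨x, hx, τ, χ, hχ, s, hs, hsy⟩ := hy t ht
    obtain ⟨σ, ξ, χ', hξ, hf⟩ := hp.2.2.2 τ χ
    obtain ⟨q, hqy, hqs⟩ := hf.exists_state (fun _ h => h) hsy.symm
    refine ⟨stateMap χ' σ.start, ?_, σ, χ',
      ⟨TimeTrajectory.isInfinite_of_coversActive hξ.2.2 hχ.1, rfl⟩, q, ?_, hqy⟩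
    · rw [mem_preimage, hf.stateMap_comm, TimeTrajectory.stateMap_start hξ.2.2, hχ.2]
      exact hx
    · have h := TimeTrajectory.time_stateMap_eq hξ.2.2 q
      rw [hqs] at h
      exact h.symm.trans hs

/-- The lifted execution starts over `p x` but perhaps not at `x`. It does pass through `x` at time
`0`, possibly in a later mode, and is restarted from that mode. -/
theorem IsSubdivision.exists_isInfiniteFrom {p : S ⟶ H} (hp : IsSubdivision p) {x : S.State}
    (hx : ∃ (τ : TimeTrajectory) (χ : τ.toSystem ⟶ H), IsInfiniteFrom χ (stateMap p x)) :
    ∃ (σ : TimeTrajectory) (χ : σ.toSystem ⟶ S), IsInfiniteFrom χ x := by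
  obtain ⟨τ, χ, hτ, hχ⟩ := hx
  obtain ⟨σ, ξ, χ', hξ, hf⟩ := hp.2.2.2 τ χ
  obtain ⟨q, hqx, hqs⟩ := hf.exists_state (fun _ h => h) hχ.symm
  have hq : TimeTrajectory.time q = 0 := by
    have h := TimeTrajectory.time_stateMap_eq hξ.2.2 q
    rw [hqs] at h
    exact h.symm
  obtain ⟨ρ, η, hρ, hη⟩ := TimeTrajectory.exists_restart
    (TimeTrajectory.isInfinite_of_coversActive hξ.2.2 hτ) q hq
  exact ⟨ρ, η ≫ χ', hρ, by rw [stateMap_comp, hη, hqx]⟩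

theorem IsAttractingWith.preimage {p : S ⟶ H} (hp : IsSubdivision p) {A W : Set H.State}
    (h : IsAttractingWith H A W) :
    IsAttractingWith S (stateMap p ⁻¹' A) (stateMap p ⁻¹' W) := by
  refine ⟨h.1.preimage p, ?_, ?_⟩
  · refine mem_nhdsSet_iff_forall.2 fun x hx => ?_
    exact (continuous_stateMap p).continuousAt (mem_nhdsSet_iff_forall.1 h.2.1 _ hx)
  · rw [hp.limitSet_preimage, ← h.2.2]

theorem IsTrappingRegion.preimage {p : S ⟶ H} (hp : IsSubdivision p) {W : Set H.State}
    (h : IsTrappingRegion H W) : IsTrappingRegion S (stateMap p ⁻¹' W) := by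
  obtain ⟨hex, hinv, T, hT, hW⟩ := h
  have hc := continuous_stateMap p
  refine ⟨fun w hw => hp.exists_isInfiniteFrom (hex _ hw), hinv.preimage p, T, hT, ?_⟩
  intro x hx σ χ hχ t ht
  have h := hW _ (hc.closure_preimage_subset W hx) σ (χ ≫ p) (hχ.comp p) t ht
  rw [at_time_comp] at h
  exact (image_subset_iff.1 h).trans (preimage_interior_subset_interior_preimage hc)

end Dynamics

end HybridSystem

end Hybrid

end

/-! ### The theorem on fiber products of submersions and embeddings -/

theorem mainTheorem8 {K₁ K₂ H : Hybrid.HybridSystem}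
    (hK₁ : K₁.IsPruned) (hK₂ : K₂.IsPruned) (hH : H.IsPruned)
    (i : K₂ ⟶ H) (hi : Hybrid.HybridSystem.IsEmbedding i)
    (p : K₁ ⟶ H) (hp : Hybrid.HybridSystem.IsSubmersion p) :
    -- the fiber product exists in `𝐇`
    (∃ (L : Hybrid.HybridSystem) (i' : L ⟶ K₁) (p' : L ⟶ K₂),
      Hybrid.HybridSystem.IsFiberProduct Hybrid.HybridSystem.IsPruned p i i' p') ∧
    -- properties of the fiber product in `𝐇`
    (∀ (L : Hybrid.HybridSystem) (i' : L ⟶ K₁) (p' : L ⟶ K₂),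
      Hybrid.HybridSystem.IsFiberProduct Hybrid.HybridSystem.IsPruned p i i' p' →
        Hybrid.HybridSystem.IsSubmersion p' ∧
        Hybrid.HybridSystem.IsEmbedding i' ∧
        (Hybrid.HybridSystem.IsSubdivision p → Hybrid.HybridSystem.IsSubdivision p') ∧
        (Hybrid.HybridSystem.IsSurjectiveSubmersion p →
          Hybrid.HybridSystem.CoversActive p' ∧
          (Hybrid.HybridSystem.IsSurjectiveSubmersion p' ↔
            ∀ e₂ : K₂.graph.E, ∃ e₁ : K₁.graph.E,
              (Hybrid.HybridSystem.graphMap p).emap e₁ =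
                (Hybrid.HybridSystem.graphMap i).emap e₂ ∧
              ∃ (x₁ : K₁.guard e₁) (x₂ : K₂.guard e₂),
                Hybrid.HybridSystem.stateMap p ⟨_, ⟨x₁.1, K₁.guard_subset e₁ x₁.2⟩⟩ =
                  Hybrid.HybridSystem.stateMap i ⟨_, ⟨x₂.1, K₂.guard_subset e₂ x₂.2⟩⟩)) ∧
        (Hybrid.HybridSystem.IsSubdivision p → ∀ W : Set H.State,
          (H.IsAttractingWith (Set.range (Hybrid.HybridSystem.stateMap i)) W →
            K₁.IsAttractingWith (Set.range (Hybrid.HybridSystem.stateMap i'))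
              (Hybrid.HybridSystem.stateMap p ⁻¹' W)) ∧
          (H.IsTrappingRegion W →
            K₁.IsTrappingRegion (Hybrid.HybridSystem.stateMap p ⁻¹' W)))) ∧
    -- the fiber product exists in `𝐇_∅`
    (∃ (L : Hybrid.HybridSystem) (i' : L ⟶ K₁) (p' : L ⟶ K₂),
      Hybrid.HybridSystem.IsFiberProduct (fun _ => True) p i i' p') ∧
    -- properties of the fiber product in `𝐇_∅`
    (∀ (L : Hybrid.HybridSystem) (i' : L ⟶ K₁) (p' : L ⟶ K₂),
      Hybrid.HybridSystem.IsFiberProduct (fun _ => True) p i i' p' →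
        Hybrid.HybridSystem.IsSubmersion p' ∧
        Hybrid.HybridSystem.IsEmbedding i' ∧
        (Hybrid.HybridSystem.IsSurjectiveSubmersion p →
          Hybrid.HybridSystem.IsSurjectiveSubmersion p')) := by

  have hexP := Hybrid.HybridSystem.exists_isFiberProduct_isPruned hp hi
  have hexT := Hybrid.HybridSystem.exists_isFiberProduct hp hi
  refine ⟨?_, ?_, ?_, ?_⟩
  · obtain ⟨L, i', p', h, -⟩ := hexP
    exact ⟨L, i', p', h⟩
  · intro L i' p' h
    obtain ⟨hp', hi'⟩ := h.isSubmersion_isEmbedding hexP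
    refine ⟨hp', hi', h.isSubdivision hK₂ hp', fun hps => ?_, fun hpd W => ⟨fun hW => ?_,
      fun hW => hW.preimage hpd⟩⟩
    · have hc := h.coversActive (fun _ h => h) hps.2.2
      have he := h.epi_iff hi hK₂ hc
      exact ⟨hc, fun hs => he.1 hs.2.1, fun hE => ⟨hp', he.2 hE, hc⟩⟩
    · rw [h.range_stateMap fun _ h => h]
      exact hW.preimage hpd
  · obtain ⟨L, i', p', h, -⟩ := hexT
    exact ⟨L, i', p', h⟩
  · intro L i' p' h
    obtain ⟨hp', hi'⟩ := h.isSubmersion_isEmbedding hexT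
    exact ⟨hp', hi', fun hps =>
      ⟨hp', h.epi_of_epi hps.2.1, h.coversActive (fun _ _ => trivial) hps.2.2⟩⟩
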